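/- Let $\lambda>0$. Let $\cdots<y_{-1}<y_0\le 0<y_1<y_2<\cdots$ be the points, labelled in increasing order, of a homogeneous Poisson process of intensity $\lambda$ on $\mathbb R$, and for each $i\in\mathbb Z$ let $0<d_{i,i}<d_{i,i+1}<\cdots$ be the points of a Poisson process of intensity $1$ on $(0,\infty)$, all these Poisson processes being independent. The slow-to-start traffic model is the following. Car $j\in\mathbb Z$ starts at time $0$ at $y_j$ with speed $0$. For $i\le j$, the arrival time $A(i,j)$ of car $j$ at the position $y_i$ and its departure time $D(i,j)$ from $y_i$ are defined by $A(i,i)=0$, $D(i,i)=d_{i,i}$ and, for $i<j$, \[ A(i,j)=D(i+1,j)+y_{i+1}-y_i,\qquad D(i,j)=\begin{cases}A(i,j),& A(i,j)>D(i,j-1),\\ d_{i,j},&\text{otherwise.}\end{cases} \] The position and speed of car $j$ at time $t\ge 0$ are \[ (\pi_j(t),v_j(t))=\begin{cases}(y_i,0),& A(i,j)\le t<D(i,j),\\ (y_i-t+D(i,j),\,1),& D(i,j)\le t<A(i-1,j).\end{cases} \] Let $\mathbf y(t)=\{\pi_j(t): v_j(t)=0,\ j\in\mathbb Z\}$ be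 the set of positions of the stopped cars (the traffic jams) and $\mathbf y^1(t)=\{\pi_j(t): v_j(t)=1,\ j\in\mathbb Z\}$ the set of positions of the moving cars at time $t$. Then $\mathbf y(t)\to\emptyset$ almost surely as $t\to\infty$, that is, almost surely, for every compact $K\subset\mathbb R$ one has $\mathbf y(t)\cap K=\emptyset$ for all sufficiently large $t$. Moreover, almost surely $\mathbf y^1(t)$ is locally finite for all $t\ge 0$, and, as $t\to\infty$, $\mathbf y^1(t)$ converges in distribution, as a random locally finite point configuration on $\mathbb R$ with the vague topology, to a homogeneous Poisson process on $\mathbb R$ of intensity $\min\{1,\lambda\}$. -/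

import Mathlib

open MeasureTheory ProbabilityTheory Filter Topology
open scoped ENNReal CompactlySupported

noncomputable section

namespace Traffic

/-- The random set `X` of points of `ℝ` is a Poisson process with intensity measure `ν`: the
number of points in each Borel set is a random variable, it is Poisson distributed with mean
`ν B` whenever `ν B` is finite, and the numbers of points in finitely many pairwise disjoint
Borel sets are independent. -/
structure IsPoissonProcess {Ω : Type*} [MeasurableSpace Ω] (P : Measure Ω) (ν : Measure ℝ)
    (X : Ω → Set ℝ) : Prop where
  measurable_count : ∀ B : Set ℝ, MeasurableSet B → Measurable fun ω => (X ω ∩ B).encard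
  law_count : ∀ B : Set ℝ, MeasurableSet B → ν B ≠ ∞ →
    P.map (fun ω => (X ω ∩ B).encard)
      = (poissonMeasure (ν B).toNNReal).map (fun n : ℕ => (n : ℕ∞))
  indep_count : ∀ (n : ℕ) (B : Fin n → Set ℝ), (∀ l, MeasurableSet (B l)) →
    Pairwise (fun l m => Disjoint (B l) (B m)) →
    iIndepFun (fun l ω => (X ω ∩ B l).encard) P

/-- The Lebesgue measure times `r`, the intensity measure of a homogeneous Poisson process on
`ℝ` with intensity `r`. -/
def homogeneous (r : ℝ) : Measure ℝ := ENNReal.ofReal r • volume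

/-- The random input of the traffic model with parameter `lam`. The car positions at time `0`
are the points `y i`, `i ∈ ℤ`, of a Poisson process of intensity `lam` on `ℝ`, labelled in
increasing order with `y 0 ≤ 0 < y 1`. For each site `i` the numbers
`0 < d i 0 < d i 1 < ⋯` are the points of a Poisson process of intensity `1` on `(0, ∞)`;
`d i k` is the potential departure time of car `i + k` from the position `y i`. All these
Poisson processes are independent. -/
structure IsInput {Ω : Type*} [MeasurableSpace Ω] (P : Measure Ω) (lam : ℝ)
    (y : ℤ → Ω → ℝ) (d : ℤ → ℕ → Ω → ℝ) : Prop where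
  measurable_y : ∀ i, Measurable (y i)
  measurable_d : ∀ i k, Measurable (d i k)
  strictMono_y : ∀ᵐ ω ∂P, StrictMono fun i => y i ω
  label_y : ∀ᵐ ω ∂P, y 0 ω ≤ 0 ∧ 0 < y 1 ω
  poisson_y : IsPoissonProcess P (homogeneous lam) fun ω => Set.range fun i => y i ω
  strictMono_d : ∀ i, ∀ᵐ ω ∂P, StrictMono fun k => d i k ω
  pos_d : ∀ i, ∀ᵐ ω ∂P, 0 < d i 0 ω
  poisson_d : ∀ i, IsPoissonProcess P (volume.restrict (Set.Ioi 0))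
    fun ω => Set.range fun k => d i k ω
  indep_d : iIndepFun (fun (i : ℤ) ω (k : ℕ) => d i k ω) P
  indep_y_d : IndepFun (fun ω (i : ℤ) => y i ω) (fun ω (i : ℤ) (k : ℕ) => d i k ω) P

/-- `dep y d k i` is the departure time `D(i, i + k)` of car `i + k` from the position `y i`:
car `i` leaves `y i` at time `d i 0`, and car `i + k + 1`, which arrives at `y i` at time
`a = D(i + 1, i + k + 1) + y (i + 1) - y i`, passes `y i` without stopping if car `i + k` has
already left `y i`, and otherwise stops there until time `d i (k + 1)`. -/
def dep (y : ℤ → ℝ) (d : ℤ → ℕ → ℝ) : ℕ → ℤ → ℝ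
  | 0, i => d i 0
  | k + 1, i =>
    if dep y d k i < dep y d k (i + 1) + y (i + 1) - y i
    then dep y d k (i + 1) + y (i + 1) - y i
    else d i (k + 1)

/-- `arr y d k i` is the arrival time `A(i, i + k)` of car `i + k` at the position `y i`. -/
def arr (y : ℤ → ℝ) (d : ℤ → ℕ → ℝ) : ℕ → ℤ → ℝ
  | 0, _ => 0
  | k + 1, i => dep y d k (i + 1) + y (i + 1) - y i

/-- `CarState y d j t x s`: at time `t` car `j` is at position `x` and has speed `s`. Between its
arrival at `y i` and its departure from there (with `j = i + k`) the car is at `y i` and has speed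
`0`; between its departure from `y i` and its arrival at `y (i - 1)` it moves to the left with
speed `1`. -/
inductive CarState (y : ℤ → ℝ) (d : ℤ → ℕ → ℝ) (j : ℤ) (t : ℝ) : ℝ → ℕ → Prop
  | stopped (i : ℤ) (k : ℕ) (hj : j = i + k) (h₁ : arr y d k i ≤ t) (h₂ : t < dep y d k i) :
      CarState y d j t (y i) 0
  | moving (i : ℤ) (k : ℕ) (hj : j = i + k) (h₁ : dep y d k i ≤ t)
      (h₂ : t < arr y d (k + 1) (i - 1)) :
      CarState y d j t (y i - t + dep y d k i) 1

/-- The traffic jams at time `t`: the set of positions of the stopped cars. -/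
def jams (y : ℤ → ℝ) (d : ℤ → ℕ → ℝ) (t : ℝ) : Set ℝ := {x | ∃ j, CarState y d j t x 0}

/-- The set of positions of the moving cars at time `t`. -/
def movingCars (y : ℤ → ℝ) (d : ℤ → ℕ → ℝ) (t : ℝ) : Set ℝ := {x | ∃ j, CarState y d j t x 1}

/-- A set of reals is locally finite if it has finitely many points in each compact set. -/
def IsLocFinite (S : Set ℝ) : Prop := ∀ K : Set ℝ, IsCompact K → (S ∩ K).Finite

/-- The space of point configurations: locally finite subsets of `ℝ`, identified with
simple locally finite counting measures. -/
def Config : Type := {S : Set ℝ // IsLocFinite S}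

/-- The vague topology: the coarsest one for which `S ↦ ∑ x ∈ S, f x` is continuous for every
compactly supported continuous `f`. -/
instance : TopologicalSpace Config :=
  TopologicalSpace.induced (fun (S : Config) (f : C_c(ℝ, ℝ)) => ∑ᶠ x ∈ S.1, f x) inferInstance

instance : MeasurableSpace Config := borel Config

instance : BorelSpace Config := ⟨rfl⟩

open Classical in
/-- A locally finite set as a point configuration (the empty configuration if the set is not
locally finite). -/
def toConfig (S : Set ℝ) : Config :=
  if h : IsLocFinite S then ⟨S, h⟩ else ⟨∅, fun K _ => by simp⟩

end Traffic

end

/-!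
The slow-to-start model is a system of single server queues in tandem. While a car moves, its
position plus the time is constant; `phase y d i k` is this number for car `i + k` behind the site
`y i`. The recursion for `dep` says that the phases at a site are the departure times of a queue
(`lindley`) with arrival times `y i, y (i + 1), …` and certain service times `service y d i`. These
are computed, car by car, from the service times at the site `y (i + 1)` and the clock at `y i`
(`service_eq_run`): a service time `x` at `y (i + 1)` that exceeds a certain level `g` gives
the service time `x - g`, otherwise the clock supplies a fresh exponential variable. By the lack of
memory of the exponential distribution the result is exponential whatever `g` is
(`map_memoryless_swap`). Hence, for given positions of the cars, the service times at each site are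
independent exponential variables of rate one (`measurePreserving_serviceOf`).

Once a car passes a site without stopping, all later cars do. If this never happened at `y i`, the
clock at `y i` would stay ahead of the sum of the service times at `y (i + 1)`, and a symmetric
random walk would be bounded from above, which has probability zero (`ae_exists_psum_gt`). So each
site is cleared after finitely many cars, compact sets become free of jams, and in a window around
the origin the moving cars are, at late times `t`, the phases at the site `y 1` shifted by `t`
(`eventually_mem_movingCars_iff`).

It remains to see that the departures from the queue at `y 1` look like a Poisson process at late
times, that is, that the distances between them are independent exponential variables.

* For `1 ≤ lam`, at a late time, the work that has arrived since a suitable earlier moment exceeds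
  the time since then by any given amount: seen backwards in time this is again a statement about
  the difference of two random walks. The server is then busy throughout the window, and the
  departures are the partial sums of the service times as seen from the left of the window. By the
  lack of memory these are exponential of rate one (`map_restart`).
* For `lam < 1` the queue is coupled to one in equilibrium that has the same arrivals after the
  origin. The two coalesce (`exists_lindley_eq`), and the distances between the departures from the
  queue in equilibrium are exponential of rate `lam` by Burke's theorem (`map_burke`).

The limit law is that of the initial positions multiplied by `lam / min 1 lam`. Convergence in
distribution follows from agreement in windows up to events of small probability
(`tendstoInDistribution_of_window`), because open sets of configurations are increasing unions
of open sets that depend on one window only. The link between the Poisson processes of the statement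
and exponential distances is `IsPoissonProcess.map_gap`: both laws give the same probabilities that
the first points lie in given ordered intervals.
-/

noncomputable section

namespace Traffic

/-! ### The exponential distribution -/

lemma lintegral_expMeasure {r : ℝ} {f : ℝ → ℝ≥0∞} (hf : Measurable f) :
    ∫⁻ x, f x ∂expMeasure r
      = ∫⁻ x in Set.Ioi 0, ENNReal.ofReal (r * Real.exp (-(r * x))) * f x := by
  have h : expMeasure r = volume.withDensity (exponentialPDF r) := rfl
  rw [h, lintegral_withDensity_eq_lintegral_mul _ (by
    unfold exponentialPDF; exact (measurable_exponentialPDFReal r).ennreal_ofReal) hf,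
    ← lintegral_indicator measurableSet_Ioi]
  have h0 : ∀ᵐ x : ℝ, x ≠ 0 := by simp [ae_iff]
  refine lintegral_congr_ae (h0.mono fun x hx => ?_)
  by_cases hx0 : 0 < x
  · simp [Set.indicator, hx0, exponentialPDF_eq, hx0.le]
  · have : x < 0 := lt_of_le_of_ne (not_lt.mp hx0) hx
    simp [Set.indicator, hx0, exponentialPDF_eq, not_le.mpr this]

/-- Translating the half line `(g, ∞)` to `(0, ∞)` under a Lebesgue integral. -/
lemma lintegral_Ioi_sub (g : ℝ) (F : ℝ → ℝ≥0∞) :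
    ∫⁻ x in Set.Ioi g, F (x - g) = ∫⁻ x in Set.Ioi 0, F x := by
  rw [← lintegral_indicator measurableSet_Ioi, ← lintegral_indicator measurableSet_Ioi,
    ← lintegral_sub_right_eq_self (fun x => (Set.Ioi 0).indicator F x) g]
  refine lintegral_congr fun x => ?_
  simp [Set.indicator]

/-- The memoryless property: the part of an exponential variable beyond the level `g ≥ 0` is
exponential again, with total mass `exp (-r g)`. -/
lemma lintegral_expMeasure_memoryless {r g : ℝ} (hg : 0 ≤ g) {f : ℝ → ℝ≥0∞}
    (hf : Measurable f) :
    ∫⁻ x, (Set.Ioi g).indicator (fun x => f (x - g)) x ∂expMeasure r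
      = ENNReal.ofReal (Real.exp (-(r * g))) * ∫⁻ x, f x ∂expMeasure r := by
  rw [lintegral_expMeasure (f := (Set.Ioi g).indicator (fun x => f (x - g)))
      ((hf.comp (measurable_id.sub_const g)).indicator measurableSet_Ioi),
    lintegral_expMeasure hf, ← lintegral_const_mul _ (by fun_prop),
    ← lintegral_Ioi_sub g (fun x => ENNReal.ofReal (Real.exp (-(r * g))) *
      (ENNReal.ofReal (r * Real.exp (-(r * x))) * f x)),
    ← lintegral_indicator measurableSet_Ioi, ← lintegral_indicator measurableSet_Ioi]
  refine lintegral_congr fun x => ?_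
  by_cases hx : g < x
  · have h0 : 0 < x := hg.trans_lt hx
    simp only [Set.indicator, Set.mem_Ioi, hx, h0, if_true]
    rw [← mul_assoc, ← ENNReal.ofReal_mul (Real.exp_nonneg _), mul_left_comm, ← Real.exp_add]
    congr 4
    ring
  · simp [Set.indicator, hx]

instance isProbabilityMeasure_exp_one : IsProbabilityMeasure (expMeasure 1) :=
  isProbabilityMeasure_expMeasure one_pos

lemma expMeasure_Ioi {r g : ℝ} (hr : 0 < r) (hg : 0 ≤ g) :
    expMeasure r (Set.Ioi g) = ENNReal.ofReal (Real.exp (-(r * g))) := by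
  have := isProbabilityMeasure_expMeasure hr
  have h := lintegral_expMeasure_memoryless (r := r) hg (f := fun _ => 1) measurable_const
  rw [lintegral_indicator measurableSet_Ioi] at h
  simpa using h

lemma ae_pos_expMeasure {r : ℝ} (hr : 0 < r) : ∀ᵐ x ∂expMeasure r, 0 < x := by
  have := isProbabilityMeasure_expMeasure hr
  have h := expMeasure_Ioi hr le_rfl
  simp only [mul_zero, neg_zero, Real.exp_zero, ENNReal.ofReal_one] at h
  exact (prob_compl_eq_zero_iff measurableSet_Ioi).2 h

/-- Replacing the part of an exponential variable below the level `g` by an independent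
exponential variable does not change the law: this is the elementary step of the whole
analysis. -/
lemma map_memoryless_swap {r g : ℝ} (hr : 0 < r) (hg : 0 ≤ g) :
    ((expMeasure r).prod (expMeasure r)).map
      (fun p : ℝ × ℝ => if g < p.1 then p.1 - g else p.2) = expMeasure r := by
  have := isProbabilityMeasure_expMeasure hr
  have hm : Measurable (fun p : ℝ × ℝ => if g < p.1 then p.1 - g else p.2) :=
    Measurable.ite (measurableSet_lt measurable_const measurable_fst)
      (measurable_fst.sub_const g) measurable_snd
  ext A hA
  rw [Measure.map_apply hm hA, Measure.prod_apply (hm hA)]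
  -- the section at `x` is everything or nothing above `g`, and `A` below `g`
  have h1 : ∀ x : ℝ, expMeasure r (Prod.mk x ⁻¹'
        ((fun p : ℝ × ℝ => if g < p.1 then p.1 - g else p.2) ⁻¹' A))
      = (Set.Ioi g).indicator (fun x => A.indicator 1 (x - g)) x
        + (Set.Iic g).indicator (fun _ => expMeasure r A) x := by
    intro x
    by_cases hx : g < x
    · by_cases hxA : x - g ∈ A
      · have : (Prod.mk x ⁻¹' ((fun p : ℝ × ℝ => if g < p.1 then p.1 - g else p.2) ⁻¹' A))
            = Set.univ := by ext z; simp [hx, hxA]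
        rw [this]; simp [Set.indicator, hx, hxA, not_le.2 hx]
      · have : (Prod.mk x ⁻¹' ((fun p : ℝ × ℝ => if g < p.1 then p.1 - g else p.2) ⁻¹' A))
            = ∅ := by ext z; simp [hx, hxA]
        rw [this]; simp [Set.indicator, hx, hxA, not_le.2 hx]
    · have : (Prod.mk x ⁻¹' ((fun p : ℝ × ℝ => if g < p.1 then p.1 - g else p.2) ⁻¹' A))
            = A := by ext z; simp [hx]
      rw [this]; simp [Set.indicator, hx, not_lt.1 hx]
  simp_rw [h1]
  rw [lintegral_add_right _ (measurable_const.indicator measurableSet_Iic),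
    lintegral_expMeasure_memoryless hg (measurable_one.indicator hA),
    lintegral_indicator_one hA, lintegral_indicator measurableSet_Iic,
    setLIntegral_const, ← expMeasure_Ioi hr hg, mul_comm, ← mul_add, add_comm]
  have : expMeasure r (Set.Iic g) + expMeasure r (Set.Ioi g) = 1 := by
    rw [← Set.compl_Iic, measure_add_measure_compl measurableSet_Iic, measure_univ]
  rw [this, mul_one]

/-! ### Independent sequences and machines that read them -/

section Machines

variable {α β γ σ : Type*} [MeasurableSpace α] [MeasurableSpace β] [MeasurableSpace γ]
  [MeasurableSpace σ]

/-- The law of a sequence of independent variables with law `ρ`. -/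
def iid (ρ : Measure α) : Measure (ℕ → α) := Measure.infinitePi fun _ => ρ

instance (ρ : Measure α) [IsProbabilityMeasure ρ] : IsProbabilityMeasure (iid ρ) := by
  unfold iid; infer_instance

/-- The sequence `x` without its first term. -/
def stail {α : Type*} (x : ℕ → α) : ℕ → α := fun n => x (n + 1)

/-- The sequence `x` with the term `a` put in front. -/
def scons {α : Type*} (a : α) (x : ℕ → α) : ℕ → α
  | 0 => a
  | n + 1 => x n

@[simp] lemma scons_zero {α : Type*} (a : α) (x : ℕ → α) : scons a x 0 = a := rfl
@[simp] lemma scons_succ {α : Type*} (a : α) (x : ℕ → α) (n : ℕ) : scons a x (n + 1) = x n := rfl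
@[simp] lemma stail_apply {α : Type*} (x : ℕ → α) (n : ℕ) : stail x n = x (n + 1) := rfl
@[simp] lemma stail_scons {α : Type*} (a : α) (x : ℕ → α) : stail (scons a x) = x := rfl

@[fun_prop] lemma measurable_stail : Measurable (stail : (ℕ → α) → ℕ → α) := by
  unfold stail; fun_prop

@[fun_prop] lemma measurable_scons : Measurable fun p : α × (ℕ → α) => scons p.1 p.2 := by
  refine measurable_pi_lambda _ fun n => ?_
  cases n
  · exact measurable_fst
  · exact (measurable_pi_apply _).comp measurable_snd

lemma eq_iid {ρ : Measure α} [IsProbabilityMeasure ρ] {ν : Measure (ℕ → α)}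
    (h : ∀ (n : ℕ) (t : ℕ → Set α), (∀ k, MeasurableSet (t k)) →
      ν {x | ∀ k < n, x k ∈ t k} = ∏ k ∈ Finset.range n, ρ (t k)) :
    ν = iid ρ := by
  refine Measure.eq_infinitePi (μ := fun _ : ℕ => ρ) fun s t ht => ?_
  classical
  obtain ⟨n, hn⟩ := s.exists_nat_subset_range
  have h' := h n (fun k => if k ∈ s then t k else Set.univ) fun k => by
    split_ifs
    · exact ht k
    · exact .univ
  have e1 : {x : ℕ → α | ∀ k < n, x k ∈ (if k ∈ s then t k else Set.univ)}
      = Set.pi (s : Set ℕ) t := by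
    ext x
    simp only [Set.mem_ofPred_eq, Set.mem_pi, Finset.mem_coe]
    constructor
    · intro hx k hk
      simpa [hk] using hx k (Finset.mem_range.1 (hn hk))
    · intro hx k _
      split_ifs with hk
      · exact hx k hk
      · trivial
  rw [e1] at h'
  rw [h', ← Finset.prod_subset hn]
  · exact Finset.prod_congr rfl fun k hk => by simp [hk]
  · intro k _ hk
    simp [hk]

lemma iid_prefix {ρ : Measure α} [IsProbabilityMeasure ρ] (n : ℕ) {t : ℕ → Set α}
    (ht : ∀ k, MeasurableSet (t k)) :
    iid ρ {x | ∀ k < n, x k ∈ t k} = ∏ k ∈ Finset.range n, ρ (t k) := by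
  rw [← Measure.infinitePi_pi (μ := fun _ : ℕ => ρ) (s := Finset.range n) (fun k _ => ht k), iid]
  congr 1
  ext x
  simp [Set.mem_pi]

lemma measurableSet_prefix (n : ℕ) {t : ℕ → Set α} (ht : ∀ k, MeasurableSet (t k)) :
    MeasurableSet {x : ℕ → α | ∀ k < n, x k ∈ t k} := by
  simp only [Set.ofPred_forall]
  exact .iInter fun k => .iInter fun _ => measurable_pi_apply k (ht k)

/-- The first term and the remaining sequence of an i.i.d. sequence are independent. -/
lemma measurePreserving_scons (ρ : Measure α) [IsProbabilityMeasure ρ] :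
    MeasurePreserving (fun p : α × (ℕ → α) => scons p.1 p.2) (ρ.prod (iid ρ)) (iid ρ) := by
  refine ⟨measurable_scons, eq_iid fun n t ht => ?_⟩
  rw [Measure.map_apply measurable_scons (measurableSet_prefix n ht)]
  cases n with
  | zero => simp
  | succ n =>
    have : (fun p : α × (ℕ → α) => scons p.1 p.2) ⁻¹' {x | ∀ k < n + 1, x k ∈ t k}
        = t 0 ×ˢ {x | ∀ k < n, x k ∈ t (k + 1)} := by
      ext ⟨a, x⟩
      simp only [Set.mem_preimage, Set.mem_ofPred_eq, Set.mem_prod]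
      constructor
      · exact fun h => ⟨h 0 (by omega), fun k hk => h (k + 1) (by omega)⟩
      · rintro ⟨h0, h1⟩ k hk
        cases k with
        | zero => exact h0
        | succ k => exact h1 k (by omega)
    rw [this, Measure.prod_prod, iid_prefix n fun k => ht (k + 1), Finset.prod_range_succ']
    exact mul_comm _ _

lemma measurePreserving_split (ρ : Measure α) [IsProbabilityMeasure ρ] :
    MeasurePreserving (fun x : ℕ → α => (x 0, stail x)) (iid ρ) (ρ.prod (iid ρ)) := by
  refine ⟨by fun_prop, ?_⟩
  conv_lhs => rw [← (measurePreserving_scons ρ).map_eq]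
  rw [Measure.map_map (by fun_prop) (by fun_prop)]
  exact Measure.map_id

/-- Exchanging the two middle factors of a product of four measures. -/
lemma measurePreserving_prod_comm {δ : Type*} [MeasurableSpace δ] (μ : Measure α) (ν : Measure β)
    (τ : Measure γ) (υ : Measure δ) [SFinite μ] [SFinite ν] [SFinite τ] [SFinite υ] :
    MeasurePreserving (fun q : (α × β) × (γ × δ) => ((q.1.1, q.2.1), (q.1.2, q.2.2)))
      ((μ.prod ν).prod (τ.prod υ)) ((μ.prod τ).prod (ν.prod υ)) := by
  refine ⟨by fun_prop, Measure.ext_of_lintegral _ fun f hf => ?_⟩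
  rw [lintegral_map hf (by fun_prop)]
  have hf' : Measurable fun q : (α × β) × (γ × δ) => f ((q.1.1, q.2.1), (q.1.2, q.2.2)) :=
    hf.comp (by fun_prop)
  rw [lintegral_prod _ hf'.aemeasurable, lintegral_prod _ hf.aemeasurable,
    lintegral_prod _ hf'.lintegral_prod_right'.aemeasurable,
    lintegral_prod _ hf.lintegral_prod_right'.aemeasurable]
  refine lintegral_congr fun a => ?_
  have h1 : ∀ b, ∫⁻ q : γ × δ, f ((a, q.1), (b, q.2)) ∂τ.prod υ
      = ∫⁻ c, ∫⁻ d, f ((a, c), (b, d)) ∂υ ∂τ := fun b =>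
    lintegral_prod _ (hf.comp (by fun_prop)).aemeasurable
  have h2 : ∀ c, ∫⁻ q : β × δ, f ((a, c), q) ∂ν.prod υ
      = ∫⁻ b, ∫⁻ d, f ((a, c), (b, d)) ∂υ ∂ν := fun c =>
    lintegral_prod _ (hf.comp (by fun_prop)).aemeasurable
  simp only [h1, h2]
  refine lintegral_lintegral_swap (Measurable.aemeasurable ?_)
  have : Measurable fun q : (β × γ) × δ => f ((a, q.1.2), (q.1.1, q.2)) := hf.comp (by fun_prop)
  exact this.lintegral_prod_right'

/-- The first terms of two independent i.i.d. sequences are independent of the remaining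
sequences. -/
lemma measurePreserving_scons_prod (κ : Measure α) (κ' : Measure β) [IsProbabilityMeasure κ]
    [IsProbabilityMeasure κ'] :
    MeasurePreserving
      (fun q : (α × β) × ((ℕ → α) × (ℕ → β)) => (scons q.1.1 q.2.1, scons q.1.2 q.2.2))
      ((κ.prod κ').prod ((iid κ).prod (iid κ'))) ((iid κ).prod (iid κ')) :=
  ((measurePreserving_scons κ).prod (measurePreserving_scons κ')).comp
    (measurePreserving_prod_comm κ κ' (iid κ) (iid κ'))

/-- The output sequence of a machine that starts in the state `s` and reads the two input
sequences `a` and `b` in parallel: in the state `s` it reads the letters `x, y`, writes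
`φ (s, (x, y))` and moves to the state `ψ (s, (x, y))`. -/
def run {α β γ σ : Type*} (φ : σ × (α × β) → γ) (ψ : σ × (α × β) → σ) :
    σ → (ℕ → α) → (ℕ → β) → ℕ → γ
  | s, a, b, 0 => φ (s, (a 0, b 0))
  | s, a, b, n + 1 => run φ ψ (ψ (s, (a 0, b 0))) (stail a) (stail b) n

lemma measurable_run {φ : σ × (α × β) → γ} {ψ : σ × (α × β) → σ} (hφ : Measurable φ)
    (hψ : Measurable ψ) :
    Measurable fun p : σ × ((ℕ → α) × (ℕ → β)) => run φ ψ p.1 p.2.1 p.2.2 := by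
  refine measurable_pi_lambda _ fun n => ?_
  induction n with
  | zero => exact hφ.comp (by fun_prop)
  | succ n ih =>
    have h : Measurable fun p : σ × ((ℕ → α) × (ℕ → β)) =>
        (ψ (p.1, (p.2.1 0, p.2.2 0)), (stail p.2.1, stail p.2.2)) :=
      (hψ.comp (by fun_prop)).prodMk (by fun_prop)
    exact ih.comp h

/-- The output of a machine fed with independent letters is i.i.d. with law `ρ`, if in each state
the next letter written has law `ρ`. -/
lemma map_run {φ : σ × (α × β) → γ} {ψ : σ × (α × β) → σ} (hφ : Measurable φ)
    (hψ : Measurable ψ) {κ : Measure α} {κ' : Measure β} {ρ : Measure γ} [IsProbabilityMeasure κ]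
    [IsProbabilityMeasure κ'] [IsProbabilityMeasure ρ]
    (h : ∀ s, (κ.prod κ').map (fun p => φ (s, p)) = ρ) (s : σ) :
    ((iid κ).prod (iid κ')).map (fun p => run φ ψ s p.1 p.2) = iid ρ := by
  have hm : ∀ s, Measurable fun p : (ℕ → α) × (ℕ → β) => run φ ψ s p.1 p.2 := fun s =>
    (measurable_run hφ hψ).comp (measurable_const.prodMk measurable_id)
  refine eq_iid fun n t ht => ?_
  rw [Measure.map_apply (hm s) (measurableSet_prefix n ht)]
  induction n generalizing s t with
  | zero => simp
  | succ n ih =>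
    have hmeas := hm s (measurableSet_prefix (n + 1) ht)
    rw [← (measurePreserving_scons_prod κ κ').measure_preimage hmeas.nullMeasurableSet,
      Measure.prod_apply ((measurePreserving_scons_prod κ κ').measurable hmeas)]
    -- given the first letters, the machine continues from the next state, where the induction
    -- hypothesis applies
    have hfib : ∀ q : α × β, ((iid κ).prod (iid κ')) (Prod.mk q ⁻¹'
        ((fun q : (α × β) × ((ℕ → α) × (ℕ → β)) => (scons q.1.1 q.2.1, scons q.1.2 q.2.2)) ⁻¹'
          ((fun p : (ℕ → α) × (ℕ → β) => run φ ψ s p.1 p.2) ⁻¹'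
            {x | ∀ k < n + 1, x k ∈ t k})))
        = ((fun p => φ (s, p)) ⁻¹' t 0).indicator
          (fun _ => ∏ k ∈ Finset.range n, ρ (t (k + 1))) q := by
      intro q
      by_cases hq : φ (s, q) ∈ t 0
      · rw [Set.indicator_of_mem (by exact hq),
          ← ih (ψ (s, q)) (fun k => t (k + 1)) fun k => ht (k + 1)]
        congr 1
        ext ⟨a, b⟩
        simp only [Set.mem_preimage, Set.mem_ofPred_eq]
        constructor
        · exact fun h k hk => h (k + 1) (by omega)
        · intro h k hk
          cases k with
          | zero => exact hq
          | succ k => exact h k (by omega)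
      · rw [Set.indicator_of_notMem (by exact hq)]
        convert measure_empty (μ := (iid κ).prod (iid κ')) using 2
        ext ⟨a, b⟩
        simp only [Set.mem_preimage, Set.mem_ofPred_eq, Set.mem_empty_iff_false, iff_false]
        exact fun h => hq (h 0 (by omega))
    have hφs : Measurable fun p => φ (s, p) := hφ.comp (measurable_const.prodMk measurable_id)
    simp_rw [hfib]
    rw [lintegral_indicator_const (hφs (ht 0)), ← Measure.map_apply hφs (ht 0), h s,
      Finset.prod_range_succ']

/-- The output of a machine fed with independent letters is i.i.d. with law `ρ`, if its random
initial state has a law `ν` for which the letter written and the next state are independent with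
laws `ρ` and `ν`. -/
lemma map_run_of_invariant {φ : σ × (α × β) → γ} {ψ : σ × (α × β) → σ} (hφ : Measurable φ)
    (hψ : Measurable ψ) {κ : Measure α} {κ' : Measure β} {ρ : Measure γ} {ν : Measure σ}
    [IsProbabilityMeasure κ] [IsProbabilityMeasure κ'] [IsProbabilityMeasure ρ]
    [IsProbabilityMeasure ν]
    (h : (ν.prod (κ.prod κ')).map (fun p => (φ p, ψ p)) = ρ.prod ν) :
    (ν.prod ((iid κ).prod (iid κ'))).map (fun p => run φ ψ p.1 p.2.1 p.2.2) = iid ρ := by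
  have hm := measurable_run hφ hψ
  refine eq_iid fun n t ht => ?_
  rw [Measure.map_apply hm (measurableSet_prefix n ht)]
  induction n generalizing t with
  | zero => simp
  | succ n ih =>
    have hmeas := hm (measurableSet_prefix (n + 1) ht)
    -- read the first letters
    have m1 := (MeasurePreserving.id ν).prod (measurePreserving_scons_prod κ κ')
    have m2 := measurePreserving_prodAssoc ν (κ.prod κ') ((iid κ).prod (iid κ'))
    have m12 := m1.comp m2
    rw [← m12.measure_preimage hmeas.nullMeasurableSet]
    -- write the first letter and move to the next state
    have m3 : MeasurePreserving (fun p => (φ p, ψ p)) (ν.prod (κ.prod κ')) (ρ.prod ν) :=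
      ⟨hφ.prodMk hψ, h⟩
    have m4 := m3.prod (MeasurePreserving.id ((iid κ).prod (iid κ')))
    have m5 := measurePreserving_prodAssoc ρ ν ((iid κ).prod (iid κ'))
    have m45 := m5.comp m4
    have hmeas' : MeasurableSet (t 0 ×ˢ ((fun p : σ × ((ℕ → α) × (ℕ → β)) =>
        run φ ψ p.1 p.2.1 p.2.2) ⁻¹' {x | ∀ k < n, x k ∈ t (k + 1)})) :=
      (ht 0).prod (hm (measurableSet_prefix n fun k => ht (k + 1)))
    rw [Finset.prod_range_succ', ← ih (fun k => t (k + 1)) fun k => ht (k + 1), mul_comm,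
      ← Measure.prod_prod,
      ← m45.measure_preimage hmeas'.nullMeasurableSet]
    congr 1
    ext ⟨⟨s, q⟩, ⟨a, b⟩⟩
    simp only [Set.mem_preimage, Set.mem_ofPred_eq, Set.mem_prod, Function.comp]
    constructor
    · exact fun h => ⟨h 0 (by omega), fun k hk => h (k + 1) (by omega)⟩
    · rintro ⟨h0, h1⟩ k hk
      cases k with
      | zero => exact h0
      | succ k => exact h1 k (by omega)

end Machines

/-! ### Queues with exponential service times -/

/-- The law of a sequence of independent exponential variables with rate `r`. -/
abbrev expSeq (r : ℝ) : Measure (ℕ → ℝ) := iid (expMeasure r)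

lemma isProbabilityMeasure_expSeq {r : ℝ} (hr : 0 < r) : IsProbabilityMeasure (expSeq r) := by
  have := isProbabilityMeasure_expMeasure hr
  infer_instance

lemma ae_pos_expSeq {r : ℝ} (hr : 0 < r) : ∀ᵐ x ∂expSeq r, ∀ k, 0 < x k := by
  have := isProbabilityMeasure_expMeasure hr
  refine ae_all_iff.2 fun k => ?_
  exact (measurePreserving_eval_infinitePi (fun _ : ℕ => expMeasure r) k).quasiMeasurePreserving.ae
    (ae_pos_expMeasure hr)

/-- `lindley c z e k` is the departure time of customer `k` from a single server queue in which
customer `k` arrives at time `z k` and needs the service time `e k`, and where the server is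
busy until time `c`. -/
def lindley (c : ℝ) (z e : ℕ → ℝ) : ℕ → ℝ
  | 0 => max c (z 0) + e 0
  | k + 1 => max (lindley c z e k) (z (k + 1)) + e (k + 1)

lemma lindley_succ' (c : ℝ) (z e : ℕ → ℝ) (k : ℕ) :
    lindley c z e (k + 1) = lindley (max c (z 0) + e 0) (stail z) (stail e) k := by
  induction k with
  | zero => rfl
  | succ k ih =>
    rw [lindley, ih]
    rfl

lemma measurable_lindley (k : ℕ) :
    Measurable fun p : ℝ × (ℕ → ℝ) × (ℕ → ℝ) => lindley p.1 p.2.1 p.2.2 k := by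
  induction k with
  | zero => unfold lindley; fun_prop
  | succ k ih => unfold lindley; fun_prop

/-- Customer `n` is the first one to leave after time `t`. -/
def FirstAfter (t c : ℝ) (z e : ℕ → ℝ) (n : ℕ) : Prop :=
  t < lindley c z e n ∧ ∀ k < n, lindley c z e k ≤ t

lemma FirstAfter.unique {t c : ℝ} {z e : ℕ → ℝ} {m n : ℕ} (hm : FirstAfter t c z e m)
    (hn : FirstAfter t c z e n) : m = n := by
  by_contra h
  rcases lt_or_gt_of_ne h with h | h
  · exact (hn.2 m h).not_gt hm.1
  · exact (hm.2 n h).not_gt hn.1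

/-- The service times as seen from time `t`, if customer `n` is the first one to leave after
time `t`: the part of the service of customer `n` after time `t`, and the service times of the
later customers. -/
def residual (t c : ℝ) (z e : ℕ → ℝ) (n : ℕ) : ℕ → ℝ :=
  scons (lindley c z e n - max t (lindley c z e n - e n)) fun k => e (n + 1 + k)

open Classical in
/-- The service times as seen from time `t`. -/
def restart (t c : ℝ) (z e : ℕ → ℝ) : ℕ → ℝ :=
  if h : ∃ n, FirstAfter t c z e n then residual t c z e h.choose else 0

lemma restart_eq {t c : ℝ} {z e : ℕ → ℝ} {n : ℕ} (h : FirstAfter t c z e n) :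
    restart t c z e = residual t c z e n := by
  have h' : ∃ n, FirstAfter t c z e n := ⟨n, h⟩
  rw [restart, dif_pos h', h'.choose_spec.unique h]

lemma measurableSet_firstAfter (t : ℝ) (n : ℕ) :
    MeasurableSet {p : ℝ × (ℕ → ℝ) × (ℕ → ℝ) | FirstAfter t p.1 p.2.1 p.2.2 n} := by
  refine (measurableSet_lt measurable_const (measurable_lindley n)).inter ?_
  change MeasurableSet {p : ℝ × (ℕ → ℝ) × (ℕ → ℝ) | ∀ k < n, lindley p.1 p.2.1 p.2.2 k ≤ t}
  simp only [Set.ofPred_forall]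
  exact .iInter fun k => .iInter fun _ => measurableSet_le (measurable_lindley k) measurable_const

lemma measurable_residual (t : ℝ) (n : ℕ) :
    Measurable fun p : ℝ × (ℕ → ℝ) × (ℕ → ℝ) => residual t p.1 p.2.1 p.2.2 n := by
  have h := measurable_lindley n
  refine measurable_scons.comp (Measurable.prodMk ?_ ?_)
  · fun_prop
  · fun_prop

lemma restart_preimage (t : ℝ) (B : Set (ℕ → ℝ)) :
    (fun p : ℝ × (ℕ → ℝ) × (ℕ → ℝ) => restart t p.1 p.2.1 p.2.2) ⁻¹' B
      = (⋃ n, {p | FirstAfter t p.1 p.2.1 p.2.2 n} ∩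
          (fun p => residual t p.1 p.2.1 p.2.2 n) ⁻¹' B)
        ∪ ((⋃ n, {p | FirstAfter t p.1 p.2.1 p.2.2 n})ᶜ ∩ {_p | (0 : ℕ → ℝ) ∈ B}) := by
  ext p
  by_cases h : ∃ n, FirstAfter t p.1 p.2.1 p.2.2 n
  · obtain ⟨n, hn⟩ := h
    simp only [Set.mem_preimage, restart_eq hn, Set.mem_union, Set.mem_iUnion, Set.mem_inter_iff,
      Set.mem_ofPred_eq, Set.mem_compl_iff]
    constructor
    · exact fun hB => Or.inl ⟨n, hn, hB⟩
    · rintro (⟨m, hm, hB⟩ | ⟨hno, _⟩)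
      · rwa [hn.unique hm]
      · exact absurd ⟨n, hn⟩ hno
  · have h' : ¬ ∃ n, FirstAfter t p.1 p.2.1 p.2.2 n := h
    simp only [Set.mem_preimage, restart, dif_neg h', Set.mem_union, Set.mem_iUnion,
      Set.mem_inter_iff, Set.mem_ofPred_eq, Set.mem_compl_iff]
    push Not at h
    simp [h]

lemma measurable_restart (t : ℝ) :
    Measurable fun p : ℝ × (ℕ → ℝ) × (ℕ → ℝ) => restart t p.1 p.2.1 p.2.2 := by
  intro B hB
  rw [restart_preimage]
  refine (MeasurableSet.iUnion fun n =>
    (measurableSet_firstAfter t n).inter (measurable_residual t n hB)).union ?_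
  exact (MeasurableSet.iUnion fun n => measurableSet_firstAfter t n).compl.inter (.const _)

/-- Given that customer `n` is the first one to leave after time `t`, the service times as seen
from time `t` are again independent exponential variables. -/
lemma expSeq_firstAfter_inter {r : ℝ} (hr : 0 < r) (t : ℝ) (n : ℕ) (c : ℝ) (z : ℕ → ℝ)
    {B : Set (ℕ → ℝ)} (hB : MeasurableSet B) :
    expSeq r {e | FirstAfter t c z e n ∧ residual t c z e n ∈ B}
      = expSeq r {e | FirstAfter t c z e n} * expSeq r B := by
  have := isProbabilityMeasure_expMeasure hr
  have hA : ∀ n c z, MeasurableSet {e | FirstAfter t c z e n} := fun n c z =>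
    (by fun_prop : Measurable fun e : ℕ → ℝ => (c, z, e)) (measurableSet_firstAfter t n)
  have hAB : ∀ n c z, ∀ {B : Set (ℕ → ℝ)}, MeasurableSet B →
      MeasurableSet {e | FirstAfter t c z e n ∧ residual t c z e n ∈ B} := fun n c z B hB =>
    (hA n c z).inter ((by fun_prop : Measurable fun e : ℕ → ℝ => (c, z, e))
      (measurable_residual t n hB))
  have hs := measurePreserving_scons (expMeasure r)
  induction n generalizing c z B with
  | zero =>
    set m := max c (z 0) with hm
    -- customer `0` leaves after `t` if the service, which begins at `m`, lasts longer than
    -- `max t m - m`; the excess is exponential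
    have key : ∀ {B : Set (ℕ → ℝ)}, MeasurableSet B →
        expSeq r {e | FirstAfter t c z e 0 ∧ residual t c z e 0 ∈ B}
          = ENNReal.ofReal (Real.exp (-(r * (max t m - m)))) * expSeq r B := by
      intro B hB
      rw [← hs.measure_preimage (hAB 0 c z hB).nullMeasurableSet,
        Measure.prod_apply (hs.measurable (hAB 0 c z hB)),
        ← hs.measure_preimage hB.nullMeasurableSet, Measure.prod_apply (hs.measurable hB),
        ← lintegral_expMeasure_memoryless (sub_nonneg.2 (le_max_right t m))
          (measurable_measure_prodMk_left (hs.measurable hB))]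
      refine lintegral_congr_ae ((ae_pos_expMeasure hr).mono fun x hx => ?_)
      have hiff : t < m + x ↔ max t m - m < x := by
        rw [sub_lt_iff_lt_add', max_lt_iff]
        exact ⟨fun h => ⟨h, by linarith⟩, fun h => h.1⟩
      have hset : Prod.mk x ⁻¹' ((fun p : ℝ × (ℕ → ℝ) => scons p.1 p.2) ⁻¹'
          {e | FirstAfter t c z e 0 ∧ residual t c z e 0 ∈ B})
          = {e | t < m + x ∧ scons (x - (max t m - m)) e ∈ B} := by
        ext e
        have h1 : residual t c z (scons x e) 0 = scons (x - (max t m - m)) e := by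
          funext k
          cases k with
          | zero => simp only [residual, lindley, scons_zero, ← hm, add_sub_cancel_right]; ring
          | succ k => simp only [residual, scons_succ, zero_add, Nat.add_comm 1 k]
        simp only [Set.mem_preimage, Set.mem_ofPred_eq, h1, FirstAfter, lindley, scons_zero, ← hm]
        simp
      beta_reduce
      rw [hset]
      by_cases h : t < m + x
      · rw [Set.indicator_of_mem (by exact hiff.1 h)]
        simp only [h, true_and]
        rfl
      · rw [Set.indicator_of_notMem (by exact fun h' => h (hiff.2 h'))]
        simp [h]
    have h1 := key MeasurableSet.univ
    simp only [Set.mem_univ, and_true, measure_univ, mul_one] at h1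
    rw [key hB, h1]
  | succ n ih =>
    set m := max c (z 0) with hm
    -- customer `0` leaves at the time `m + x ≤ t`, and then the queue of the later customers starts
    have key : ∀ {B : Set (ℕ → ℝ)}, MeasurableSet B →
        expSeq r {e | FirstAfter t c z e (n + 1) ∧ residual t c z e (n + 1) ∈ B}
          = (∫⁻ x, (Set.Iic (t - m)).indicator
              (fun x => expSeq r {e | FirstAfter t (m + x) (stail z) e n}) x ∂expMeasure r)
            * expSeq r B := by
      intro B hB
      have hmeas : Measurable ((Set.Iic (t - m)).indicator
          (fun x => expSeq r {e | FirstAfter t (m + x) (stail z) e n})) := by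
        refine Measurable.indicator ?_ measurableSet_Iic
        have : MeasurableSet {p : ℝ × (ℕ → ℝ) | FirstAfter t (m + p.1) (stail z) p.2 n} :=
          (by fun_prop : Measurable fun p : ℝ × (ℕ → ℝ) => (m + p.1, stail z, p.2))
            (measurableSet_firstAfter t n)
        exact measurable_measure_prodMk_left this
      rw [← lintegral_mul_const _ hmeas,
        ← hs.measure_preimage (hAB (n + 1) c z hB).nullMeasurableSet,
        Measure.prod_apply (hs.measurable (hAB (n + 1) c z hB))]
      refine lintegral_congr fun x => ?_
      have hset : Prod.mk x ⁻¹' ((fun p : ℝ × (ℕ → ℝ) => scons p.1 p.2) ⁻¹'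
          {e | FirstAfter t c z e (n + 1) ∧ residual t c z e (n + 1) ∈ B})
          = {e | m + x ≤ t ∧ FirstAfter t (m + x) (stail z) e n ∧
              residual t (m + x) (stail z) e n ∈ B} := by
        ext e
        have h0 : ∀ k, lindley c z (scons x e) (k + 1) = lindley (m + x) (stail z) e k :=
          fun k => lindley_succ' c z (scons x e) k
        have h1 : residual t c z (scons x e) (n + 1) = residual t (m + x) (stail z) e n := by
          funext k
          cases k with
          | zero => simp only [residual, scons_zero, h0, scons_succ]
          | succ k =>
            simp only [residual, scons_succ]
            rw [show n + 1 + 1 + k = (n + 1 + k) + 1 by ring, scons_succ]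
        have h2 : FirstAfter t c z (scons x e) (n + 1)
            ↔ m + x ≤ t ∧ FirstAfter t (m + x) (stail z) e n := by
          simp only [FirstAfter, h0]
          constructor
          · rintro ⟨ha, hb⟩
            exact ⟨hb 0 (by omega), ha, fun k hk => (h0 k) ▸ hb (k + 1) (by omega)⟩
          · rintro ⟨ha, hb, hc⟩
            refine ⟨hb, fun k hk => ?_⟩
            cases k with
            | zero => exact ha
            | succ k => exact (h0 k) ▸ hc k (by omega)
        simp only [Set.mem_preimage, Set.mem_ofPred_eq, h1, h2, and_assoc]
      rw [hset]
      by_cases h : m + x ≤ t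
      · rw [Set.indicator_of_mem (by rw [Set.mem_Iic]; linarith)]
        simp only [h, true_and]
        exact ih (m + x) (stail z) hB
      · rw [Set.indicator_of_notMem (by rw [Set.mem_Iic]; intro h'; exact h (by linarith))]
        simp [h]
    have h1 := key MeasurableSet.univ
    simp only [Set.mem_univ, and_true, measure_univ, mul_one] at h1
    rw [key hB, h1]

/-- The service times as seen from the time `t` are independent exponential variables. -/
lemma map_restart {r : ℝ} (hr : 0 < r) (t c : ℝ) (z : ℕ → ℝ)
    (h : ∀ᵐ e ∂expSeq r, ∃ n, FirstAfter t c z e n) :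
    (expSeq r).map (restart t c z) = expSeq r := by
  have := isProbabilityMeasure_expMeasure hr
  have hm : Measurable fun e : ℕ → ℝ => (c, z, e) := by fun_prop
  have hmr : Measurable (restart t c z) := (measurable_restart t).comp hm
  ext B hB
  have key : ∀ {B : Set (ℕ → ℝ)}, MeasurableSet B → expSeq r (restart t c z ⁻¹' B)
      = (∑' n, expSeq r {e | FirstAfter t c z e n}) * expSeq r B := by
    intro B hB
    rw [← ENNReal.tsum_mul_right]
    have h1 : (restart t c z ⁻¹' B : Set _) =ᵐ[expSeq r]
        (⋃ n, {e | FirstAfter t c z e n ∧ residual t c z e n ∈ B} : Set (ℕ → ℝ)) := by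
      filter_upwards [h] with e he
      obtain ⟨n, hn⟩ := he
      refine propext ?_
      change restart t c z e ∈ B ↔ e ∈ ⋃ n, {e | FirstAfter t c z e n ∧ residual t c z e n ∈ B}
      rw [restart_eq hn, Set.mem_iUnion]
      constructor
      · exact fun hB => ⟨n, hn, hB⟩
      · rintro ⟨m, hm, hB⟩
        rwa [hn.unique hm]
    rw [measure_congr h1, measure_iUnion]
    · exact tsum_congr fun n => expSeq_firstAfter_inter hr t n c z hB
    · intro i j hij
      refine Set.disjoint_left.2 fun e hi hj => hij (hi.1.unique hj.1)
    · exact fun n => (hm (measurableSet_firstAfter t n)).inter (hm (measurable_residual t n hB))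
  -- the factor in front is identified by taking `B = univ`
  have h1 := key MeasurableSet.univ
  simp only [Set.preimage_univ, measure_univ, mul_one] at h1
  rw [Measure.map_apply hmr hB, key hB, ← h1, one_mul]

/-! ### Burke's theorem -/

/-- Decomposing the open quadrant along its diagonal. -/
lemma lintegral_quadrant {F : ℝ → ℝ → ℝ≥0∞} (hF : Measurable fun p : ℝ × ℝ => F p.1 p.2) :
    ∫⁻ a in Set.Ioi 0, ∫⁻ w in Set.Ioi 0, F a w
      = (∫⁻ e in Set.Ioi 0, ∫⁻ p in Set.Ioi 0, F (p + e) e)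
        + ∫⁻ e in Set.Ioi 0, ∫⁻ q in Set.Ioi 0, F e (q + e) := by
  have hF' : ∀ a, Measurable (F a) := fun a => hF.comp (by fun_prop : Measurable fun w => (a, w))
  have hlow : Measurable fun p : ℝ × ℝ => (Set.Iio p.1).indicator (F p.1) p.2 := by
    simp only [Set.indicator, Set.mem_Iio]
    exact Measurable.ite (measurableSet_lt measurable_snd measurable_fst) hF measurable_const
  have h1 : ∀ a ∈ Set.Ioi (0 : ℝ), ∫⁻ w in Set.Ioi 0, F a w
      = (∫⁻ w in Set.Ioi 0, (Set.Iio a).indicator (F a) w) + ∫⁻ q in Set.Ioi 0, F a (q + a) := by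
    intro a ha
    have h2 := lintegral_Ioi_sub a (fun q => F a (q + a))
    simp only [sub_add_cancel] at h2
    rw [← h2, ← lintegral_indicator measurableSet_Ioi, ← lintegral_indicator measurableSet_Ioi,
      ← lintegral_indicator measurableSet_Ioi, ← lintegral_add_left]
    · have h0 : ∀ᵐ w : ℝ, w ≠ a := by simp [ae_iff]
      refine lintegral_congr_ae (h0.mono fun w hw => ?_)
      rcases lt_or_gt_of_ne hw with h | h
      · simp [Set.indicator, h, h.not_gt]
      · simp [Set.indicator, h, h.not_gt, (Set.mem_Ioi.1 ha).trans h]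
    · exact ((hF' a).indicator measurableSet_Iio).indicator measurableSet_Ioi
  rw [setLIntegral_congr_fun measurableSet_Ioi h1, lintegral_add_left hlow.lintegral_prod_right']
  congr 1
  rw [lintegral_lintegral_swap hlow.aemeasurable]
  refine setLIntegral_congr_fun measurableSet_Ioi fun w hw => ?_
  have h2 := lintegral_Ioi_sub w (fun p => F (p + w) w)
  simp only [sub_add_cancel] at h2
  rw [← h2, ← lintegral_indicator measurableSet_Ioi, ← lintegral_indicator measurableSet_Ioi]
  refine lintegral_congr fun a => ?_
  by_cases h : w < a
  · simp [Set.indicator, h, (Set.mem_Ioi.1 hw).trans h]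
  · simp [Set.indicator, h]

/-- The time between the departures of two consecutive customers: `p.1` is the time the first one
spends in the system, `p.2.1` the time between their arrivals, and `p.2.2` the service time of the
second one. -/
def burkeOut (p : ℝ × (ℝ × ℝ)) : ℝ := max (p.2.1 - p.1) 0 + p.2.2

/-- The time the second customer spends in the system. -/
def burkeNext (p : ℝ × (ℝ × ℝ)) : ℝ := max (p.1 - p.2.1) 0 + p.2.2

lemma measurable_burkeOut : Measurable burkeOut := by unfold burkeOut; fun_prop
lemma measurable_burkeNext : Measurable burkeNext := by unfold burkeNext; fun_prop

lemma lintegral_exp_neg_Ioi : ∫⁻ x in Set.Ioi (0 : ℝ), ENNReal.ofReal (Real.exp (-x)) = 1 := by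
  have h := lintegral_expMeasure (r := 1) (f := fun _ => 1) measurable_const
  simpa using h.symm

/-- The one-step form of Burke's theorem: in equilibrium the time between two departures is
exponential with the arrival rate, and it is independent of the time the second customer spends in
the system. -/
lemma map_burke {lam : ℝ} (h0 : 0 < lam) (h1 : lam < 1) :
    ((expMeasure (1 - lam)).prod ((expMeasure lam).prod (expMeasure 1))).map
      (fun p => (burkeOut p, burkeNext p)) = (expMeasure lam).prod (expMeasure (1 - lam)) := by
  have hb : 0 < 1 - lam := sub_pos.2 h1
  have := isProbabilityMeasure_expMeasure h0
  have := isProbabilityMeasure_expMeasure hb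
  refine Measure.ext_of_lintegral _ fun f hf => ?_
  have hm : Measurable fun p => (burkeOut p, burkeNext p) :=
    measurable_burkeOut.prodMk measurable_burkeNext
  have hfm : Measurable fun p : ℝ × (ℝ × ℝ) => f (burkeOut p, burkeNext p) := hf.comp hm
  -- the integral over the service time, which enters both components
  set G : ℝ → ℝ → ℝ≥0∞ := fun p q =>
    ∫⁻ e in Set.Ioi 0, ENNReal.ofReal (Real.exp (-e)) * f (p + e, q + e) with hG
  have hGm : Measurable fun p : ℝ × ℝ => G p.1 p.2 := by
    have : Measurable fun p : (ℝ × ℝ) × ℝ =>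
        ENNReal.ofReal (Real.exp (-p.2)) * f (p.1.1 + p.2, p.1.2 + p.2) :=
      Measurable.mul (by fun_prop) (hf.comp (by fun_prop))
    exact this.lintegral_prod_right'
  have hG0 : Measurable fun q => G 0 q := hGm.comp (f := fun q : ℝ => ((0 : ℝ), q)) (by fun_prop)
  have hG1 : Measurable fun p => G p 0 := hGm.comp (f := fun p : ℝ => (p, (0 : ℝ))) (by fun_prop)
  set c : ℝ≥0∞ := ENNReal.ofReal (1 - lam) * ENNReal.ofReal lam with hc
  have hl : 0 ≤ lam := h0.le
  have hb' : 0 ≤ 1 - lam := hb.le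
  -- splitting the quadrant of sojourn and interarrival times along its diagonal
  have hL : ∫⁻ p, f (burkeOut p, burkeNext p)
        ∂((expMeasure (1 - lam)).prod ((expMeasure lam).prod (expMeasure 1)))
      = c * ((∫⁻ q in Set.Ioi 0, ENNReal.ofReal (Real.exp (-((1 - lam) * q))) * G 0 q)
        + ∫⁻ p in Set.Ioi 0, ENNReal.ofReal (Real.exp (-(lam * p))) * G p 0) := by
    have hin : ∀ w a, ∫⁻ e, f (burkeOut (w, (a, e)), burkeNext (w, (a, e))) ∂expMeasure 1
        = G (max (a - w) 0) (max (w - a) 0) := by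
      intro w a
      rw [lintegral_expMeasure (f := fun e => f (burkeOut (w, (a, e)), burkeNext (w, (a, e))))
        (hfm.comp (by fun_prop))]
      simp [hG, burkeOut, burkeNext]
    have hmid : Measurable fun p : ℝ × ℝ => G (max (p.2 - p.1) 0) (max (p.1 - p.2) 0) :=
      hGm.comp (f := fun p : ℝ × ℝ => (max (p.2 - p.1) 0, max (p.1 - p.2) 0)) (by fun_prop)
    have hmid' : ∀ w, Measurable fun a => G (max (a - w) 0) (max (w - a) 0) := fun w =>
      hmid.comp (f := fun a : ℝ => (w, a)) (by fun_prop)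
    have hF : Measurable fun p : ℝ × ℝ =>
        ENNReal.ofReal (Real.exp (-((1 - lam) * p.1))) * (ENNReal.ofReal (Real.exp (-(lam * p.2)))
          * G (max (p.2 - p.1) 0) (max (p.1 - p.2) 0)) := by
      refine Measurable.mul (by fun_prop) (Measurable.mul (by fun_prop) hmid)
    rw [lintegral_prod _ hfm.aemeasurable]
    have e1 : ∀ w, ∫⁻ q : ℝ × ℝ, f (burkeOut (w, q), burkeNext (w, q))
        ∂(expMeasure lam).prod (expMeasure 1)
        = ∫⁻ a, G (max (a - w) 0) (max (w - a) 0) ∂expMeasure lam := by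
      intro w
      have hw : Measurable fun q : ℝ × ℝ => f (burkeOut (w, q), burkeNext (w, q)) :=
        hfm.comp (by fun_prop : Measurable fun q : ℝ × ℝ => (w, q))
      rw [lintegral_prod _ hw.aemeasurable]
      exact lintegral_congr fun a => hin w a
    simp_rw [e1]
    rw [lintegral_expMeasure (by
      have : Measurable fun p : ℝ × ℝ => G (max (p.2 - p.1) 0) (max (p.1 - p.2) 0) := hmid
      exact this.lintegral_prod_right')]
    have e2 : ∀ w, ENNReal.ofReal ((1 - lam) * Real.exp (-((1 - lam) * w)))
          * ∫⁻ a, G (max (a - w) 0) (max (w - a) 0) ∂expMeasure lam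
        = c * ∫⁻ a in Set.Ioi 0, ENNReal.ofReal (Real.exp (-((1 - lam) * w))) *
            (ENNReal.ofReal (Real.exp (-(lam * a))) * G (max (a - w) 0) (max (w - a) 0)) := by
      intro w
      rw [lintegral_expMeasure (hmid' w), ← lintegral_const_mul _ (by
          exact Measurable.mul (by fun_prop) (hmid' w)),
        ← lintegral_const_mul _ (by
          exact Measurable.mul (by fun_prop) (Measurable.mul (by fun_prop) (hmid' w)))]
      refine lintegral_congr fun a => ?_
      rw [ENNReal.ofReal_mul hb', ENNReal.ofReal_mul hl, hc]
      ring
    simp_rw [e2]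
    rw [lintegral_const_mul _ hF.lintegral_prod_right', lintegral_quadrant hF]
    congr 1
    -- on both sides of the diagonal the common part of the two exponential factors has mass one
    have e3 : ∀ e p : ℝ, 0 < p → ENNReal.ofReal (Real.exp (-((1 - lam) * (p + e)))) *
          (ENNReal.ofReal (Real.exp (-(lam * e))) * G (max (e - (p + e)) 0) (max (p + e - e) 0))
        = ENNReal.ofReal (Real.exp (-e)) *
          (ENNReal.ofReal (Real.exp (-((1 - lam) * p))) * G 0 p) := by
      intro e p hp
      rw [show max (e - (p + e)) 0 = 0 from max_eq_right (by linarith),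
        show max (p + e - e) 0 = p by rw [add_sub_cancel_right]; exact max_eq_left hp.le,
        ← mul_assoc, ← mul_assoc, ← ENNReal.ofReal_mul (Real.exp_nonneg _),
        ← ENNReal.ofReal_mul (Real.exp_nonneg _), ← Real.exp_add, ← Real.exp_add]
      congr 3
      ring
    have e4 : ∀ e q : ℝ, 0 < q → ENNReal.ofReal (Real.exp (-((1 - lam) * e))) *
          (ENNReal.ofReal (Real.exp (-(lam * (q + e)))) *
            G (max (q + e - e) 0) (max (e - (q + e)) 0))
        = ENNReal.ofReal (Real.exp (-e)) * (ENNReal.ofReal (Real.exp (-(lam * q))) * G q 0) := by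
      intro e p hp
      rw [show max (e - (p + e)) 0 = 0 from max_eq_right (by linarith),
        show max (p + e - e) 0 = p by rw [add_sub_cancel_right]; exact max_eq_left hp.le,
        ← mul_assoc, ← mul_assoc, ← ENNReal.ofReal_mul (Real.exp_nonneg _),
        ← ENNReal.ofReal_mul (Real.exp_nonneg _), ← Real.exp_add, ← Real.exp_add]
      congr 3
      ring
    congr 1
    · have : ∀ e, ∫⁻ p in Set.Ioi 0, ENNReal.ofReal (Real.exp (-((1 - lam) * (p + e)))) *
          (ENNReal.ofReal (Real.exp (-(lam * e))) * G (max (e - (p + e)) 0) (max (p + e - e) 0))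
          = ENNReal.ofReal (Real.exp (-e)) * ∫⁻ p in Set.Ioi 0,
            ENNReal.ofReal (Real.exp (-((1 - lam) * p))) * G 0 p := by
        intro e
        rw [← lintegral_const_mul _ (by fun_prop)]
        exact setLIntegral_congr_fun measurableSet_Ioi fun p hp => e3 e p hp
      simp_rw [this]
      rw [lintegral_mul_const _ (by fun_prop), lintegral_exp_neg_Ioi, one_mul]
    · have : ∀ e, ∫⁻ q in Set.Ioi 0, ENNReal.ofReal (Real.exp (-((1 - lam) * e))) *
          (ENNReal.ofReal (Real.exp (-(lam * (q + e)))) *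
            G (max (q + e - e) 0) (max (e - (q + e)) 0))
          = ENNReal.ofReal (Real.exp (-e)) * ∫⁻ p in Set.Ioi 0,
            ENNReal.ofReal (Real.exp (-(lam * p))) * G p 0 := by
        intro e
        rw [← lintegral_const_mul _ (by fun_prop)]
        exact setLIntegral_congr_fun measurableSet_Ioi fun p hp => e4 e p hp
      simp_rw [this]
      rw [lintegral_mul_const _ (by fun_prop), lintegral_exp_neg_Ioi, one_mul]
  -- splitting the quadrant of interdeparture and next sojourn times along its diagonal
  have hR : ∫⁻ p, f p ∂((expMeasure lam).prod (expMeasure (1 - lam)))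
      = c * ((∫⁻ p in Set.Ioi 0, ENNReal.ofReal (Real.exp (-(lam * p))) * G p 0)
        + ∫⁻ q in Set.Ioi 0, ENNReal.ofReal (Real.exp (-((1 - lam) * q))) * G 0 q) := by
    have hf1 : ∀ δ, Measurable fun w => f (δ, w) := fun δ => hf.comp (by fun_prop)
    have hF : Measurable fun p : ℝ × ℝ => ENNReal.ofReal (Real.exp (-(lam * p.1))) *
        (ENNReal.ofReal (Real.exp (-((1 - lam) * p.2))) * f (p.1, p.2)) :=
      Measurable.mul (by fun_prop) (Measurable.mul (by fun_prop) hf)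
    rw [lintegral_prod _ hf.aemeasurable,
      lintegral_expMeasure (Measurable.lintegral_prod_right' hf)]
    have e2 : ∀ δ, ENNReal.ofReal (lam * Real.exp (-(lam * δ)))
          * ∫⁻ w, f (δ, w) ∂expMeasure (1 - lam)
        = c * ∫⁻ w in Set.Ioi 0, ENNReal.ofReal (Real.exp (-(lam * δ))) *
            (ENNReal.ofReal (Real.exp (-((1 - lam) * w))) * f (δ, w)) := by
      intro δ
      rw [lintegral_expMeasure (hf1 δ), ← lintegral_const_mul _ (by
          exact Measurable.mul (by fun_prop) (hf1 δ)),
        ← lintegral_const_mul _ (by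
          exact Measurable.mul (by fun_prop) (Measurable.mul (by fun_prop) (hf1 δ)))]
      refine lintegral_congr fun a => ?_
      rw [ENNReal.ofReal_mul hb', ENNReal.ofReal_mul hl, hc]
      ring
    simp_rw [e2]
    rw [lintegral_const_mul _ hF.lintegral_prod_right', lintegral_quadrant hF]
    congr 1
    -- above and below the diagonal the smaller component `e` plays the role of the service time
    have e3 : ∀ e p : ℝ, ENNReal.ofReal (Real.exp (-(lam * (p + e)))) *
          (ENNReal.ofReal (Real.exp (-((1 - lam) * e))) * f (p + e, e))
        = ENNReal.ofReal (Real.exp (-(lam * p))) *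
          (ENNReal.ofReal (Real.exp (-e)) * f (p + e, 0 + e)) := by
      intro e p
      rw [zero_add, ← mul_assoc, ← mul_assoc, ← ENNReal.ofReal_mul (Real.exp_nonneg _),
        ← ENNReal.ofReal_mul (Real.exp_nonneg _), ← Real.exp_add, ← Real.exp_add]
      congr 3
      ring
    have e4 : ∀ e q : ℝ, ENNReal.ofReal (Real.exp (-(lam * e))) *
          (ENNReal.ofReal (Real.exp (-((1 - lam) * (q + e)))) * f (e, q + e))
        = ENNReal.ofReal (Real.exp (-((1 - lam) * q))) *
          (ENNReal.ofReal (Real.exp (-e)) * f (0 + e, q + e)) := by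
      intro e p
      rw [zero_add, ← mul_assoc, ← mul_assoc, ← ENNReal.ofReal_mul (Real.exp_nonneg _),
        ← ENNReal.ofReal_mul (Real.exp_nonneg _), ← Real.exp_add, ← Real.exp_add]
      congr 3
      ring
    simp_rw [e3, e4]
    congr 1
    · rw [lintegral_lintegral_swap (Measurable.aemeasurable (by
        exact Measurable.mul (by fun_prop) (Measurable.mul (by fun_prop)
          (hf.comp (by fun_prop)))))]
      refine lintegral_congr fun p => ?_
      rw [lintegral_const_mul _ (by fun_prop)]
    · rw [lintegral_lintegral_swap (Measurable.aemeasurable (by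
        exact Measurable.mul (by fun_prop) (Measurable.mul (by fun_prop)
          (hf.comp (by fun_prop)))))]
      refine lintegral_congr fun p => ?_
      rw [lintegral_const_mul _ (by fun_prop)]
  rw [lintegral_map hf hm, hL, hR, add_comm]

/-! ### The difference of two exponential random walks -/

/-- The partial sums of a sequence. -/
def psum (x : ℕ → ℝ) (k : ℕ) : ℝ := ∑ l ∈ Finset.range (k + 1), x l

lemma psum_zero (x : ℕ → ℝ) : psum x 0 = x 0 := by simp [psum]

lemma psum_succ (x : ℕ → ℝ) (k : ℕ) : psum x (k + 1) = psum x k + x (k + 1) := by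
  simp [psum, Finset.sum_range_succ]

lemma psum_succ' (x : ℕ → ℝ) (k : ℕ) : psum x (k + 1) = x 0 + psum (stail x) k := by
  rw [psum, Finset.sum_range_succ', add_comm]
  rfl

@[fun_prop] lemma measurable_psum_apply (k : ℕ) : Measurable fun x : ℕ → ℝ => psum x k := by
  unfold psum
  fun_prop

@[fun_prop] lemma measurable_psum : Measurable psum :=
  measurable_pi_lambda _ fun k => measurable_psum_apply k

lemma psum_mul (c : ℝ) (x : ℕ → ℝ) (k : ℕ) : psum (fun l => c * x l) k = c * psum x k := by
  simp [psum, Finset.mul_sum]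

lemma psum_strictMono {x : ℕ → ℝ} (hx : ∀ k, 0 < x k) : StrictMono (psum x) :=
  strictMono_nat_of_lt_succ fun k => by rw [psum_succ]; linarith [hx (k + 1)]

lemma psum_pos {x : ℕ → ℝ} (hx : ∀ k, 0 < x k) (k : ℕ) : 0 < psum x k :=
  Finset.sum_pos (fun l _ => hx l) ⟨0, by simp⟩

/-- Multiplying an exponential variable by a constant. -/
lemma map_const_mul_expMeasure {r s : ℝ} (hr : 0 < r) (hs : 0 < s) :
    (expMeasure s).map (fun x => s / r * x) = expMeasure r := by
  refine Measure.ext_of_lintegral _ fun f hf => ?_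
  have hm : Measurable fun x : ℝ => s / r * x := by fun_prop
  have hc : 0 < s / r := div_pos hs hr
  rw [lintegral_map hf hm, lintegral_expMeasure (f := fun x => f (s / r * x)) (hf.comp hm),
    lintegral_expMeasure hf]
  rw [← lintegral_indicator measurableSet_Ioi, ← lintegral_indicator measurableSet_Ioi]
  conv_rhs => rw [← Real.smul_map_volume_mul_left hc.ne']
  have hF : Measurable ((Set.Ioi 0).indicator
      fun x => ENNReal.ofReal (r * Real.exp (-(r * x))) * f x) :=
    Measurable.indicator (by fun_prop) measurableSet_Ioi
  rw [lintegral_smul_measure, lintegral_map hF hm, smul_eq_mul,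
    ← lintegral_const_mul (f := fun a => (Set.Ioi 0).indicator
      (fun x => ENNReal.ofReal (r * Real.exp (-(r * x))) * f x) (s / r * a)) _ (hF.comp hm)]
  refine lintegral_congr fun x => ?_
  have hiff : 0 < s / r * x ↔ 0 < x := mul_pos_iff_of_pos_left hc
  by_cases hx : 0 < x
  · rw [Set.indicator_of_mem (by exact hx), Set.indicator_of_mem (by exact hiff.2 hx), ← mul_assoc,
      abs_of_pos hc, ← ENNReal.ofReal_mul hc.le, ← mul_assoc, div_mul_cancel₀ _ hr.ne',
      ← mul_assoc, mul_div_cancel₀ _ hr.ne']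
  · rw [Set.indicator_of_notMem (by exact hx),
      Set.indicator_of_notMem (by exact fun h => hx (hiff.1 h)), mul_zero]

lemma map_const_mul_expSeq {r s : ℝ} (hr : 0 < r) (hs : 0 < s) :
    (expSeq s).map (fun x k => s / r * x k) = expSeq r := by
  have := isProbabilityMeasure_expMeasure hr
  have := isProbabilityMeasure_expMeasure hs
  rw [expSeq, iid, Measure.infinitePi_map_pi (μ := fun _ : ℕ => expMeasure s)
    (f := fun _ (x : ℝ) => s / r * x) (fun _ => by fun_prop)]
  simp_rw [map_const_mul_expMeasure hr hs]
  rfl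

/-- The Laplace transform of the exponential distribution. -/
lemma lintegral_exp_neg_mul {r s : ℝ} (hr : 0 < r) (hs : 0 ≤ s) :
    ∫⁻ x, ENNReal.ofReal (Real.exp (-(s * x))) ∂expMeasure r = ENNReal.ofReal (r / (r + s)) := by
  have hrs : 0 < r + s := by linarith
  have h1 := isProbabilityMeasure_expMeasure hrs
  have h2 : ∫⁻ x in Set.Ioi (0 : ℝ), ENNReal.ofReal ((r + s) * Real.exp (-((r + s) * x))) = 1 := by
    have h := lintegral_expMeasure (r := r + s) (f := fun _ => 1) measurable_const
    simpa using h.symm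
  rw [lintegral_expMeasure (by fun_prop), ← mul_one (ENNReal.ofReal (r / (r + s))), ← h2,
    ← lintegral_const_mul _ (by fun_prop)]
  refine lintegral_congr fun x => ?_
  rw [← ENNReal.ofReal_mul (by positivity), ← ENNReal.ofReal_mul (by positivity), mul_assoc,
    ← Real.exp_add, ← mul_assoc, div_mul_cancel₀ _ hrs.ne']
  congr 3
  ring

lemma integrable_exp_neg_mul {r s : ℝ} (hr : 0 < r) (hs : 0 ≤ s) :
    Integrable (fun x => Real.exp (-(s * x))) (expMeasure r) := by
  refine ⟨by fun_prop, ?_⟩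
  rw [hasFiniteIntegral_iff_ofReal (Eventually.of_forall fun x => Real.exp_nonneg _),
    lintegral_exp_neg_mul hr hs]
  exact ENNReal.ofReal_lt_top

lemma integral_exp_neg_mul {r s : ℝ} (hr : 0 < r) (hs : 0 ≤ s) :
    ∫ x, Real.exp (-(s * x)) ∂expMeasure r = r / (r + s) := by
  rw [integral_eq_lintegral_of_nonneg_ae (Eventually.of_forall fun x => Real.exp_nonneg _)
    (by fun_prop), lintegral_exp_neg_mul hr hs, ENNReal.toReal_ofReal (by positivity)]

/-- The event that a random walk with steps `x l - y l` does not exceed `z` in the first `n`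
steps. -/
def staysBelow (n : ℕ) (z : ℝ) : Set ((ℕ → ℝ) × (ℕ → ℝ)) :=
  {p | ∀ k < n, psum p.1 k ≤ psum p.2 k + z}

lemma measurableSet_staysBelow' (n : ℕ) :
    MeasurableSet {q : ℝ × ((ℕ → ℝ) × (ℕ → ℝ)) | q.2 ∈ staysBelow n q.1} := by
  change MeasurableSet {q : ℝ × ((ℕ → ℝ) × (ℕ → ℝ)) |
    ∀ k < n, psum q.2.1 k ≤ psum q.2.2 k + q.1}
  simp only [Set.ofPred_forall]
  exact .iInter fun k => .iInter fun _ => measurableSet_le (by fun_prop) (by fun_prop)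

lemma measurableSet_staysBelow (n : ℕ) (z : ℝ) : MeasurableSet (staysBelow n z) :=
  (by fun_prop : Measurable fun p : (ℕ → ℝ) × (ℕ → ℝ) => (z, p)) (measurableSet_staysBelow' n)

lemma scons_mem_staysBelow {n : ℕ} {z x y : ℝ} {a b : ℕ → ℝ} :
    (scons x a, scons y b) ∈ staysBelow (n + 1) z
      ↔ x ≤ y + z ∧ (a, b) ∈ staysBelow n (y + z - x) := by
  simp only [staysBelow, Set.mem_ofPred_eq]
  constructor
  · intro h
    refine ⟨by simpa [psum_zero] using h 0 (by omega), fun k hk => ?_⟩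
    have := h (k + 1) (by omega)
    rw [psum_succ', psum_succ'] at this
    simp only [scons_zero, stail_scons] at this
    linarith
  · rintro ⟨h0, h1⟩ k hk
    cases k with
    | zero => simpa [psum_zero] using h0
    | succ k =>
      rw [psum_succ', psum_succ']
      have := h1 k (by omega)
      simp only [scons_zero, stail_scons]
      linarith

/-- The integral over the first step of the walk that appears in the harmonic function argument
below. -/
lemma lintegral_step_le {lam θ A w : ℝ} (h1 : lam < 1) (hθ1 : θ < 1) (hA : 0 ≤ A)
    (hw : 0 ≤ w) :
    ∫⁻ x, (Set.Iic w).indicator (fun x => ENNReal.ofReal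
        (1 - lam * Real.exp (-((1 - lam) * (w - x))) + A * Real.exp (-(θ * (w - x))))) x
        ∂expMeasure 1
      ≤ ENNReal.ofReal (1 - Real.exp (-((1 - lam) * w)) + A / (1 - θ) * Real.exp (-(θ * w))) := by
  set f : ℝ → ℝ := fun x => Real.exp (-x) *
    (1 - lam * Real.exp (-((1 - lam) * (w - x))) + A * Real.exp (-(θ * (w - x)))) with hf
  have hfc : Continuous f := by fun_prop
  have hθ : 1 - θ ≠ 0 := (sub_pos.2 hθ1).ne'
  rw [lintegral_expMeasure (Measurable.indicator (by fun_prop) measurableSet_Iic),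
    ← lintegral_indicator measurableSet_Ioi]
  have e1 : ∫⁻ x, (Set.Ioi 0).indicator (fun x => ENNReal.ofReal (1 * Real.exp (-(1 * x))) *
        (Set.Iic w).indicator (fun x => ENNReal.ofReal
          (1 - lam * Real.exp (-((1 - lam) * (w - x))) + A * Real.exp (-(θ * (w - x))))) x) x
      = ∫⁻ x in Set.Ioc 0 w, ENNReal.ofReal (f x) := by
    rw [← lintegral_indicator measurableSet_Ioc]
    refine lintegral_congr fun x => ?_
    by_cases hx0 : 0 < x
    · by_cases hxw : x ≤ w
      · simp [Set.indicator, hx0, hxw, hf, ENNReal.ofReal_mul (Real.exp_nonneg _)]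
      · simp [Set.indicator, hx0, hxw]
    · simp [Set.indicator, hx0]
  rw [e1, ← ofReal_integral_eq_lintegral_ofReal (hfc.integrableOn_Ioc),
    ← intervalIntegral.integral_of_le hw]
  -- an antiderivative of `f`
  · have hd : ∀ x ∈ Set.uIcc 0 w, HasDerivAt (fun x => -Real.exp (-x)
        + Real.exp (-((1 - lam) * w)) * Real.exp (-(lam * x))
        - A * Real.exp (-(θ * w)) * Real.exp (-((1 - θ) * x)) / (1 - θ)) (f x) x := by
      intro x _
      have d1 : HasDerivAt (fun x : ℝ => Real.exp (-x)) (-Real.exp (-x)) x := by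
        simpa using (hasDerivAt_neg x).exp
      have d2 : ∀ c : ℝ, HasDerivAt (fun x : ℝ => Real.exp (-(c * x)))
          (Real.exp (-(c * x)) * -c) x := by
        intro c
        simpa using (((hasDerivAt_id x).const_mul c).neg).exp
      have := (d1.neg.add ((d2 lam).const_mul (Real.exp (-((1 - lam) * w))))).sub
        (((d2 (1 - θ)).const_mul (A * Real.exp (-(θ * w)))).div_const (1 - θ))
      refine this.congr_deriv ?_
      have x1 : Real.exp (-((1 - lam) * w)) * Real.exp (-(lam * x))
          = Real.exp (-x) * Real.exp (-((1 - lam) * (w - x))) := by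
        rw [← Real.exp_add, ← Real.exp_add]; congr 1; ring
      have x2 : Real.exp (-(θ * w)) * Real.exp (-((1 - θ) * x))
          = Real.exp (-x) * Real.exp (-(θ * (w - x))) := by
        rw [← Real.exp_add, ← Real.exp_add]; congr 1; ring
      simp only [hf]
      have x3 : ∀ E : ℝ, A * Real.exp (-(θ * w)) * (E * -(1 - θ)) / (1 - θ)
          = -(A * Real.exp (-(θ * w)) * E) := fun E => by
        rw [div_eq_iff hθ]; ring
      rw [x3]
      linear_combination (-lam) * x1 + A * x2
    rw [intervalIntegral.integral_eq_sub_of_hasDerivAt hd (hfc.intervalIntegrable _ _)]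
    refine ENNReal.ofReal_le_ofReal ?_
    have x1 : Real.exp (-((1 - lam) * w)) * Real.exp (-(lam * w)) = Real.exp (-w) := by
      rw [← Real.exp_add]; congr 1; ring
    have x2 : 0 ≤ A * Real.exp (-(θ * w)) * Real.exp (-((1 - θ) * w)) / (1 - θ) :=
      div_nonneg (by positivity) (sub_pos.2 hθ1).le
    have x3 : A / (1 - θ) * Real.exp (-(θ * w)) = A * Real.exp (-(θ * w)) / (1 - θ) := by ring
    simp only [mul_zero, neg_zero, Real.exp_zero, mul_one]
    linarith
  · refine ae_restrict_of_forall_mem measurableSet_Ioc fun x hx => ?_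
    have h2 : Real.exp (-((1 - lam) * (w - x))) ≤ 1 := Real.exp_le_one_iff.2 (by
      have := mul_nonneg (sub_pos.2 h1).le (sub_nonneg.2 hx.2)
      linarith)
    have h3 : 0 ≤ A * Real.exp (-(θ * (w - x))) := by positivity
    have h4 : lam * Real.exp (-((1 - lam) * (w - x))) ≤ 1 :=
      mul_le_one₀ h1.le (Real.exp_nonneg _) h2
    exact mul_nonneg (Real.exp_nonneg _) (by linarith)

/-- An upper bound for the probability that a walk with negative drift stays below `z`. The
function `1 - lam * exp (-(1 - lam) * z)` is harmonic for the walk killed above `z`, and the second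
term decreases to `0` as `n` grows because `4 * lam < (1 + lam) ^ 2`. -/
lemma staysBelow_le {lam : ℝ} (h0 : 0 < lam) (h1 : lam < 1) (n : ℕ) {z : ℝ} (hz : 0 ≤ z) :
    ((expSeq 1).prod (expSeq lam)) (staysBelow n z)
      ≤ ENNReal.ofReal (1 - lam * Real.exp (-((1 - lam) * z))
          + (4 * lam / (1 + lam) ^ 2) ^ n * Real.exp (-((1 - lam) / 2 * z))) := by
  have := isProbabilityMeasure_expMeasure h0
  set q : ℝ := 4 * lam / (1 + lam) ^ 2 with hq
  have hq0 : 0 ≤ q := by positivity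
  have hb : 0 < 1 - lam := sub_pos.2 h1
  induction n generalizing z with
  | zero =>
    have h2 : lam * Real.exp (-((1 - lam) * z)) ≤ Real.exp (-((1 - lam) / 2 * z)) := by
      have h3 : Real.exp (-((1 - lam) * z)) ≤ Real.exp (-((1 - lam) / 2 * z)) := by
        apply Real.exp_le_exp.2
        nlinarith [mul_nonneg hb.le hz]
      nlinarith [Real.exp_nonneg (-((1 - lam) * z))]
    calc _ ≤ (1 : ℝ≥0∞) := prob_le_one
      _ = ENNReal.ofReal 1 := by simp
      _ ≤ _ := ENNReal.ofReal_le_ofReal (by rw [pow_zero, one_mul]; linarith)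
  | succ n ih =>
    set A := q ^ n with hA
    have hA0 : 0 ≤ A := pow_nonneg hq0 n
    have hs := measurePreserving_scons_prod (expMeasure 1) (expMeasure lam)
    have hm := measurableSet_staysBelow (n + 1) z
    rw [← hs.measure_preimage hm.nullMeasurableSet, Measure.prod_apply (hs.measurable hm)]
    -- after a first step that stays below `z` the walk has the distance `y + z - x` to the level
    have hfib : ∀ p : ℝ × ℝ, ((expSeq 1).prod (expSeq lam)) (Prod.mk p ⁻¹'
        ((fun q : (ℝ × ℝ) × ((ℕ → ℝ) × (ℕ → ℝ)) => (scons q.1.1 q.2.1, scons q.1.2 q.2.2)) ⁻¹'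
          staysBelow (n + 1) z))
        ≤ (Set.Iic (p.2 + z)).indicator (fun x => ENNReal.ofReal
          (1 - lam * Real.exp (-((1 - lam) * (p.2 + z - x)))
            + A * Real.exp (-((1 - lam) / 2 * (p.2 + z - x))))) p.1 := by
      rintro ⟨x, y⟩
      by_cases hxy : x ≤ y + z
      · rw [Set.indicator_of_mem (by exact hxy)]
        refine le_trans (measure_mono ?_) (ih (sub_nonneg.2 hxy))
        rintro ⟨a, b⟩ hab
        exact (scons_mem_staysBelow.1 hab).2
      · rw [Set.indicator_of_notMem (by exact hxy), nonpos_iff_eq_zero]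
        convert measure_empty (μ := (expSeq 1).prod (expSeq lam)) using 2
        ext ⟨a, b⟩
        simp only [Set.mem_empty_iff_false, iff_false]
        exact fun hab => hxy (scons_mem_staysBelow.1 hab).1
    refine (lintegral_mono hfib).trans ?_
    have hmeas : Measurable fun p : ℝ × ℝ => (Set.Iic (p.2 + z)).indicator (fun x => ENNReal.ofReal
          (1 - lam * Real.exp (-((1 - lam) * (p.2 + z - x)))
            + A * Real.exp (-((1 - lam) / 2 * (p.2 + z - x))))) p.1 := by
      simp only [Set.indicator, Set.mem_Iic]
      exact Measurable.ite (measurableSet_le (by fun_prop) (by fun_prop)) (by fun_prop)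
        measurable_const
    rw [lintegral_prod_symm _ hmeas.aemeasurable]
    have hstep : ∀ᵐ y ∂expMeasure lam, (∫⁻ x, (Set.Iic (y + z)).indicator
        (fun x => ENNReal.ofReal (1 - lam * Real.exp (-((1 - lam) * (y + z - x)))
            + A * Real.exp (-((1 - lam) / 2 * (y + z - x))))) x ∂expMeasure 1)
        ≤ ENNReal.ofReal (1 - Real.exp (-((1 - lam) * z)) * Real.exp (-((1 - lam) * y))
          + A / (1 - (1 - lam) / 2) * Real.exp (-((1 - lam) / 2 * z))
            * Real.exp (-((1 - lam) / 2 * y))) := by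
      filter_upwards [ae_pos_expMeasure h0] with y hy
      refine (lintegral_step_le h1 (by linarith) hA0 (by linarith)).trans (le_of_eq ?_)
      rw [mul_add, mul_add, neg_add, neg_add, Real.exp_add, Real.exp_add]
      congr 1
      ring
    refine (lintegral_mono_ae hstep).trans (le_of_eq ?_)
    have i1 := (integrable_exp_neg_mul h0 hb.le).const_mul (Real.exp (-((1 - lam) * z)))
    have i2 := (integrable_exp_neg_mul h0 (half_pos hb).le).const_mul
      (A / (1 - (1 - lam) / 2) * Real.exp (-((1 - lam) / 2 * z)))
    have i0 : Integrable (fun _ : ℝ => (1 : ℝ)) (expMeasure lam) := integrable_const _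
    have i3 : Integrable (fun y => 1 - Real.exp (-((1 - lam) * z)) * Real.exp (-((1 - lam) * y))
          + A / (1 - (1 - lam) / 2) * Real.exp (-((1 - lam) / 2 * z))
            * Real.exp (-((1 - lam) / 2 * y))) (expMeasure lam) := (i0.sub i1).add i2
    rw [← ofReal_integral_eq_lintegral_ofReal i3]
    · congr 1
      refine (integral_add (i0.sub i1) i2).trans ?_
      refine (congrArg (· + _) (integral_sub i0 i1)).trans ?_
      rw [integral_const_mul, integral_const_mul, integral_exp_neg_mul h0 hb.le,
        integral_exp_neg_mul h0 (half_pos hb).le]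
      simp only [integral_const, probReal_univ, smul_eq_mul, mul_one, pow_succ]
      rw [← hA, hq]
      have : 1 + lam ≠ 0 := by positivity
      have h5 : lam + (1 - lam) / 2 ≠ 0 := by linarith
      have h6 : 1 - (1 - lam) / 2 ≠ 0 := by linarith
      have h7 : lam + (1 - lam) = 1 := by ring
      rw [h7, div_one]
      -- the exponent `(1 - lam) / 2` minimizes the factor per step
      have h8 : A / (1 - (1 - lam) / 2) * (lam / (lam + (1 - lam) / 2))
          = A * (4 * lam / (1 + lam) ^ 2) := by
        rw [show 1 - (1 - lam) / 2 = (1 + lam) / 2 by ring,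
          show lam + (1 - lam) / 2 = (1 + lam) / 2 by ring]
        field_simp
        ring
      linear_combination Real.exp (-((1 - lam) / 2 * z)) * h8
    · filter_upwards [ae_pos_expMeasure h0] with y hy
      have h2 : Real.exp (-((1 - lam) * z)) ≤ 1 :=
        Real.exp_le_one_iff.2 (by nlinarith [mul_nonneg hb.le hz])
      have h3 : Real.exp (-((1 - lam) * y)) ≤ 1 :=
        Real.exp_le_one_iff.2 (by nlinarith [mul_nonneg hb.le hy.le])
      have h4 := mul_le_one₀ h2 (Real.exp_nonneg _) h3
      have h5 : 0 < 1 - (1 - lam) / 2 := by linarith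
      have h6 : 0 ≤ A / (1 - (1 - lam) / 2) * Real.exp (-((1 - lam) / 2 * z))
            * Real.exp (-((1 - lam) / 2 * y)) := by positivity
      simp only [Pi.zero_apply]
      linarith

/-- A symmetric exponential random walk exceeds every level. -/
lemma ae_exists_psum_gt_one (z : ℝ) :
    ∀ᵐ p ∂(expSeq 1).prod (expSeq 1), ∃ k, psum p.2 k + z < psum p.1 k := by
  suffices h : ((expSeq 1).prod (expSeq 1)) {p | ∀ k, psum p.1 k ≤ psum p.2 k + max z 0} = 0 by
    refine measure_mono_null (fun p hp => ?_) h
    simp only [Set.mem_compl_iff, Set.mem_ofPred_eq, not_exists, not_lt] at hp ⊢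
    exact fun k => (hp k).trans (by linarith [le_max_left z 0])
  set w := max z 0
  have hw : 0 ≤ w := le_max_right _ _
  -- slow down the second walk: this gives a bound for each `lam < 1`
  have hle : ∀ lam : ℝ, 0 < lam → lam < 1 →
      ((expSeq 1).prod (expSeq 1)) {p | ∀ k, psum p.1 k ≤ psum p.2 k + w}
        ≤ ENNReal.ofReal (1 - lam * Real.exp (-((1 - lam) * w))) := by
    intro lam h0 h1
    have := isProbabilityMeasure_expMeasure h0
    have hmp : MeasurePreserving (fun x k => 1 / lam * x k : (ℕ → ℝ) → (ℕ → ℝ))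
        (expSeq 1) (expSeq lam) := ⟨by fun_prop, map_const_mul_expSeq h0 one_pos⟩
    have hmp2 := (MeasurePreserving.id (expSeq 1)).prod hmp
    have hn : ∀ n, ((expSeq 1).prod (expSeq 1)) {p | ∀ k, psum p.1 k ≤ psum p.2 k + w}
        ≤ ENNReal.ofReal (1 - lam * Real.exp (-((1 - lam) * w))
          + (4 * lam / (1 + lam) ^ 2) ^ n * Real.exp (-((1 - lam) / 2 * w))) := by
      intro n
      refine le_trans ?_ (staysBelow_le h0 h1 n hw)
      rw [← hmp2.measure_preimage (measurableSet_staysBelow n w).nullMeasurableSet]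
      refine measure_mono_ae ?_
      have hpos : ∀ᵐ p ∂(expSeq 1).prod (expSeq 1), ∀ k, 0 < p.2 k :=
        Measure.quasiMeasurePreserving_snd.ae (ae_pos_expSeq one_pos)
      filter_upwards [hpos] with p hp h k hk
      have h2 := h k
      simp only [Prod.map, id, psum_mul]
      have h3 := (psum_pos hp k).le
      have h4 : 1 ≤ 1 / lam := by rw [le_div_iff₀ h0]; linarith
      nlinarith
    have hq : Tendsto (fun n : ℕ => ENNReal.ofReal (1 - lam * Real.exp (-((1 - lam) * w))
          + (4 * lam / (1 + lam) ^ 2) ^ n * Real.exp (-((1 - lam) / 2 * w)))) atTop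
        (𝓝 (ENNReal.ofReal (1 - lam * Real.exp (-((1 - lam) * w))
          + 0 * Real.exp (-((1 - lam) / 2 * w))))) := by
      refine ENNReal.tendsto_ofReal (tendsto_const_nhds.add (Tendsto.mul_const _ ?_))
      refine tendsto_pow_atTop_nhds_zero_of_lt_one (by positivity) ?_
      rw [div_lt_one (by positivity)]
      nlinarith [mul_pos (sub_pos.2 h1) (sub_pos.2 h1)]
    have := ge_of_tendsto' hq hn
    simpa using this
  have hlim : Tendsto (fun lam : ℝ => ENNReal.ofReal (1 - lam * Real.exp (-((1 - lam) * w))))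
      (𝓝[<] 1) (𝓝 0) := by
    have hc : Continuous fun lam : ℝ =>
        ENNReal.ofReal (1 - lam * Real.exp (-((1 - lam) * w))) :=
      ENNReal.continuous_ofReal.comp (by fun_prop)
    have := (hc.tendsto 1).mono_left (nhdsWithin_le_nhds (s := Set.Iio 1))
    simpa using this
  refine le_antisymm (ge_of_tendsto hlim ?_) zero_le
  filter_upwards [Ioo_mem_nhdsLT (show (0 : ℝ) < 1 by norm_num)] with lam hlam
  exact hle lam hlam.1 hlam.2

/-- The difference of two exponential random walks exceeds every level if the rate of the first one
is at most that of the second one. -/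
lemma ae_exists_psum_gt {r s : ℝ} (hr : 0 < r) (hrs : r ≤ s) (z : ℝ) :
    ∀ᵐ p ∂(expSeq r).prod (expSeq s), ∃ k, psum p.2 k + z < psum p.1 k := by
  have hs := hr.trans_le hrs
  have := isProbabilityMeasure_expMeasure hr
  have := isProbabilityMeasure_expMeasure hs
  have m1 : MeasurePreserving (fun x k => 1 / r * x k : (ℕ → ℝ) → (ℕ → ℝ))
      (expSeq 1) (expSeq r) := ⟨by fun_prop, map_const_mul_expSeq hr one_pos⟩
  have m2 : MeasurePreserving (fun x k => 1 / s * x k : (ℕ → ℝ) → (ℕ → ℝ))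
      (expSeq 1) (expSeq s) := ⟨by fun_prop, map_const_mul_expSeq hs one_pos⟩
  have hmeas : MeasurableSet {p : (ℕ → ℝ) × (ℕ → ℝ) | ∃ k, psum p.2 k + z < psum p.1 k} := by
    simp only [Set.ofPred_exists]
    exact .iUnion fun k => measurableSet_lt (by fun_prop) (by fun_prop)
  -- both walks are multiples of walks of rate one, and the second factor is the smaller one
  rw [← (m1.prod m2).map_eq, ae_map_iff (m1.prod m2).measurable.aemeasurable hmeas]
  have hpos : ∀ᵐ p ∂(expSeq 1).prod (expSeq 1), ∀ k, 0 < p.2 k :=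
    Measure.quasiMeasurePreserving_snd.ae (ae_pos_expSeq one_pos)
  filter_upwards [hpos, ae_exists_psum_gt_one (r * z)] with p hp ⟨k, hk⟩
  refine ⟨k, ?_⟩
  simp only [Prod.map, psum_mul]
  have h3 := (psum_pos hp k).le
  have h4 : 1 / s * psum p.2 k ≤ 1 / r * psum p.2 k :=
    mul_le_mul_of_nonneg_right (one_div_le_one_div_of_le hr hrs) h3
  have h5 : 1 / r * (psum p.2 k + r * z) < 1 / r * psum p.1 k :=
    mul_lt_mul_of_pos_left hk (by positivity)
  have h6 : 1 / r * (r * z) = z := by field_simp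
  linarith

/-! ### The gaps of a Poisson process -/

/-- The differences of consecutive terms of a sequence; the first term is kept. -/
def gap (x : ℕ → ℝ) : ℕ → ℝ
  | 0 => x 0
  | k + 1 => x (k + 1) - x k

@[fun_prop] lemma measurable_gap : Measurable gap := by
  refine measurable_pi_lambda _ fun k => ?_
  cases k <;> simp only [gap] <;> fun_prop

lemma psum_gap (x : ℕ → ℝ) : psum (gap x) = x := by
  funext k
  induction k with
  | zero => simp [psum_zero, gap]
  | succ k ih => rw [psum_succ, ih]; simp [gap]

lemma gap_psum (x : ℕ → ℝ) : gap (psum x) = x := by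
  funext k
  cases k with
  | zero => simp [psum_zero, gap]
  | succ k => simp [psum_succ, gap]

/-- The intervals `(a k, b k]`, `k ≤ n`, are arranged from left to right in `(0, ∞)`. -/
structure OrderedBoxes (n : ℕ) (a b : ℕ → ℝ) : Prop where
  nonneg : 0 ≤ a 0
  le : ∀ k ≤ n, a k ≤ b k
  le_succ : ∀ k < n, b k ≤ a (k + 1)

lemma OrderedBoxes.tail {n : ℕ} {a b : ℕ → ℝ} (h : OrderedBoxes (n + 1) a b) :
    OrderedBoxes n (stail a) (stail b) where
  nonneg := h.nonneg.trans ((h.le 0 (by omega)).trans (h.le_succ 0 (by omega)))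
  le k hk := h.le (k + 1) (by omega)
  le_succ k hk := h.le_succ (k + 1) (by omega)

lemma OrderedBoxes.le_of_lt {n : ℕ} {a b : ℕ → ℝ} (h : OrderedBoxes n a b) {i j : ℕ} (hij : i < j)
    (hj : j ≤ n) : b i ≤ a j := by
  induction j with
  | zero => omega
  | succ j ih =>
    rcases Nat.lt_succ_iff_lt_or_eq.1 hij with h1 | h1
    · exact (ih h1 (by omega)).trans ((h.le j (by omega)).trans (h.le_succ j (by omega)))
    · exact h1 ▸ h.le_succ i (by omega)

/-- The probability that the points `k = 0, …, n` of a homogeneous Poisson process on `(0, ∞)` lie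
in the intervals `(a k, b k]`. -/
def boxProb (r : ℝ) (n : ℕ) (a b : ℕ → ℝ) : ℝ :=
  (∏ k ∈ Finset.range n, r * (b k - a k)) * (Real.exp (-(r * a n)) - Real.exp (-(r * b n)))

lemma boxProb_succ (r : ℝ) (n : ℕ) (a b : ℕ → ℝ) :
    boxProb r (n + 1) a b = r * (b 0 - a 0) * boxProb r n (stail a) (stail b) := by
  simp only [boxProb, Finset.prod_range_succ' _ n, stail_apply]
  ring

lemma boxProb_nonneg {r : ℝ} (hr : 0 < r) {n : ℕ} {a b : ℕ → ℝ} (h : OrderedBoxes n a b) :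
    0 ≤ boxProb r n a b := by
  refine mul_nonneg (Finset.prod_nonneg fun k hk => ?_) (sub_nonneg.2 (Real.exp_le_exp.2 ?_))
  · exact mul_nonneg hr.le (sub_nonneg.2 (h.le k (Finset.mem_range.1 hk).le))
  · exact neg_le_neg (mul_le_mul_of_nonneg_left (h.le n le_rfl) hr.le)

/-- The probability `boxProb` for points with independent exponential distances. The induction is
over the first point, so the sequence is allowed to start at any `c` to the left of the boxes. -/
lemma expSeq_box {r : ℝ} (hr : 0 < r) (n : ℕ) {a b : ℕ → ℝ} (h : OrderedBoxes n a b) {c : ℝ}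
    (hc : c ≤ a 0) :
    expSeq r {e | ∀ k ≤ n, c + psum e k ∈ Set.Ioc (a k) (b k)}
      = ENNReal.ofReal (Real.exp (r * c) * boxProb r n a b) := by
  have := isProbabilityMeasure_expMeasure hr
  have hs := measurePreserving_scons (expMeasure r)
  have hmeas : ∀ (n : ℕ) (a b : ℕ → ℝ) (c : ℝ),
      MeasurableSet {e : ℕ → ℝ | ∀ k ≤ n, c + psum e k ∈ Set.Ioc (a k) (b k)} := by
    intro n a b c
    simp only [Set.ofPred_forall]
    exact .iInter fun k => .iInter fun _ =>
      (by fun_prop : Measurable fun e : ℕ → ℝ => c + psum e k) measurableSet_Ioc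
  induction n generalizing a b c with
  | zero =>
    have hab := h.le 0 le_rfl
    rw [← hs.measure_preimage (hmeas 0 a b c).nullMeasurableSet]
    have hset : (fun p : ℝ × (ℕ → ℝ) => scons p.1 p.2) ⁻¹'
        {e | ∀ k ≤ 0, c + psum e k ∈ Set.Ioc (a k) (b k)}
        = (Set.Ioi (a 0 - c) \ Set.Ioi (b 0 - c)) ×ˢ Set.univ := by
      ext ⟨x, e⟩
      simp only [Set.mem_preimage, Set.mem_ofPred_eq, Nat.le_zero, forall_eq, psum_zero,
        scons_zero, Set.mem_Ioc, Set.mem_prod, Set.mem_sdiff, Set.mem_Ioi, Set.mem_univ, and_true,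
        not_lt]
      constructor <;> rintro ⟨h1, h2⟩ <;> constructor <;> linarith
    rw [hset, Measure.prod_prod, measure_univ, mul_one,
      measure_sdiff (Set.Ioi_subset_Ioi (by linarith)) measurableSet_Ioi.nullMeasurableSet
        (measure_ne_top _ _), expMeasure_Ioi hr (by linarith), expMeasure_Ioi hr (by linarith),
      ← ENNReal.ofReal_sub _ (Real.exp_nonneg _)]
    congr 1
    simp only [boxProb, Finset.range_zero, Finset.prod_empty, one_mul, mul_sub, ← Real.exp_add]
    congr 2 <;> ring
  | succ n ih =>
    have hab := h.le 0 (by omega)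
    set K := boxProb r n (stail a) (stail b)
    have hK : 0 ≤ K := boxProb_nonneg hr h.tail
    rw [← hs.measure_preimage (hmeas (n + 1) a b c).nullMeasurableSet,
      Measure.prod_apply (hs.measurable (hmeas (n + 1) a b c))]
    -- the density of the first point cancels the factor `exp (r * (c + x))` of the other ones
    have hfib : ∀ x, expSeq r (Prod.mk x ⁻¹' ((fun p : ℝ × (ℕ → ℝ) => scons p.1 p.2) ⁻¹'
        {e | ∀ k ≤ n + 1, c + psum e k ∈ Set.Ioc (a k) (b k)}))
        = (Set.Ioc (a 0 - c) (b 0 - c)).indicator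
          (fun x => ENNReal.ofReal (Real.exp (r * (c + x)) * K)) x := by
      intro x
      by_cases hx : x ∈ Set.Ioc (a 0 - c) (b 0 - c)
      · rw [Set.indicator_of_mem hx]
        have hcx : c + x ≤ stail a 0 := by
          have := h.le_succ 0 (by omega)
          simp only [stail_apply]
          linarith [hx.2]
        rw [← ih h.tail hcx]
        congr 1
        ext e
        simp only [Set.mem_preimage, Set.mem_ofPred_eq]
        constructor
        · intro h1 k hk
          have := h1 (k + 1) (by omega)
          rwa [psum_succ', scons_zero, stail_scons, ← add_assoc] at this
        · intro h1 k hk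
          cases k with
          | zero =>
            rw [psum_zero, scons_zero]
            exact ⟨by linarith [hx.1], by linarith [hx.2]⟩
          | succ k =>
            rw [psum_succ', scons_zero, stail_scons, ← add_assoc]
            exact h1 k (by omega)
      · rw [Set.indicator_of_notMem hx]
        convert measure_empty (μ := expSeq r) using 2
        ext e
        simp only [Set.mem_preimage, Set.mem_ofPred_eq, Set.mem_empty_iff_false, iff_false]
        intro h1
        have := h1 0 (by omega)
        rw [psum_zero, scons_zero] at this
        exact hx ⟨by linarith [this.1], by linarith [this.2]⟩
    simp_rw [hfib]
    rw [lintegral_expMeasure (Measurable.indicator (by fun_prop) measurableSet_Ioc),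
      ← lintegral_indicator measurableSet_Ioi]
    have e1 : ∀ x, (Set.Ioi 0).indicator (fun x => ENNReal.ofReal (r * Real.exp (-(r * x))) *
        (Set.Ioc (a 0 - c) (b 0 - c)).indicator
          (fun x => ENNReal.ofReal (Real.exp (r * (c + x)) * K)) x) x
        = (Set.Ioc (a 0 - c) (b 0 - c)).indicator
          (fun _ => ENNReal.ofReal (r * Real.exp (r * c) * K)) x := by
      intro x
      by_cases hx : x ∈ Set.Ioc (a 0 - c) (b 0 - c)
      · have hx0 : 0 < x := by linarith [hx.1]
        rw [Set.indicator_of_mem (by exact hx0), Set.indicator_of_mem hx,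
          Set.indicator_of_mem hx, ← ENNReal.ofReal_mul (by positivity)]
        congr 1
        rw [mul_add, Real.exp_add]
        have : Real.exp (-(r * x)) * Real.exp (r * x) = 1 := by rw [← Real.exp_add]; simp
        linear_combination r * Real.exp (r * c) * K * this
      · rw [Set.indicator_of_notMem hx]
        simp only [Set.indicator, hx, if_false, mul_zero, ite_self]
    simp_rw [e1]
    rw [lintegral_indicator measurableSet_Ioc, setLIntegral_const, Real.volume_Ioc,
      ← ENNReal.ofReal_mul (by positivity), boxProb_succ]
    congr 1
    ring

/-- A description of the event that the points of an increasing sequence lie in ordered intervals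
in terms of the numbers of points in these intervals and between them. -/
lemma forall_mem_Ioc_iff {n : ℕ} {a b : ℕ → ℝ} (h : OrderedBoxes n a b) {x : ℕ → ℝ}
    (hx : StrictMono x) (hx0 : 0 < x 0) :
    (∀ k ≤ n, x k ∈ Set.Ioc (a k) (b k)) ↔
      (∀ k ≤ n, (Set.range x ∩ Set.Ioc (scons 0 b k) (a k)).encard = 0) ∧
      (∀ k ≤ n, (Set.range x ∩ Set.Ioc (a k) (b k)).encard ∈
        (if k = n then {0}ᶜ else {1} : Set ℕ∞)) := by
  constructor
  · intro hk
    refine ⟨fun k hkn => ?_, fun k hkn => ?_⟩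
    · rw [Set.encard_eq_zero, Set.eq_empty_iff_forall_notMem]
      rintro _ ⟨⟨m, rfl⟩, hm1, hm2⟩
      rcases lt_or_ge m k with hmk | hmk
      · obtain ⟨j, rfl⟩ : ∃ j, k = j + 1 := ⟨k - 1, by omega⟩
        rw [scons_succ] at hm1
        have h1 : x m ≤ x j := hx.monotone (by omega)
        exact absurd (h1.trans (hk j (by omega)).2) (not_le.2 hm1)
      · exact absurd ((hk k hkn).1.trans_le (hx.monotone hmk)) (not_lt.2 hm2)
    · split_ifs with hkn'
      · rw [Set.mem_compl_singleton_iff, Set.encard_ne_zero]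
        exact ⟨x k, ⟨k, rfl⟩, hk k hkn⟩
      · rw [Set.mem_singleton_iff, Set.encard_eq_one]
        refine ⟨x k, Set.eq_singleton_iff_unique_mem.2 ⟨⟨⟨k, rfl⟩, hk k hkn⟩, ?_⟩⟩
        rintro _ ⟨⟨m, rfl⟩, hm1, hm2⟩
        rcases lt_trichotomy m k with hmk | hmk | hmk
        · exact absurd ((hk m (by omega)).2.trans (h.le_of_lt hmk hkn)) (not_le.2 hm1)
        · rw [hmk]
        · have h1 : x (k + 1) ≤ x m := hx.monotone (by omega)
          have h2 := (hk (k + 1) (by omega)).1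
          have h3 := h.le_succ k (by omega)
          linarith
  · rintro ⟨h0, h1⟩ k
    induction k using Nat.strong_induction_on with
    | _ k ih =>
      intro hkn
      have hne : (Set.range x ∩ Set.Ioc (a k) (b k)).Nonempty := by
        rw [← Set.encard_ne_zero]
        intro h2
        have := h1 k hkn
        rw [h2] at this
        split_ifs at this <;> simp at this
      obtain ⟨_, ⟨m, rfl⟩, hm1, hm2⟩ := hne
      -- the points before `x k` are in their own boxes, so the point in the box `k` is `x k` or a
      -- later one; and `x k` cannot be to the left of this box, since the interval before the box
      -- is empty and the previous box has only one point
      have hmk : k ≤ m := by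
        by_contra hlt
        push Not at hlt
        exact absurd ((ih m hlt (by omega)).2.trans (h.le_of_lt hlt hkn)) (not_le.2 hm1)
      refine ⟨?_, (hx.monotone hmk).trans hm2⟩
      by_contra hle
      push Not at hle
      have hemp := h0 k hkn
      rw [Set.encard_eq_zero, Set.eq_empty_iff_forall_notMem] at hemp
      have hlow : x k ≤ scons 0 b k := by
        by_contra hgt
        push Not at hgt
        exact hemp (x k) ⟨⟨k, rfl⟩, hgt, hle⟩
      cases k with
      | zero => exact absurd hx0 (not_lt.2 hlow)
      | succ j =>
        have h2 := h1 j (by omega)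
        rw [if_neg (by omega), Set.mem_singleton_iff, Set.encard_eq_one] at h2
        obtain ⟨w, hw⟩ := h2
        have hj := ih j (by omega) (by omega)
        have hlt : x j < x (j + 1) := hx (by omega)
        have e1 : x j ∈ ({w} : Set ℝ) := hw ▸ ⟨⟨j, rfl⟩, hj⟩
        have e2 : x (j + 1) ∈ ({w} : Set ℝ) := hw ▸ ⟨⟨j + 1, rfl⟩, hj.1.trans hlt, hlow⟩
        rw [Set.mem_singleton_iff] at e1 e2
        linarith

namespace IsPoissonProcess

variable {Ω : Type*} [MeasurableSpace Ω] {P : Measure Ω} {ν : Measure ℝ} {X : Ω → Set ℝ}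

lemma indep_count_fintype (hX : IsPoissonProcess P ν X) {ι : Type*} [Fintype ι] {B : ι → Set ℝ}
    (hB : ∀ i, MeasurableSet (B i)) (hd : Pairwise fun i j => Disjoint (B i) (B j)) :
    iIndepFun (fun i ω => (X ω ∩ B i).encard) P := by
  let e := Fintype.equivFin ι
  have h := hX.indep_count _ (fun l => B (e.symm l)) (fun l => hB _)
    fun l m hlm => hd (e.symm.injective.ne hlm)
  have h2 := h.precomp (g := e) e.injective
  simpa [Function.comp_def] using h2

lemma measure_count_eq (hX : IsPoissonProcess P ν X) {B : Set ℝ} (hB : MeasurableSet B)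
    (hν : ν B ≠ ∞) (n : ℕ) :
    P {ω | (X ω ∩ B).encard = n} = poissonMeasure (ν B).toNNReal {n} := by
  have h1 : P {ω | (X ω ∩ B).encard = n} = P.map (fun ω => (X ω ∩ B).encard) {(n : ℕ∞)} := by
    rw [Measure.map_apply (hX.measurable_count B hB) (measurableSet_singleton _)]
    rfl
  rw [h1, hX.law_count B hB hν, Measure.map_apply (by fun_prop) (measurableSet_singleton _)]
  congr 1
  ext m
  simp

lemma measure_count_eq_zero (hX : IsPoissonProcess P ν X) {B : Set ℝ} (hB : MeasurableSet B)
    {m : ℝ} (hm : 0 ≤ m) (hν : ν B = ENNReal.ofReal m) :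
    P {ω | (X ω ∩ B).encard = 0} = ENNReal.ofReal (Real.exp (-m)) := by
  have h := hX.measure_count_eq hB (by rw [hν]; exact ENNReal.ofReal_ne_top) 0
  rw [Nat.cast_zero] at h
  rw [h, poissonMeasure_singleton, hν,
    show ((ENNReal.ofReal m).toNNReal : ℝ) = m from ENNReal.toReal_ofReal hm]
  simp

lemma measure_count_eq_one (hX : IsPoissonProcess P ν X) {B : Set ℝ} (hB : MeasurableSet B)
    {m : ℝ} (hm : 0 ≤ m) (hν : ν B = ENNReal.ofReal m) :
    P {ω | (X ω ∩ B).encard = 1} = ENNReal.ofReal (m * Real.exp (-m)) := by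
  have h := hX.measure_count_eq hB (by rw [hν]; exact ENNReal.ofReal_ne_top) 1
  rw [Nat.cast_one] at h
  rw [h, poissonMeasure_singleton, hν,
    show ((ENNReal.ofReal m).toNNReal : ℝ) = m from ENNReal.toReal_ofReal hm]
  simp [mul_comm]

/-- Almost surely there are finitely many points in a set of finite intensity. -/
lemma ae_finite (hX : IsPoissonProcess P ν X) {B : Set ℝ} (hB : MeasurableSet B)
    (hν : ν B ≠ ∞) : ∀ᵐ ω ∂P, (X ω ∩ B).Finite := by
  have h1 : ∀ᵐ c ∂P.map (fun ω => (X ω ∩ B).encard), c ≠ ⊤ := by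
    rw [hX.law_count B hB hν, ae_map_iff (p := fun c : ℕ∞ => c ≠ ⊤) (by fun_prop)
      (measurableSet_singleton _).compl]
    exact Eventually.of_forall fun n => ENat.natCast_ne_top n
  have h2 := ae_of_ae_map (hX.measurable_count B hB).aemeasurable h1
  filter_upwards [h2] with ω hω
  rwa [Set.encard_ne_top_iff] at hω

/-- Almost surely there is no point in a set of intensity zero. -/
lemma ae_empty (hX : IsPoissonProcess P ν X) [IsProbabilityMeasure P] {B : Set ℝ}
    (hB : MeasurableSet B) (hν : ν B = 0) : ∀ᵐ ω ∂P, X ω ∩ B = ∅ := by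
  have h1 := hX.measure_count_eq_zero hB le_rfl (by rw [hν]; simp)
  rw [neg_zero, Real.exp_zero, ENNReal.ofReal_one] at h1
  have hm : MeasurableSet {ω | (X ω ∩ B).encard = 0} :=
    hX.measurable_count B hB (measurableSet_singleton _)
  filter_upwards [(prob_compl_eq_zero_iff hm).2 h1] with ω hω
  simpa using hω

/-- The probability that the first points of a Poisson process that is homogeneous on `(0, ∞)`
after the change of coordinates `T` lie in given intervals. -/
lemma measure_box [IsProbabilityMeasure P] (hX : IsPoissonProcess P ν X) {r : ℝ} (hr : 0 < r)
    {T : ℝ → ℝ}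
    (hTi : Function.Injective T) (hTm : Measurable T)
    (hν : ∀ a b, 0 ≤ a → a ≤ b → ν (T ⁻¹' Set.Ioc a b) = ENNReal.ofReal (r * (b - a)))
    {x : Ω → ℕ → ℝ} (hmono : ∀ᵐ ω ∂P, StrictMono (x ω)) (hpos : ∀ᵐ ω ∂P, 0 < x ω 0)
    (hrange : ∀ᵐ ω ∂P, ∀ s, 0 < s → (s ∈ Set.range (x ω) ↔ s ∈ T '' X ω))
    {n : ℕ} {a b : ℕ → ℝ} (h : OrderedBoxes n a b) :
    P {ω | ∀ k ≤ n, x ω k ∈ Set.Ioc (a k) (b k)} = ENNReal.ofReal (boxProb r n a b) := by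
  -- the intervals between the boxes are indexed by `inl`, the boxes by `inr`
  let I : Fin (n + 1) ⊕ Fin (n + 1) → Set ℝ :=
    Sum.elim (fun k => Set.Ioc (scons 0 b k) (a k)) fun k => Set.Ioc (a k) (b k)
  let S : Fin (n + 1) ⊕ Fin (n + 1) → Set ℕ∞ :=
    Sum.elim (fun _ => {0}) fun k => if (k : ℕ) = n then {0}ᶜ else {1}
  have hI0 : ∀ k ≤ n, 0 ≤ scons 0 b k := by
    intro k hk
    cases k with
    | zero => exact le_rfl
    | succ k => exact h.nonneg.trans ((h.le 0 (by omega)).trans (by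
        rcases Nat.eq_zero_or_pos k with rfl | hk0
        · exact le_rfl
        · exact (h.le_of_lt hk0 (by omega)).trans (h.le k (by omega))))
  have hIa : ∀ k ≤ n, scons 0 b k ≤ a k := by
    intro k hk
    cases k with
    | zero => exact h.nonneg
    | succ k => exact h.le_succ k (by omega)
  have hIb : ∀ i j : ℕ, i < j → j ≤ n → b i ≤ scons 0 b j := by
    intro i j hij hj
    obtain ⟨m, rfl⟩ : ∃ m, j = m + 1 := ⟨j - 1, by omega⟩
    rcases Nat.lt_succ_iff_lt_or_eq.1 hij with h1 | h1
    · exact (h.le_of_lt h1 (by omega)).trans (h.le m (by omega))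
    · rw [h1]; exact le_rfl
  have hdis : ∀ {p q s t : ℝ}, q ≤ s → Disjoint (Set.Ioc p q) (Set.Ioc s t) := by
    intro p q s t hqs
    exact Set.disjoint_left.2 fun w hw hw' => absurd (hw.2.trans hqs) (not_le.2 hw'.1)
  have hd : Pairwise fun i j => Disjoint (I i) (I j) := by
    rintro (⟨i, hi⟩ | ⟨i, hi⟩) (⟨j, hj⟩ | ⟨j, hj⟩) hij
    · have hij' : i ≠ j := fun h' => hij (by simp [h'])
      rcases lt_or_gt_of_ne hij' with h1 | h1
      · exact hdis ((h.le i (by omega)).trans (hIb i j h1 (by omega)))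
      · exact (hdis ((h.le j (by omega)).trans (hIb j i h1 (by omega)))).symm
    · rcases Nat.lt_or_ge j i with h1 | h1
      · exact (hdis (hIb j i h1 (by omega))).symm
      · refine hdis ?_
        rcases Nat.eq_or_lt_of_le h1 with h2 | h2
        · subst h2; exact le_rfl
        · exact (h.le i (by omega)).trans (h.le_of_lt h2 (by omega))
    · rcases Nat.lt_or_ge i j with h1 | h1
      · exact hdis (hIb i j h1 (by omega))
      · refine (hdis ?_).symm
        rcases Nat.eq_or_lt_of_le h1 with h2 | h2
        · subst h2; exact le_rfl
        · exact (h.le j (by omega)).trans (h.le_of_lt h2 (by omega))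
    · have hij' : i ≠ j := fun h' => hij (by simp [h'])
      rcases lt_or_gt_of_ne hij' with h1 | h1
      · exact hdis (h.le_of_lt h1 (by omega))
      · exact (hdis (h.le_of_lt h1 (by omega))).symm
  have hIm : ∀ i, MeasurableSet (I i) := by
    rintro (i | i) <;> exact measurableSet_Ioc
  have hIpos : ∀ i, I i ⊆ Set.Ioi 0 := by
    rintro (⟨i, hi⟩ | ⟨i, hi⟩) w hw
    · exact (hI0 i (by omega)).trans_lt hw.1
    · exact ((hI0 i (by omega)).trans (hIa i (by omega))).trans_lt hw.1
  have hindep := hX.indep_count_fintype (B := fun i => T ⁻¹' I i) (fun i => hTm (hIm i))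
    fun i j hij => (hd hij).preimage T
  -- the event in terms of counts
  have hev : {ω | ∀ k ≤ n, x ω k ∈ Set.Ioc (a k) (b k)} =ᵐ[P]
      ⋂ i, (fun ω => (X ω ∩ T ⁻¹' I i).encard) ⁻¹' S i := by
    filter_upwards [hmono, hpos, hrange] with ω h1 h2 h3
    refine propext ?_
    have hcount : ∀ i, (X ω ∩ T ⁻¹' I i).encard = (Set.range (x ω) ∩ I i).encard := by
      intro i
      rw [← hTi.injOn.encard_image, Set.image_inter_preimage]
      congr 1
      ext s
      constructor
      · exact fun hs => ⟨(h3 s (hIpos i hs.2)).2 hs.1, hs.2⟩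
      · exact fun hs => ⟨(h3 s (hIpos i hs.2)).1 hs.1, hs.2⟩
    change (∀ k ≤ n, x ω k ∈ Set.Ioc (a k) (b k)) ↔
      ω ∈ ⋂ i, (fun ω => (X ω ∩ T ⁻¹' I i).encard) ⁻¹' S i
    rw [forall_mem_Ioc_iff h h1 h2]
    simp only [Set.mem_iInter, Set.mem_preimage, hcount, Sum.forall, I, S, Sum.elim_inl,
      Sum.elim_inr, Fin.forall_iff, Nat.lt_succ_iff, Set.mem_singleton_iff]
  rw [measure_congr hev, hindep.meas_iInter (fun i => ⟨S i, .of_discrete, rfl⟩),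
    Fintype.prod_sum_type]
  have hP0 : ∀ k : Fin (n + 1), P ((fun ω => (X ω ∩ T ⁻¹' I (Sum.inl k)).encard) ⁻¹' S (Sum.inl k))
      = ENNReal.ofReal (Real.exp (-(r * (a k - scons 0 b k)))) := by
    rintro ⟨k, hk⟩
    exact hX.measure_count_eq_zero (hTm measurableSet_Ioc)
      (mul_nonneg hr.le (sub_nonneg.2 (hIa k (by omega))))
      (hν _ _ (hI0 k (by omega)) (hIa k (by omega)))
  have hP1 : ∀ k : Fin (n + 1), P ((fun ω => (X ω ∩ T ⁻¹' I (Sum.inr k)).encard) ⁻¹' S (Sum.inr k))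
      = ENNReal.ofReal (if (k : ℕ) = n then 1 - Real.exp (-(r * (b k - a k)))
          else r * (b k - a k) * Real.exp (-(r * (b k - a k)))) := by
    rintro ⟨k, hk⟩
    have hk' : k ≤ n := by omega
    have hm : 0 ≤ r * (b k - a k) := mul_nonneg hr.le (sub_nonneg.2 (h.le k hk'))
    have hνk := hν _ _ ((hI0 k hk').trans (hIa k hk')) (h.le k hk')
    by_cases hkn : k = n
    · have h0 := hX.measure_count_eq_zero (hTm measurableSet_Ioc) hm hνk
      have hmeas : MeasurableSet {ω | (X ω ∩ T ⁻¹' Set.Ioc (a k) (b k)).encard = 0} :=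
        hX.measurable_count _ (hTm measurableSet_Ioc) (measurableSet_singleton _)
      have h1 := prob_compl_eq_one_sub (μ := P) hmeas
      rw [h0, ← ENNReal.ofReal_one, ← ENNReal.ofReal_sub _ (Real.exp_nonneg _)] at h1
      simp only [hkn, if_true, S, Sum.elim_inr, I]
      rw [hkn] at h1
      exact h1
    · simp only [hkn, if_false, S, Sum.elim_inr, I]
      exact hX.measure_count_eq_one (hTm measurableSet_Ioc) hm hνk
  simp_rw [hP0, hP1]
  rw [← ENNReal.ofReal_prod_of_nonneg (fun i _ => (Real.exp_nonneg _)),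
    ← ENNReal.ofReal_prod_of_nonneg, ← ENNReal.ofReal_mul
      (Finset.prod_nonneg fun i _ => (Real.exp_nonneg _))]
  · congr 1
    rw [Fin.prod_univ_eq_prod_range (fun k => Real.exp (-(r * (a k - scons 0 b k)))),
      Fin.prod_univ_eq_prod_range (fun k => if k = n then 1 - Real.exp (-(r * (b k - a k)))
          else r * (b k - a k) * Real.exp (-(r * (b k - a k)))), Finset.prod_range_succ _ n,
      Finset.prod_range_succ _ n, if_pos rfl]
    have e1 : ∏ k ∈ Finset.range n, (if k = n then 1 - Real.exp (-(r * (b k - a k)))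
          else r * (b k - a k) * Real.exp (-(r * (b k - a k))))
        = (∏ k ∈ Finset.range n, r * (b k - a k)) *
          ∏ k ∈ Finset.range n, Real.exp (-(r * (b k - a k))) := by
      rw [← Finset.prod_mul_distrib]
      refine Finset.prod_congr rfl fun k hk => ?_
      rw [if_neg (Finset.mem_range.1 hk).ne]
    -- the void probabilities of adjacent intervals telescope
    have e2 : ∀ m, (∏ k ∈ Finset.range m, Real.exp (-(r * (a k - scons 0 b k)))) *
        ∏ k ∈ Finset.range m, Real.exp (-(r * (b k - a k))) = Real.exp (-(r * scons 0 b m)) := by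
      intro m
      induction m with
      | zero => simp
      | succ m ih =>
        rw [Finset.prod_range_succ, Finset.prod_range_succ, mul_mul_mul_comm, ih, ← Real.exp_add,
          ← Real.exp_add, scons_succ]
        congr 1
        ring
    have e3 : Real.exp (-(r * (a n - scons 0 b n))) * Real.exp (-(r * scons 0 b n))
        = Real.exp (-(r * a n)) := by
      rw [← Real.exp_add]; congr 1; ring
    have e4 : Real.exp (-(r * a n)) * Real.exp (-(r * (b n - a n))) = Real.exp (-(r * b n)) := by
      rw [← Real.exp_add]; congr 1; ring
    rw [e1, boxProb, ← e4, ← e3, ← e2 n]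
    ring
  · rintro ⟨k, hk⟩ -
    have hm : 0 ≤ r * (b k - a k) := mul_nonneg hr.le (sub_nonneg.2 (h.le k (by omega)))
    simp only
    split_ifs
    · rw [sub_nonneg]
      exact Real.exp_le_one_iff.2 (by linarith)
    · positivity

end IsPoissonProcess

/-! ### Sequences and ordered intervals -/

/-- The set of increasing sequences of `n + 1` positive numbers. -/
def cone (n : ℕ) : Set (Fin (n + 1) → ℝ) := {y | 0 < y 0 ∧ ∀ i j, i < j → y i < y j}

lemma isOpen_cone (n : ℕ) : IsOpen (cone n) := by
  have h : cone n = {y | 0 < y 0} ∩ ⋂ i, ⋂ j, {y : Fin (n + 1) → ℝ | i < j → y i < y j} := by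
    ext y; simp [cone]
  rw [h]
  refine (isOpen_lt (by fun_prop) (by fun_prop)).inter
    (isOpen_iInter_of_finite fun i => isOpen_iInter_of_finite fun j => ?_)
  by_cases hij : i < j
  · simp only [hij, true_imp_iff]
    exact isOpen_lt (by fun_prop) (by fun_prop)
  · simp [hij]

/-- The box with the sides `(a k, b k]`, `k ≤ n`. -/
def box (n : ℕ) (a b : ℕ → ℝ) : Set (Fin (n + 1) → ℝ) :=
  {y | ∀ k : Fin (n + 1), y k ∈ Set.Ioc (a k) (b k)}

lemma measurableSet_box (n : ℕ) (a b : ℕ → ℝ) : MeasurableSet (box n a b) := by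
  simp only [box, Set.ofPred_forall]
  exact .iInter fun k => measurable_pi_apply k measurableSet_Ioc

lemma OrderedBoxes.box_subset_cone {n : ℕ} {a b : ℕ → ℝ} (h : OrderedBoxes n a b) :
    box n a b ⊆ cone n := by
  intro y hy
  refine ⟨h.nonneg.trans_lt (hy 0).1, fun i j hij => ?_⟩
  exact (hy i).2.trans_lt ((h.le_of_lt (Fin.lt_def.1 hij) (by omega)).trans_lt (hy j).1)

/-- The boxes with rational corners inside an open subset of the cone cover it. Such boxes have
ordered sides, since the corners of a closed box in the cone are increasing sequences. -/
lemma exists_box_of_mem {n : ℕ} {U : Set (Fin (n + 1) → ℝ)} (hU : IsOpen U) (hUC : U ⊆ cone n)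
    {y : Fin (n + 1) → ℝ} (hy : y ∈ U) :
    ∃ p : Fin (n + 1) → ℚ × ℚ, y ∈ {z | ∀ k, z k ∈ Set.Ioc ((p k).1 : ℝ) (p k).2} ∧
      {z | ∀ k, z k ∈ Set.Ioc ((p k).1 : ℝ) (p k).2} ⊆ U ∧
      ∃ a b, OrderedBoxes n a b ∧ {z | ∀ k, z k ∈ Set.Ioc ((p k).1 : ℝ) (p k).2} = box n a b := by
  obtain ⟨ε, hε, hball⟩ := Metric.isOpen_iff.1 hU y hy
  have h1 : ∀ k, ∃ q : ℚ, y k - ε / 2 < q ∧ (q : ℝ) < y k := fun k =>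
    exists_rat_btwn (by linarith)
  have h2 : ∀ k, ∃ q : ℚ, y k < q ∧ (q : ℝ) < y k + ε / 2 := fun k =>
    exists_rat_btwn (by linarith)
  choose p hp1 hp2 using h1
  choose q hq1 hq2 using h2
  have hin : ∀ z : Fin (n + 1) → ℝ, (∀ k, z k ∈ Set.Icc (p k : ℝ) (q k)) → z ∈ U := by
    intro z hz
    refine hball (lt_of_le_of_lt ((dist_pi_le_iff (show (0 : ℝ) ≤ ε / 2 by linarith)).2 fun k => ?_)
      (by linarith))
    rw [Real.dist_eq, abs_le]
    constructor <;> linarith [(hz k).1, (hz k).2, hp1 k, hq2 k]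
  have hpq : ∀ k, (p k : ℝ) < q k := fun k => (hp2 k).trans (hq1 k)
  let a : ℕ → ℝ := fun k => if hk : k < n + 1 then p ⟨k, hk⟩ else 0
  let b : ℕ → ℝ := fun k => if hk : k < n + 1 then q ⟨k, hk⟩ else 0
  have ha : ∀ k (hk : k < n + 1), a k = p ⟨k, hk⟩ := fun k hk => dif_pos hk
  have hb : ∀ k (hk : k < n + 1), b k = q ⟨k, hk⟩ := fun k hk => dif_pos hk
  refine ⟨fun k => (p k, q k), fun k => ⟨hp2 k, (hq1 k).le⟩,
    fun z hz => hin z fun k => ⟨(hz k).1.le, (hz k).2⟩, a, b, ⟨?_, ?_, ?_⟩, ?_⟩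
  · rw [ha 0 (by omega)]
    exact (hUC (hin (fun k => p k) fun k => ⟨le_rfl, (hpq k).le⟩)).1.le
  · intro k hk
    rw [ha k (by omega), hb k (by omega)]
    exact (hpq _).le
  · intro k hk
    rw [hb k (by omega), ha (k + 1) (by omega)]
    have h3 := (hUC (hin (fun j => if (j : ℕ) ≤ k then q j else p j) fun j => by
      split_ifs
      · exact ⟨(hpq j).le, le_rfl⟩
      · exact ⟨le_rfl, (hpq j).le⟩)).2 ⟨k, by omega⟩ ⟨k + 1, by omega⟩ (by simp)
    simp only [le_refl, if_true] at h3
    rw [if_neg (by omega)] at h3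
    exact h3.le
  · ext z
    simp only [box, Set.mem_ofPred_eq]
    refine forall_congr' fun k => ?_
    rw [ha k k.2, hb k k.2]

/-- Two probability measures on sequences that are concentrated on increasing positive sequences
and agree on ordered boxes are equal. -/
lemma ext_of_orderedBoxes {μ ν : Measure (ℕ → ℝ)} [IsProbabilityMeasure μ]
    [IsProbabilityMeasure ν] (hμ : ∀ᵐ x ∂μ, StrictMono x ∧ 0 < x 0)
    (hν : ∀ᵐ x ∂ν, StrictMono x ∧ 0 < x 0)
    (h : ∀ n a b, OrderedBoxes n a b → μ {x | ∀ k ≤ n, x k ∈ Set.Ioc (a k) (b k)}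
      = ν {x | ∀ k ≤ n, x k ∈ Set.Ioc (a k) (b k)}) : μ = ν := by
  have hpre : ∀ n, μ.map (fun x (k : Fin (n + 1)) => x k)
      = ν.map (fun x (k : Fin (n + 1)) => x k) := by
    intro n
    have hm : Measurable fun (x : ℕ → ℝ) (k : Fin (n + 1)) => x k := by fun_prop
    have := Measure.isProbabilityMeasure_map (μ := μ) hm.aemeasurable
    have := Measure.isProbabilityMeasure_map (μ := ν) hm.aemeasurable
    have hcone : ∀ {μ : Measure (ℕ → ℝ)}, (∀ᵐ x ∂μ, StrictMono x ∧ 0 < x 0) →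
        (μ.map fun x (k : Fin (n + 1)) => x k) (cone n)ᶜ = 0 := by
      intro μ hμ
      rw [Measure.map_apply hm (isOpen_cone n).measurableSet.compl]
      refine measure_mono_null (t := {x | ¬ (StrictMono x ∧ 0 < x 0)}) (fun x hx hx' => hx ?_)
        (ae_iff.1 hμ)
      exact ⟨hx'.2, fun i j hij => hx'.1 hij⟩
    -- a π-system of sets that look like ordered boxes inside the cone
    let S : Set (Set (Fin (n + 1) → ℝ)) := {s | MeasurableSet s ∧
      (s ∩ cone n = ∅ ∨ ∃ a b, OrderedBoxes n a b ∧ s ∩ cone n = box n a b)}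
    refine ext_of_generate_finite S ?_ ?_ ?_ (by simp)
    · refine le_antisymm ?_ (MeasurableSpace.generateFrom_le fun s hs => hs.1)
      rw [BorelSpace.measurable_eq (α := Fin (n + 1) → ℝ)]
      refine MeasurableSpace.generateFrom_le fun U hU => ?_
      have hU : IsOpen U := hU
      rw [← Set.inter_union_sdiff U (cone n)]
      refine MeasurableSet.union ?_ (MeasurableSpace.measurableSet_generateFrom
        ⟨hU.measurableSet.diff (isOpen_cone n).measurableSet, Or.inl (by
          rw [Set.sdiff_inter_self])⟩)
      have hV : IsOpen (U ∩ cone n) := hU.inter (isOpen_cone n)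
      let J : Set (Fin (n + 1) → ℚ × ℚ) := {p |
        {z | ∀ k, z k ∈ Set.Ioc ((p k).1 : ℝ) (p k).2} ⊆ U ∩ cone n ∧
        ∃ a b, OrderedBoxes n a b ∧ {z | ∀ k, z k ∈ Set.Ioc ((p k).1 : ℝ) (p k).2} = box n a b}
      have hUJ : U ∩ cone n = ⋃ p ∈ J, {z | ∀ k, z k ∈ Set.Ioc ((p k).1 : ℝ) (p k).2} := by
        refine Set.Subset.antisymm (fun y hy => ?_) (Set.iUnion₂_subset fun p hp => hp.1)
        obtain ⟨p, h1, h2, h3⟩ := exists_box_of_mem hV Set.inter_subset_right hy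
        exact Set.mem_iUnion₂.2 ⟨p, ⟨h2, h3⟩, h1⟩
      rw [hUJ]
      refine MeasurableSet.biUnion J.to_countable fun p hp => ?_
      obtain ⟨-, a, b, hab, hbox⟩ := hp
      rw [hbox]
      exact MeasurableSpace.measurableSet_generateFrom ⟨measurableSet_box n a b,
        Or.inr ⟨a, b, hab, Set.inter_eq_left.2 hab.box_subset_cone⟩⟩
    · rintro s ⟨hs, hs'⟩ t ⟨ht, ht'⟩ -
      refine ⟨hs.inter ht, ?_⟩
      rw [Set.inter_inter_distrib_right]
      rcases hs' with hs' | ⟨a, b, hab, hs'⟩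
      · exact Or.inl (by rw [hs', Set.empty_inter])
      rcases ht' with ht' | ⟨a', b', hab', ht'⟩
      · exact Or.inl (by rw [ht', Set.inter_empty])
      rw [hs', ht']
      rcases Set.eq_empty_or_nonempty (box n a b ∩ box n a' b') with he | ⟨y, hy, hy'⟩
      · exact Or.inl he
      refine Or.inr ⟨fun k => max (a k) (a' k), fun k => min (b k) (b' k), ⟨?_, ?_, ?_⟩, ?_⟩
      · exact hab.nonneg.trans (le_max_left _ _)
      · intro k hk
        have h1 := hy ⟨k, by omega⟩
        have h2 := hy' ⟨k, by omega⟩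
        exact ((max_lt h1.1 h2.1).trans_le (le_min h1.2 h2.2)).le
      · intro k hk
        exact (min_le_left _ _).trans ((hab.le_succ k hk).trans (le_max_left _ _))
      · ext z
        simp only [box, Set.mem_inter_iff, Set.mem_ofPred_eq, Set.mem_Ioc, max_lt_iff, le_min_iff,
          ← forall_and]
        refine forall_congr' fun k => ?_
        tauto
    · rintro s ⟨hs, hs'⟩
      have hsplit : ∀ {μ : Measure (ℕ → ℝ)}, (∀ᵐ x ∂μ, StrictMono x ∧ 0 < x 0) →
          (μ.map fun x (k : Fin (n + 1)) => x k) s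
            = (μ.map fun x (k : Fin (n + 1)) => x k) (s ∩ cone n) := by
        intro μ hμ
        refine le_antisymm ?_ (measure_mono Set.inter_subset_left)
        calc (μ.map fun x (k : Fin (n + 1)) => x k) s
            ≤ (μ.map fun x (k : Fin (n + 1)) => x k) ((s ∩ cone n) ∪ (cone n)ᶜ) :=
              measure_mono fun y hy => by
                by_cases hyc : y ∈ cone n
                · exact Or.inl ⟨hy, hyc⟩
                · exact Or.inr hyc
          _ ≤ _ := measure_union_le _ _
          _ = _ := by rw [hcone hμ, add_zero]
      rw [hsplit hμ, hsplit hν]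
      rcases hs' with hs' | ⟨a, b, hab, hs'⟩
      · simp [hs']
      · rw [hs', Measure.map_apply hm (measurableSet_box n a b),
          Measure.map_apply hm (measurableSet_box n a b)]
        have : (fun (x : ℕ → ℝ) (k : Fin (n + 1)) => x k) ⁻¹' box n a b
            = {x | ∀ k ≤ n, x k ∈ Set.Ioc (a k) (b k)} := by
          ext x
          simp only [box, Set.mem_preimage, Set.mem_ofPred_eq, Fin.forall_iff, Nat.lt_succ_iff]
        rw [this]
        exact h n a b hab
  -- the law of a sequence is determined by its finite-dimensional marginals
  refine IsProjectiveLimit.unique (P := fun I => ν.map (I.restrict)) (fun I => ?_) fun I => rfl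
  obtain ⟨n, hn⟩ := I.exists_nat_subset_range
  have hfac : (I.restrict : (ℕ → ℝ) → _) = (fun (y : Fin (n + 1) → ℝ) (k : I) =>
      y ⟨k, (Finset.mem_range.1 (hn k.2)).trans (Nat.lt_succ_self n)⟩) ∘
      fun (x : ℕ → ℝ) (k : Fin (n + 1)) => x k := rfl
  change μ.map (I.restrict) = ν.map (I.restrict)
  rw [hfac, ← Measure.map_map (by fun_prop) (by fun_prop),
    ← Measure.map_map (by fun_prop) (by fun_prop), hpre n]

/-- The distances between consecutive points of a homogeneous Poisson process on `(0, ∞)` are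
independent exponential variables. The process is given as the image of a Poisson process `X` under
the change of coordinates `T`, and `x ω` lists its points. -/
theorem IsPoissonProcess.map_gap {Ω : Type*} [MeasurableSpace Ω] {P : Measure Ω}
    [IsProbabilityMeasure P] {ν : Measure ℝ} {X : Ω → Set ℝ} (hX : IsPoissonProcess P ν X) {r : ℝ}
    (hr : 0 < r) {T : ℝ → ℝ} (hTi : Function.Injective T) (hTm : Measurable T)
    (hν : ∀ a b, 0 ≤ a → a ≤ b → ν (T ⁻¹' Set.Ioc a b) = ENNReal.ofReal (r * (b - a)))
    {x : Ω → ℕ → ℝ} (hx : Measurable x) (hmono : ∀ᵐ ω ∂P, StrictMono (x ω))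
    (hpos : ∀ᵐ ω ∂P, 0 < x ω 0)
    (hrange : ∀ᵐ ω ∂P, ∀ s, 0 < s → (s ∈ Set.range (x ω) ↔ s ∈ T '' X ω)) :
    P.map (fun ω => gap (x ω)) = expSeq r := by
  have := isProbabilityMeasure_expSeq hr
  have hmeas : ∀ (n : ℕ) (a b : ℕ → ℝ),
      MeasurableSet {x : ℕ → ℝ | ∀ k ≤ n, x k ∈ Set.Ioc (a k) (b k)} := by
    intro n a b
    simp only [Set.ofPred_forall]
    exact .iInter fun k => .iInter fun _ => measurable_pi_apply k measurableSet_Ioc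
  have h1 : P.map x = (expSeq r).map psum := by
    have := Measure.isProbabilityMeasure_map (μ := P) hx.aemeasurable
    have := Measure.isProbabilityMeasure_map (μ := expSeq r) measurable_psum.aemeasurable
    have hms : MeasurableSet {x : ℕ → ℝ | StrictMono x ∧ 0 < x 0} := by
      have : {x : ℕ → ℝ | StrictMono x ∧ 0 < x 0}
          = (⋂ k, {x | x k < x (k + 1)}) ∩ {x | 0 < x 0} := by
        ext x
        simp only [Set.mem_ofPred_eq, Set.mem_inter_iff, Set.mem_iInter]
        exact and_congr_left fun _ => ⟨fun h k => h (Nat.lt_succ_self k), strictMono_nat_of_lt_succ⟩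
      rw [this]
      exact (MeasurableSet.iInter fun k => measurableSet_lt (by fun_prop) (by fun_prop)).inter
        (measurableSet_lt (by fun_prop) (by fun_prop))
    refine ext_of_orderedBoxes ?_ ?_ fun n a b h => ?_
    · rw [ae_map_iff hx.aemeasurable hms]
      filter_upwards [hmono, hpos] with ω h1 h2 using ⟨h1, h2⟩
    · rw [ae_map_iff measurable_psum.aemeasurable hms]
      filter_upwards [ae_pos_expSeq hr] with e he using ⟨psum_strictMono he, psum_pos he 0⟩
    · rw [Measure.map_apply hx (hmeas n a b), Measure.map_apply measurable_psum (hmeas n a b)]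
      have e1 := hX.measure_box hr hTi hTm hν hmono hpos hrange h
      have e2 := expSeq_box hr n h h.nonneg
      simp only [zero_add, mul_zero, Real.exp_zero, one_mul] at e2
      exact e1.trans e2.symm
  have h2 : P.map (fun ω => gap (x ω)) = (P.map x).map gap :=
    (Measure.map_map measurable_gap hx).symm
  rw [h2, h1, Measure.map_map measurable_gap measurable_psum]
  have : gap ∘ psum = id := funext fun x => gap_psum x
  rw [this, Measure.map_id]

/-! ### The trajectories of the cars -/

/-- The value of position plus time for car `i + k` while it moves from `y i` to `y (i - 1)`. -/
def phase (y : ℤ → ℝ) (d : ℤ → ℕ → ℝ) (i : ℤ) (k : ℕ) : ℝ := y i + dep y d k i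

section

variable {y : ℤ → ℝ} {d : ℤ → ℕ → ℝ}

lemma phase_zero (i : ℤ) : phase y d i 0 = y i + d i 0 := rfl

lemma phase_succ (i : ℤ) (k : ℕ) : phase y d i (k + 1) =
    if phase y d i k < phase y d (i + 1) k then phase y d (i + 1) k else y i + d i (k + 1) := by
  have h : dep y d k i < dep y d k (i + 1) + y (i + 1) - y i
      ↔ phase y d i k < phase y d (i + 1) k := by
    unfold phase
    constructor <;> intro h <;> linarith
  rw [phase, dep]
  simp only [h]
  split_ifs
  · unfold phase; ring
  · rfl

lemma phase_lt_succ (hd : ∀ i, StrictMono (d i)) (k : ℕ) (i : ℤ) :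
    phase y d i k < phase y d i (k + 1) := by
  induction k generalizing i with
  | zero =>
    rw [phase_succ]
    split_ifs with h
    · exact h
    · rw [phase_zero]
      linarith [hd i (Nat.lt_succ_self 0)]
  | succ k ih =>
    rw [phase_succ i (k + 1)]
    split_ifs with h
    · exact h
    · have hk : ¬ phase y d i k < phase y d (i + 1) k := by
        intro hlt
        rw [phase_succ i k, if_pos hlt] at h
        exact h (ih (i + 1))
      rw [phase_succ i k, if_neg hk]
      linarith [hd i (Nat.lt_succ_self (k + 1))]

lemma phase_strictMono (hd : ∀ i, StrictMono (d i)) (i : ℤ) : StrictMono (phase y d i) :=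
  strictMono_nat_of_lt_succ fun k => phase_lt_succ hd k i

/-- A car has a larger phase after a site than before the site. -/
lemma phase_le_succ (hd : ∀ i, StrictMono (d i)) (i : ℤ) (k : ℕ) :
    phase y d (i + 1) k ≤ phase y d i (k + 1) := by
  rw [phase_succ]
  split_ifs with h
  · exact le_rfl
  · have := phase_lt_succ (y := y) hd k i
    rw [phase_succ, if_neg h] at this
    linarith

lemma lt_phase (hd : ∀ i, StrictMono (d i)) (hpos : ∀ i, 0 < d i 0) (i : ℤ) (k : ℕ) :
    y (i + k) < phase y d i k := by
  induction k generalizing i with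
  | zero => rw [phase_zero]; simp [hpos i]
  | succ k ih =>
    refine lt_of_lt_of_le ?_ (phase_le_succ hd i k)
    have := ih (i + 1)
    rwa [show i + ((k + 1 : ℕ) : ℤ) = i + 1 + k by push_cast; ring]

/-- As soon as a car has passed a site without stopping, all later cars do the same. -/
lemma phase_succ_of_lt (hd : ∀ i, StrictMono (d i)) {i : ℤ} {k₀ : ℕ}
    (h : phase y d i k₀ < phase y d (i + 1) k₀) {k : ℕ} (hk : k₀ ≤ k) :
    phase y d i (k + 1) = phase y d (i + 1) k := by
  have hlt : phase y d i k < phase y d (i + 1) k := by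
    induction k, hk using Nat.le_induction with
    | base => exact h
    | succ k _ ih =>
      rw [phase_succ, if_pos ih]
      exact phase_lt_succ hd k (i + 1)
  rw [phase_succ, if_pos hlt]

lemma mem_movingCars_iff {t x : ℝ} :
    x ∈ movingCars y d t ↔ ∃ i k, phase y d i k = x + t ∧ y (i - 1) < x ∧ x ≤ y i := by
  constructor
  · rintro ⟨j, h⟩
    cases h with
    | moving i k hj h₁ h₂ =>
      refine ⟨i, k, by unfold phase; ring, ?_, by linarith⟩
      rw [arr, sub_add_cancel] at h₂
      linarith
  · rintro ⟨i, k, h, h1, h2⟩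
    unfold phase at h
    have e : x = y i - t + dep y d k i := by linarith
    refine ⟨i + k, e ▸ CarState.moving i k rfl (by linarith) ?_⟩
    rw [arr, sub_add_cancel]
    linarith

lemma mem_jams_iff {t x : ℝ} :
    x ∈ jams y d t ↔ ∃ i k, x = y i ∧ arr y d k i ≤ t ∧ t < dep y d k i := by
  constructor
  · rintro ⟨j, h⟩
    cases h with
    | stopped i k hj h₁ h₂ => exact ⟨i, k, rfl, h₁, h₂⟩
  · rintro ⟨i, k, rfl, h1, h2⟩
    exact ⟨i + k, CarState.stopped i k rfl h1 h2⟩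

/-- The sites form a two-sided unbounded increasing sequence. -/
structure IsSites (y : ℤ → ℝ) : Prop where
  strictMono : StrictMono y
  exists_gt : ∀ a, ∃ i, a < y i
  exists_lt : ∀ a, ∃ i, y i < a

lemma IsSites.exists_mem_Ioc (hy : IsSites y) (x : ℝ) : ∃ i, y (i - 1) < x ∧ x ≤ y i := by
  obtain ⟨i₁, h1⟩ := hy.exists_lt x
  obtain ⟨i₂, h2⟩ := hy.exists_gt x
  obtain ⟨i, hi, hle⟩ := Int.exists_least_of_bdd (P := fun i => x ≤ y i)
    ⟨i₁, fun i hi => (hy.strictMono.lt_iff_lt.1 (h1.trans_le hi)).le⟩ ⟨i₂, h2.le⟩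
  refine ⟨i, ?_, hi⟩
  by_contra h
  push Not at h
  have := hle _ h
  omega

lemma isLocFinite_movingCars (hy : IsSites y) (hd : ∀ i, StrictMono (d i))
    (hpos : ∀ i, 0 < d i 0) (t : ℝ) : IsLocFinite (movingCars y d t) := by
  intro K hK
  obtain ⟨a, ha⟩ := hK.bddBelow
  obtain ⟨b, hb⟩ := hK.bddAbove
  obtain ⟨i₁, h1⟩ := hy.exists_lt a
  obtain ⟨i₂, h2⟩ := hy.exists_gt b
  obtain ⟨i₃, h3⟩ := hy.exists_gt (b + t)
  refine (((Set.finite_Icc i₁ i₂).prod (Set.finite_Iic (i₃ - i₁).toNat)).image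
    fun p : ℤ × ℕ => phase y d p.1 p.2 - t).subset ?_
  rintro x ⟨hx, hxK⟩
  obtain ⟨i, k, h, hx1, hx2⟩ := mem_movingCars_iff.1 hx
  have hi1 : i₁ < i := hy.strictMono.lt_iff_lt.1 (h1.trans_le ((ha hxK).trans hx2))
  have hi2 : i - 1 < i₂ := hy.strictMono.lt_iff_lt.1 ((hx1.trans_le (hb hxK)).trans h2)
  have hk : i + k < i₃ := by
    refine hy.strictMono.lt_iff_lt.1 ((lt_phase hd hpos i k).trans (lt_of_le_of_lt ?_ h3))
    rw [h]
    linarith [hb hxK]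
  exact ⟨(i, k), ⟨⟨by omega, by omega⟩, by simp only [Set.mem_Iic]; omega⟩, by simp [h]⟩

/-- If at each site some car passes without stopping, then each compact set is eventually free of
traffic jams. -/
lemma eventually_jams_inter_eq_empty (hy : IsSites y) (hd : ∀ i, StrictMono (d i))
    (h : ∀ i, ∃ k, phase y d i k < phase y d (i + 1) k) {K : Set ℝ} (hK : IsCompact K) :
    ∀ᶠ t in atTop, jams y d t ∩ K = ∅ := by
  obtain ⟨a, ha⟩ := hK.bddBelow
  obtain ⟨b, hb⟩ := hK.bddAbove
  obtain ⟨i₁, h1⟩ := hy.exists_lt a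
  obtain ⟨i₂, h2⟩ := hy.exists_gt b
  choose κ hκ using h
  have hev : ∀ᶠ t in atTop, ∀ i ∈ Set.Icc i₁ i₂, ∀ k ∈ Set.Iic (κ i), dep y d k i ≤ t := by
    rw [eventually_all_finite (Set.finite_Icc i₁ i₂)]
    intro i _
    rw [eventually_all_finite (Set.finite_Iic _)]
    exact fun k _ => eventually_ge_atTop _
  filter_upwards [hev] with t ht
  refine Set.eq_empty_iff_forall_notMem.2 ?_
  rintro x ⟨hx, hxK⟩
  obtain ⟨i, k, rfl, hk1, hk2⟩ := mem_jams_iff.1 hx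
  have hi1 : i₁ < i := hy.strictMono.lt_iff_lt.1 (h1.trans_le (ha hxK))
  have hi2 : i < i₂ := hy.strictMono.lt_iff_lt.1 ((hb hxK).trans_lt h2)
  -- either the car is among the first ones, which have left the site by now, or it does not stop at
  -- this site
  rcases le_or_gt k (κ i) with hk | hk
  · exact absurd (ht i ⟨hi1.le, hi2.le⟩ k hk) (not_le.2 hk2)
  · obtain ⟨k, rfl⟩ : ∃ m, k = m + 1 := ⟨k - 1, by omega⟩
    have := phase_succ_of_lt hd (hκ i) (k := k) (by omega)
    unfold phase at this
    rw [arr] at hk1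
    linarith

/-- Far to the right all sites have the same set of phases: a site that has been cleared only
relabels the phases at the next site. -/
lemma eventually_mem_range_phase_iff (hd : ∀ i, StrictMono (d i))
    (h : ∀ i, ∃ k, phase y d i k < phase y d (i + 1) k) (i j : ℤ) :
    ∀ᶠ x in atTop, (x ∈ Set.range (phase y d i) ↔ x ∈ Set.range (phase y d j)) := by
  have hstep : ∀ i, ∀ᶠ x in atTop,
      (x ∈ Set.range (phase y d i) ↔ x ∈ Set.range (phase y d (i + 1))) := by
    intro i
    obtain ⟨k₀, hk₀⟩ := h i
    filter_upwards [eventually_gt_atTop (phase y d i k₀),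
      eventually_gt_atTop (phase y d (i + 1) k₀)] with x hx1 hx2
    constructor
    · rintro ⟨k, rfl⟩
      have hk : k₀ < k := (phase_strictMono hd i).lt_iff_lt.1 hx1
      obtain ⟨k, rfl⟩ : ∃ m, k = m + 1 := ⟨k - 1, by omega⟩
      exact ⟨k, (phase_succ_of_lt hd hk₀ (by omega)).symm⟩
    · rintro ⟨k, rfl⟩
      have hk : k₀ < k := (phase_strictMono hd (i + 1)).lt_iff_lt.1 hx2
      exact ⟨k + 1, phase_succ_of_lt hd hk₀ (by omega)⟩
  have hnat : ∀ (n : ℕ) i, ∀ᶠ x in atTop,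
      (x ∈ Set.range (phase y d i) ↔ x ∈ Set.range (phase y d (i + n))) := by
    intro n
    induction n with
    | zero => intro i; simp
    | succ n ih =>
      intro i
      filter_upwards [ih i, hstep (i + n)] with x h1 h2
      rw [h1, h2, Nat.cast_succ, add_assoc]
  rcases le_total i j with hij | hij
  · obtain ⟨n, rfl⟩ := Int.le.dest hij
    exact hnat n i
  · obtain ⟨n, rfl⟩ := Int.le.dest hij
    exact (hnat n j).mono fun x => Iff.symm

/-- In a compact window the configuration of moving cars is eventually the moving frame view of the
cars which pass a fixed site. -/
lemma eventually_mem_movingCars_iff (hy : IsSites y) (hd : ∀ i, StrictMono (d i))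
    (h : ∀ i, ∃ k, phase y d i k < phase y d (i + 1) k) (j : ℤ) (a b : ℝ) :
    ∀ᶠ t in atTop, ∀ x ∈ Set.Icc a b,
      (x ∈ movingCars y d t ↔ x + t ∈ Set.range (phase y d j)) := by
  obtain ⟨i₁, h1⟩ := hy.exists_lt a
  obtain ⟨i₂, h2⟩ := hy.exists_gt b
  have hev : ∀ᶠ s in atTop, ∀ i ∈ Set.Icc i₁ i₂, ∀ x, s ≤ x →
      (x ∈ Set.range (phase y d i) ↔ x ∈ Set.range (phase y d j)) := by
    rw [eventually_all_finite (Set.finite_Icc i₁ i₂)]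
    exact fun i _ => eventually_forall_ge_atTop.2 (eventually_mem_range_phase_iff hd h i j)
  -- the phases of the cars in the window are at least `a + t`
  have hev' := (tendsto_atTop_add_const_left atTop a tendsto_id).eventually hev
  filter_upwards [hev'] with t ht x hx
  have hbound : ∀ i, y (i - 1) < x → x ≤ y i → i ∈ Set.Icc i₁ i₂ := by
    intro i hx1 hx2
    have hi1 : i₁ < i := hy.strictMono.lt_iff_lt.1 (h1.trans_le (hx.1.trans hx2))
    have hi2 : i - 1 < i₂ := hy.strictMono.lt_iff_lt.1 ((hx1.trans_le hx.2).trans h2)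
    exact ⟨hi1.le, by omega⟩
  have hxt : a + id t ≤ x + t := by simpa using hx.1
  rw [mem_movingCars_iff]
  constructor
  · rintro ⟨i, k, hk, hx1, hx2⟩
    exact (ht i (hbound i hx1 hx2) _ hxt).1 ⟨k, hk⟩
  · intro hj
    obtain ⟨i, hx1, hx2⟩ := hy.exists_mem_Ioc x
    obtain ⟨k, hk⟩ := (ht i (hbound i hx1 hx2) _ hxt).2 hj
    exact ⟨i, k, hk, hx1, hx2⟩

/-! ### The effective service times at a site -/

/-- In terms of phases the site `y i` is a single server queue: its customer `k` is car `i + k`,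
which arrives at time `y (i + k)`, the phase of a car that never stopped, and leaves at its phase.
`service y d i k` is the service time of this customer, the time between the departure and
the larger one of the arrival time and the departure time of the previous customer. -/
def service (y : ℤ → ℝ) (d : ℤ → ℕ → ℝ) (i : ℤ) : ℕ → ℝ
  | 0 => d i 0
  | k + 1 => phase y d i (k + 1) - max (phase y d i k) (y (i + (k + 1 : ℕ)))

lemma service_pos (hd : ∀ i, StrictMono (d i)) (hpos : ∀ i, 0 < d i 0) (i : ℤ) (k : ℕ) :
    0 < service y d i k := by
  cases k with
  | zero => exact hpos i
  | succ k => exact sub_pos.2 (max_lt (phase_lt_succ hd k i) (lt_phase hd hpos i (k + 1)))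

/-- The phases at a site are the departure times of a queue with arrival times `y (i + k)`. -/
lemma lindley_service {c : ℝ} {i : ℤ} (hc : c ≤ y i) (k : ℕ) :
    lindley c (fun k : ℕ => y (i + k)) (service y d i) k = phase y d i k := by
  induction k with
  | zero => simp [lindley, service, phase_zero, hc]
  | succ k ih => rw [lindley, ih, service]; ring

/-- The state of the machine that computes the service times at `y i` from those at `y (i + 1)`: the
last phases at `y i` and at `y (i + 1)`, and the initial positions of the cars to come. -/
abbrev SiteState : Type := ℝ × ℝ × (ℕ → ℝ)

/-- The service time of a car at `y i`, computed from the state `q.1`, its service time `q.2.1` at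
`y (i + 1)` and the next distance `q.2.2` between events of the clock at `y i`. The service at
`y (i + 1)` begins first, by a time that is cut off at `0` to be nonnegative in every state. If
the service there lasts longer than this time, then the car passes `y i` without stopping, and its
service time at `y i` is the rest; otherwise it stops at `y i` until the next event of the clock. -/
def siteOut (q : SiteState × (ℝ × ℝ)) : ℝ :=
  if max 0 (max q.1.1 (q.1.2.2 0) - max q.1.2.1 (q.1.2.2 0)) < q.2.1
  then q.2.1 - max 0 (max q.1.1 (q.1.2.2 0) - max q.1.2.1 (q.1.2.2 0)) else q.2.2

/-- The state after a car has passed. -/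
def siteNext (q : SiteState × (ℝ × ℝ)) : SiteState :=
  (max q.1.1 (q.1.2.2 0) + siteOut q, max q.1.2.1 (q.1.2.2 0) + q.2.1, stail q.1.2.2)

@[fun_prop] lemma measurable_siteOut : Measurable siteOut := by
  unfold siteOut
  exact Measurable.ite (measurableSet_lt (by fun_prop) (by fun_prop)) (by fun_prop) (by fun_prop)

@[fun_prop] lemma measurable_siteNext : Measurable siteNext := by
  unfold siteNext
  fun_prop

/-- The phase at the next site of the car ahead; before the first car this is the position of the
next site. -/
def prevPhase (y : ℤ → ℝ) (d : ℤ → ℕ → ℝ) (i : ℤ) : ℕ → ℝ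
  | 0 => y (i + 1)
  | k + 1 => phase y d (i + 1) k

lemma prevPhase_add_service (i : ℤ) (k : ℕ) :
    max (prevPhase y d i k) (y (i + (k + 1 : ℕ))) + service y d (i + 1) k
      = phase y d (i + 1) k := by
  cases k with
  | zero => simp [prevPhase, service, phase_zero]
  | succ k =>
    rw [prevPhase, service, show i + 1 + ((k + 1 : ℕ) : ℤ) = i + ((k + 1 + 1 : ℕ) : ℤ) by
      push_cast; ring]
    ring

lemma service_succ (hd : ∀ i, StrictMono (d i)) (hpos : ∀ i, 0 < d i 0)
    (i : ℤ) (k : ℕ) :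
    service y d i (k + 1) = siteOut ((phase y d i k, prevPhase y d i k,
      fun l => y (i + (k + 1 + l : ℕ))), (service y d (i + 1) k, gap (d i) (k + 1))) := by
  set Y := y (i + (k + 1 : ℕ)) with hY
  have hg : max (prevPhase y d i k) Y ≤ max (phase y d i k) Y := by
    cases k with
    | zero =>
      have : prevPhase y d i 0 = Y := by simp [prevPhase, hY]
      rw [this, max_self]
      exact le_max_right _ _
    | succ k => exact max_le_max (phase_le_succ hd i k) le_rfl
  have hV := prevPhase_add_service (y := y) (d := d) i k
  have hR := service_pos (y := y) hd hpos (i + 1) k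
  have hYlt := lt_phase (y := y) hd hpos (i + 1) k
  rw [show i + 1 + (k : ℤ) = i + ((k + 1 : ℕ) : ℤ) by push_cast; ring] at hYlt
  rw [siteOut]
  simp only [add_zero]
  rw [← hY] at hV hYlt ⊢
  rw [max_eq_right (a := (0 : ℝ)) (sub_nonneg.2 hg), service, ← hY, phase_succ]
  set U := phase y d i k with hU
  set V := prevPhase y d i k
  set R := service y d (i + 1) k
  rw [← hV]
  -- `U` and `V + R` are the phases that decide whether car `i + k + 1` stops at `y i`
  by_cases hlt : max U Y - max V Y < R
  · have h1 : U < max V Y + R := by linarith [le_max_left U Y]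
    rw [if_pos h1, if_pos hlt]
    ring
  · have hYU : Y ≤ U := by
      by_contra hc
      push Not at hc
      rw [max_eq_right hc.le] at hlt hg
      linarith
    rw [max_eq_left hYU] at hlt ⊢
    have h1 : ¬ U < max V Y + R := by linarith
    rw [if_neg h1, if_neg hlt]
    have h2 : U = y i + d i k := by
      -- no car has passed this site without stopping so far
      cases k with
      | zero => exact phase_zero i
      | succ k =>
        rw [hU, phase_succ, if_neg]
        intro h3
        have h4 := phase_succ_of_lt hd h3 le_rfl
        have h5 := phase_lt_succ (y := y) hd k (i + 1)
        rw [← h4, ← hV, ← hU] at h5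
        exact h1 h5
    rw [h2, gap]
    ring

lemma run_site (hd : ∀ i, StrictMono (d i)) (hpos : ∀ i, 0 < d i 0)
    (i : ℤ) (k m : ℕ) :
    run siteOut siteNext (phase y d i k, prevPhase y d i k, fun l => y (i + (k + 1 + l : ℕ)))
      (fun n => service y d (i + 1) (k + n)) (fun n => gap (d i) (k + 1 + n)) m
      = service y d i (k + 1 + m) := by
  induction m generalizing k with
  | zero => exact (service_succ hd hpos i k).symm
  | succ m ih =>
    rw [run]
    have h := ih (k + 1)
    have e1 : siteNext ((phase y d i k, prevPhase y d i k, fun l => y (i + (k + 1 + l : ℕ))),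
        (service y d (i + 1) (k + 0), gap (d i) (k + 1 + 0)))
        = (phase y d i (k + 1), prevPhase y d i (k + 1),
          fun l => y (i + (k + 1 + 1 + l : ℕ))) := by
      rw [siteNext, add_zero, add_zero, ← service_succ hd hpos i k]
      refine Prod.ext ?_ (Prod.ext ?_ ?_)
      · simp only [service, add_zero]
        ring
      · exact prevPhase_add_service i k
      · funext l
        simp only [stail_apply]
        congr 3
        omega
    rw [e1, show k + 1 + (m + 1) = k + 1 + 1 + m by omega, ← h]
    congr 1
    · funext n; simp only [stail_apply]; congr 1; omega
    · funext n; simp only [stail_apply]; congr 1; omega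

/-- The service times at a site are the output of a machine that reads the service times at the
next site and the clock at this site. -/
lemma service_eq_run (hd : ∀ i, StrictMono (d i)) (hpos : ∀ i, 0 < d i 0)
    (i : ℤ) :
    service y d i = scons (d i 0) (run siteOut siteNext
      (y i + d i 0, y (i + 1), fun l => y (i + 1 + l)) (service y d (i + 1))
      (stail (gap (d i)))) := by
  funext k
  cases k with
  | zero => rfl
  | succ m =>
    have h := run_site (y := y) hd hpos i 0 m
    simp only [zero_add] at h
    rw [scons_succ, add_comm m 1, ← h]
    congr 1
    · refine Prod.ext rfl (Prod.ext rfl (funext fun l => ?_))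
      simp only [Nat.cast_add, Nat.cast_one, add_assoc]
    · funext n; simp only [stail_apply]; congr 1; omega

/-- If the sum of the service times at the next site exceeds the time on the clock at the site, then
the cars do not stop at the site any more. -/
lemma exists_phase_lt (hy : StrictMono y) {i : ℤ} (h : ∃ k, d i k < psum (service y d (i + 1)) k) :
    ∃ k, phase y d i k < phase y d (i + 1) k := by
  by_contra hne
  push Not at hne
  obtain ⟨k, hk⟩ := h
  have h1 : phase y d i k = y i + d i k := by
    cases k with
    | zero => rfl
    | succ k => rw [phase_succ, if_neg (not_lt.2 (hne k))]
  -- the service times sum up to a lower bound for the phases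
  have h2 : ∀ k, y (i + 1) + psum (service y d (i + 1)) k ≤ phase y d (i + 1) k := by
    intro k
    induction k with
    | zero => rw [psum_zero]; exact le_rfl
    | succ k ih =>
      rw [psum_succ, service]
      linarith [le_max_left (phase y d (i + 1) k) (y (i + 1 + (k + 1 : ℕ)))]
  have h3 := hne k
  have h4 := h2 k
  have h5 : y i < y (i + 1) := hy (by omega)
  linarith

end

/-! ### The space of point configurations -/

/-- The integral of `f` with respect to the counting measure of a point configuration. -/
def pairing (f : C_c(ℝ, ℝ)) (S : Config) : ℝ := ∑ᶠ x ∈ S.1, f x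

lemma continuous_pairing (f : C_c(ℝ, ℝ)) : Continuous (pairing f) :=
  (continuous_apply f).comp (continuous_induced_dom (f := fun (S : Config) f => pairing f S))

@[fun_prop] lemma measurable_pairing (f : C_c(ℝ, ℝ)) : Measurable (pairing f) :=
  (continuous_pairing f).measurable

instance : Nonempty Config := ⟨⟨∅, fun K _ => by simp⟩⟩

lemma pairing_eq_sum {f : C_c(ℝ, ℝ)} {K : Set ℝ} (hK : IsCompact K) (hf : ∀ x ∉ K, f x = 0)
    (S : Config) : pairing f S = ∑ x ∈ (S.2 K hK).toFinset, f x := by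
  refine finsum_mem_eq_sum_of_inter_support_eq _ ?_
  ext x
  simp only [Set.mem_inter_iff, Function.mem_support, Set.Finite.coe_toFinset]
  constructor
  · rintro ⟨h1, h2⟩
    exact ⟨⟨h1, by_contra fun h => h2 (hf x h)⟩, h2⟩
  · rintro ⟨⟨h1, -⟩, h2⟩
    exact ⟨h1, h2⟩

lemma abs_pairing_sub_le {f g φ : C_c(ℝ, ℝ)} {K : Set ℝ} (hK : IsCompact K)
    (hf : ∀ x ∉ K, f x = 0) (hg : ∀ x ∉ K, g x = 0) (hφ : ∀ x ∉ K, φ x = 0) {δ : ℝ}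
    (h : ∀ x, |f x - g x| ≤ δ * φ x) (S : Config) :
    |pairing f S - pairing g S| ≤ δ * pairing φ S := by
  rw [pairing_eq_sum hK hf, pairing_eq_sum hK hg, pairing_eq_sum hK hφ, ← Finset.sum_sub_distrib,
    Finset.mul_sum]
  exact (Finset.abs_sum_le_sum_abs _ _).trans (Finset.sum_le_sum fun x _ => h x)

/-- A trapezoidal function: it is `1` on `[a, b]` and vanishes outside `[a - 1 / m, b + 1 / m]`. -/
def bump (a b m : ℝ) (hm : 0 < m) : C_c(ℝ, ℝ) where
  toFun x := max 0 (1 - m * max 0 (max (a - x) (x - b)))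
  continuous_toFun := by fun_prop
  hasCompactSupport' := by
    refine HasCompactSupport.intro (isCompact_Icc (a := a - 1 / m) (b := b + 1 / m)) fun x hx => ?_
    refine max_eq_left ?_
    have h1 : 1 / m ≤ max 0 (max (a - x) (x - b)) := by
      rw [Set.mem_Icc, not_and_or, not_le, not_le] at hx
      refine le_max_of_le_right ?_
      rcases hx with hx | hx
      · exact le_max_of_le_left (by linarith)
      · exact le_max_of_le_right (by linarith)
    have h2 := mul_le_mul_of_nonneg_left h1 hm.le
    rw [mul_one_div_cancel hm.ne'] at h2
    linarith

lemma bump_apply (a b m : ℝ) (hm : 0 < m) (x : ℝ) :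
    bump a b m hm x = max 0 (1 - m * max 0 (max (a - x) (x - b))) := rfl

lemma bump_eq_one {a b m : ℝ} (hm : 0 < m) {x : ℝ} (hx : x ∈ Set.Icc a b) :
    bump a b m hm x = 1 := by
  rw [bump_apply, max_eq_left (a := (0 : ℝ)) (max_le (by linarith [hx.1]) (by linarith [hx.2]))]
  simp

lemma bump_eq_zero {a b m : ℝ} (hm : 0 < m) {x : ℝ} (hx : x ∉ Set.Ioo (a - 1 / m) (b + 1 / m)) :
    bump a b m hm x = 0 := by
  refine max_eq_left ?_
  have h1 : 1 / m ≤ max 0 (max (a - x) (x - b)) := by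
    rw [Set.mem_Ioo, not_and_or, not_lt, not_lt] at hx
    refine le_max_of_le_right ?_
    rcases hx with hx | hx
    · exact le_max_of_le_left (by linarith)
    · exact le_max_of_le_right (by linarith)
  have h2 := mul_le_mul_of_nonneg_left h1 hm.le
  rw [mul_one_div_cancel hm.ne'] at h2
  linarith

lemma bump_nonneg {a b m : ℝ} (hm : 0 < m) (x : ℝ) : 0 ≤ bump a b m hm x := le_max_left _ _

/-- The functions in `C_c(ℝ, ℝ)` with support in a compact set, approximated uniformly by countably
many of them. -/
lemma exists_countable_approx (n : ℕ) : ∃ D : Set C_c(ℝ, ℝ), D.Countable ∧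
    (∀ g ∈ D, ∀ x ∉ Set.Icc (-n : ℝ) n, g x = 0) ∧
    ∀ f : C_c(ℝ, ℝ), (∀ x ∉ Set.Icc (-n : ℝ) n, f x = 0) → ∀ δ > 0,
      ∃ g ∈ D, ∀ x ∈ Set.Icc (-n : ℝ) n, |f x - g x| < δ := by
  let A : Set C(ℝ, ℝ) := {g | ∀ x ∉ Set.Icc (-n : ℝ) n, g x = 0}
  obtain ⟨s, hs, hd⟩ := TopologicalSpace.exists_countable_dense A
  let ι : A → C_c(ℝ, ℝ) := fun g =>
    ⟨g.1, HasCompactSupport.intro isCompact_Icc fun x hx => g.2 x hx⟩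
  refine ⟨ι '' s, hs.image ι, ?_, fun f hf δ hδ => ?_⟩
  · rintro _ ⟨g, -, rfl⟩ x hx
    exact g.2 x hx
  · have hcont : Continuous fun g : A => f.toContinuousMap - g.1 := by fun_prop
    have hopen : IsOpen {g : A | Set.MapsTo (f.toContinuousMap - g.1) (Set.Icc (-n : ℝ) n)
        (Set.Ioo (-δ) δ)} :=
      (ContinuousMap.isOpen_setOfPred_mapsTo isCompact_Icc isOpen_Ioo).preimage hcont
    obtain ⟨g, hgs, hg⟩ := hd.exists_mem_open hopen ⟨⟨f.toContinuousMap, hf⟩, fun x _ => by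
      simp [hδ]⟩
    exact ⟨ι g, ⟨g, hgs, rfl⟩, fun x hx => abs_lt.2 (hg hx)⟩

/-- The vague topology is determined by countably many test functions. -/
theorem exists_countable_isInducing : ∃ D : Set C_c(ℝ, ℝ), D.Countable ∧
    IsInducing fun (S : Config) (f : D) => pairing f S := by
  choose D hDc hDs hDa using exists_countable_approx
  let φ : ℕ → C_c(ℝ, ℝ) := fun n => bump (-n) n 1 one_pos
  refine ⟨(⋃ n, D n) ∪ Set.range φ, (Set.countable_iUnion hDc).union (Set.countable_range φ), ?_⟩
  set D' : Set C_c(ℝ, ℝ) := (⋃ n, D n) ∪ Set.range φ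
  refine isInducing_iff_nhds.2 fun S => le_antisymm ?_ ?_
  · exact (continuous_pi fun f : D' => continuous_pairing f.1).continuousAt.tendsto.le_comap
  rw [nhds_induced, ← map_le_iff_le_comap]
  refine tendsto_pi_nhds.2 fun f => ?_
  change Tendsto (pairing f) (comap _ _) (𝓝 (pairing f S))
  have hev : ∀ g ∈ D', Tendsto (pairing g)
      (comap (fun (S : Config) (f : D') => pairing f S) (𝓝 fun f : D' => pairing f S))
      (𝓝 (pairing g S)) := fun g hg =>
    (((continuous_apply (⟨g, hg⟩ : D')).tendsto fun f : D' => pairing f S).comp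
      tendsto_comap :)
  obtain ⟨R, hR⟩ := f.hasCompactSupport'.isBounded.subset_closedBall 0
  obtain ⟨n, hn⟩ := exists_nat_ge R
  have hf : ∀ x ∉ Set.Icc (-n : ℝ) n, f x = 0 := by
    intro x hx
    refine image_eq_zero_of_notMem_tsupport fun h => hx ?_
    have := hR h
    rw [Metric.mem_closedBall, dist_zero_right, Real.norm_eq_abs, abs_le] at this
    exact ⟨by linarith [this.1], by linarith [this.2]⟩
  have hφ0 : 0 ≤ pairing (φ n) S :=
    finsum_nonneg fun x => finsum_nonneg fun _ => bump_nonneg one_pos x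
  set C := pairing (φ n) S + 1
  have hC : 0 < C := by positivity
  rw [Metric.tendsto_nhds]
  intro ε hε
  -- replacing `f` by `g` costs at most `ε / (3 * C)` times the number of points near the window,
  -- which is controlled by `φ n`
  obtain ⟨g, hgD, hg⟩ := hDa n f hf (ε / (3 * C)) (by positivity)
  have hgD' : g ∈ D' := Or.inl (Set.mem_iUnion.2 ⟨n, hgD⟩)
  have hφD' : φ n ∈ D' := Or.inr ⟨n, rfl⟩
  have hdiff : ∀ T, |pairing f T - pairing g T| ≤ ε / (3 * C) * pairing (φ n) T := by
    refine abs_pairing_sub_le (isCompact_Icc (a := -(n : ℝ) - 1) (b := n + 1)) ?_ ?_ ?_ ?_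
    · exact fun x hx => hf x fun h => hx ⟨by linarith [h.1], by linarith [h.2]⟩
    · exact fun x hx => hDs n g hgD x fun h => hx ⟨by linarith [h.1], by linarith [h.2]⟩
    · exact fun x hx => bump_eq_zero one_pos fun h => hx
        ⟨by linarith [h.1], by linarith [h.2]⟩
    · intro x
      by_cases hx : x ∈ Set.Icc (-n : ℝ) n
      · rw [bump_eq_one one_pos hx, mul_one]
        exact (hg x hx).le
      · rw [hf x hx, hDs n g hgD x hx, sub_zero, abs_zero]
        exact mul_nonneg (by positivity) (bump_nonneg one_pos x)
  filter_upwards [(hev g hgD').eventually (Metric.ball_mem_nhds _ (show 0 < ε / 3 by positivity)),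
    (hev _ hφD').eventually (gt_mem_nhds (show pairing (φ n) S < C by simp [C]))] with T h1 h2
  change |pairing g T - pairing g S| < ε / 3 at h1
  rw [Real.dist_eq]
  have hb : ∀ T, pairing (φ n) T < C → |pairing f T - pairing g T| < ε / 3 := by
    intro T hT
    refine (hdiff T).trans_lt ?_
    calc ε / (3 * C) * pairing (φ n) T < ε / (3 * C) * C :=
          mul_lt_mul_of_pos_left hT (by positivity)
      _ = ε / 3 := by field_simp
  have h3 := hb T h2
  have h4 := hb S (by simp [C])
  rw [abs_lt] at *
  constructor <;> linarith [h1.1, h1.2, h3.1, h3.2, h4.1, h4.2]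

instance : SecondCountableTopology Config := by
  obtain ⟨D, hD, hi⟩ := exists_countable_isInducing
  have := hD.to_subtype
  exact hi.secondCountableTopology

/-- A function into the space of configurations is almost everywhere measurable if its pairings with
all test functions are. -/
lemma aemeasurable_config {Ω : Type*} [MeasurableSpace Ω] {μ : Measure Ω} {X : Ω → Config}
    (h : ∀ f, AEMeasurable (fun ω => pairing f (X ω)) μ) : AEMeasurable X μ := by
  obtain ⟨D, hD, hi⟩ := exists_countable_isInducing
  have := hD.to_subtype
  set J : Config → (D → ℝ) := fun S f => pairing f S
  have hJ : AEMeasurable (fun ω => J (X ω)) μ := aemeasurable_pi_lambda _ fun f => h f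
  have hcomap : borel Config = MeasurableSpace.comap J inferInstance := by
    calc borel Config = @borel Config (TopologicalSpace.induced J inferInstance) := by
          rw [← hi.eq_induced]
      _ = MeasurableSpace.comap J (borel (D → ℝ)) := borel_comap
      _ = _ := by rw [← BorelSpace.measurable_eq (α := D → ℝ)]
  -- redefining `X` on a null set makes all the pairings in `D` measurable
  obtain ⟨N, hN, hNm, hN0⟩ := exists_measurable_superset_of_null (ae_iff.1 hJ.ae_eq_mk)
  classical
  let S₀ : Config := Classical.arbitrary _
  refine ⟨N.piecewise (fun _ => S₀) X, ?_, ?_⟩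
  · have hm : Measurable (N.piecewise (fun _ => J S₀) (hJ.mk _)) :=
      Measurable.piecewise hNm measurable_const hJ.measurable_mk
    have he : J ∘ N.piecewise (fun _ => S₀) X = N.piecewise (fun _ => J S₀) (hJ.mk _) := by
      funext ω
      by_cases hω : ω ∈ N
      · simp [hω]
      · have : J (X ω) = hJ.mk _ ω := by_contra fun h => hω (hN h)
        simp [hω, this]
    rw [← he] at hm
    intro A hA
    change MeasurableSet[borel Config] A at hA
    rw [hcomap] at hA
    obtain ⟨B, hB, rfl⟩ := hA
    exact hm hB
  · filter_upwards [measure_eq_zero_iff_ae_notMem.1 hN0] with ω hω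
    simp [hω]

lemma toConfig_coe {S : Set ℝ} (h : IsLocFinite S) : (toConfig S).1 = S := by
  unfold toConfig
  exact congrArg Subtype.val (dif_pos h)

/-- A random configuration which consists of countably many random points, each of which is present
on some event, is measurable. -/
lemma aemeasurable_toConfig {Ω ι : Type*} [MeasurableSpace Ω] [Countable ι] {μ : Measure Ω}
    {x : ι → Ω → ℝ} {A : ι → Set Ω} (hx : ∀ i, Measurable (x i)) (hA : ∀ i, MeasurableSet (A i))
    {S : Ω → Set ℝ} (hS : ∀ᵐ ω ∂μ, S ω = {s | ∃ i, ω ∈ A i ∧ x i ω = s})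
    (hfin : ∀ᵐ ω ∂μ, IsLocFinite (S ω))
    (hinj : ∀ᵐ ω ∂μ, ∀ i j, ω ∈ A i → ω ∈ A j → x i ω = x j ω → i = j) :
    AEMeasurable (fun ω => toConfig (S ω)) μ := by
  refine aemeasurable_config fun f => ?_
  refine aemeasurable_of_tendsto_metrizable_ae (atTop : Filter (Finset ι))
    (f := fun s ω => ∑ i ∈ s, (A i).indicator (fun ω => f (x i ω)) ω) (fun s => ?_) ?_
  · refine (Finset.measurable_sum s fun i _ => Measurable.indicator ?_ (hA i)).aemeasurable
    exact f.continuous.measurable.comp (hx i)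
  · filter_upwards [hS, hfin, hinj] with ω h1 h2 h3
    have himg : S ω = (fun i => x i ω) '' {i | ω ∈ A i} := by
      rw [h1]; ext s; simp
    have hinj' : Set.InjOn (fun i => x i ω) {i | ω ∈ A i} := fun i hi j hj hij => h3 i j hi hj hij
    have hsum : pairing f (toConfig (S ω)) = ∑ᶠ i, (A i).indicator (fun ω => f (x i ω)) ω := by
      rw [pairing, toConfig_coe h2, himg, finsum_mem_image hinj', finsum_mem_def]
      rfl
    have hsupp : (Function.support fun i => (A i).indicator (fun ω => f (x i ω)) ω).Finite := by
      refine Set.Finite.of_finite_image (f := fun i => x i ω)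
        ((h2 (tsupport f) f.hasCompactSupport').subset ?_) (hinj'.mono ?_)
      · rintro _ ⟨i, hi, rfl⟩
        have hiA : ω ∈ A i := Set.mem_of_indicator_ne_zero hi
        rw [Function.mem_support, Set.indicator_of_mem hiA] at hi
        refine ⟨?_, subset_tsupport _ hi⟩
        rw [himg]
        exact ⟨i, hiA, rfl⟩
      · intro i hi
        have hi' : (A i).indicator (fun ω => f (x i ω)) ω ≠ 0 := hi
        exact (Set.mem_of_indicator_ne_zero hi' : ω ∈ A i)
    rw [hsum, ← tsum_eq_finsum (L := .unconditional ι) hsupp]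
    have h := (summable_of_hasFiniteSupport (L := .unconditional ι) hsupp).hasSum
    rwa [HasSum, SummationFilter.unconditional_filter] at h

/-! ### The numbers of points of a configuration -/

/-- The counting measure of the points of a configuration in the interval `[-n, n]`. -/
def windowMeasure (n : ℕ) (S : Config) : Measure ℝ :=
  Measure.count.restrict (S.1 ∩ Set.Icc (-n : ℝ) n)

lemma windowMeasure_apply (n : ℕ) (S : Config) {B : Set ℝ} (hB : MeasurableSet B) :
    windowMeasure n S B = ((S.1 ∩ Set.Icc (-n : ℝ) n ∩ B).encard : ℝ≥0∞) := by
  have hf := S.2 (Set.Icc (-n : ℝ) n) isCompact_Icc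
  rw [windowMeasure, Measure.restrict_apply hB, Set.inter_comm,
    Measure.count_apply (hf.measurableSet.inter hB)]

instance (n : ℕ) (S : Config) : IsFiniteMeasure (windowMeasure n S) := by
  refine ⟨?_⟩
  rw [windowMeasure_apply n S MeasurableSet.univ, Set.inter_univ]
  have := (S.2 (Set.Icc (-n : ℝ) n) isCompact_Icc).encard_lt_top
  simpa [lt_top_iff_ne_top] using this.ne

/-- The indicator function of an interval is a decreasing limit of trapezoidal functions. -/
lemma measurable_encard_inter_Icc (a b : ℝ) :
    Measurable fun S : Config => ((S.1 ∩ Set.Icc a b).encard : ℝ≥0∞) := by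
  have hlim : ∀ S : Config, Tendsto
      (fun m : ℕ => ENNReal.ofReal (pairing (bump a b (m + 1) (by positivity)) S)) atTop
      (𝓝 ((S.1 ∩ Set.Icc a b).encard : ℝ≥0∞)) := by
    intro S
    refine tendsto_const_nhds.congr' ?_
    have hK : IsCompact (Set.Icc (a - 1) (b + 1)) := isCompact_Icc
    have hfin := S.2 _ hK
    have hev : ∀ᶠ m : ℕ in atTop, ∀ x ∈ S.1 ∩ Set.Icc (a - 1) (b + 1), x ∉ Set.Icc a b →
        bump a b (m + 1) (by positivity) x = 0 := by
      rw [eventually_all_finite hfin]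
      intro x _
      by_cases hx : x ∈ Set.Icc a b
      · exact Eventually.of_forall fun m h => absurd hx h
      have hpos : 0 < max (a - x) (x - b) := by
        rw [Set.mem_Icc, not_and_or, not_le, not_le] at hx
        rcases hx with hx | hx
        · exact lt_max_of_lt_left (by linarith)
        · exact lt_max_of_lt_right (by linarith)
      filter_upwards [tendsto_one_div_add_atTop_nhds_zero_nat.eventually (gt_mem_nhds hpos)]
        with m hm _
      refine bump_eq_zero _ fun h => ?_
      rcases lt_max_iff.1 hm with h1 | h1
      · linarith [h.1]
      · linarith [h.2]
    filter_upwards [hev] with m hm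
    have hsupp : ∀ x ∉ Set.Icc (a - 1) (b + 1), bump a b (m + 1) (by positivity) x = 0 := by
      intro x hx
      refine bump_eq_zero _ fun h => hx ?_
      have : 1 / ((m : ℝ) + 1) ≤ 1 := by
        rw [div_le_one (by positivity)]
        linarith [(Nat.cast_nonneg m : (0 : ℝ) ≤ m)]
      exact ⟨by linarith [h.1], by linarith [h.2]⟩
    have hsub : S.1 ∩ Set.Icc a b ⊆ S.1 ∩ Set.Icc (a - 1) (b + 1) :=
      Set.inter_subset_inter_right _ (Set.Icc_subset_Icc (by linarith) (by linarith))
    have hfin' := hfin.subset hsub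
    rw [pairing_eq_sum hK hsupp, ← Finset.sum_subset (s₁ := hfin'.toFinset)
      (by simpa using hsub) fun x hx hx' => hm x (by simpa using hx) fun h => hx' (by
        simp only [Set.Finite.mem_toFinset] at hx ⊢
        exact ⟨hx.1, h⟩)]
    rw [Finset.sum_congr rfl fun x hx => bump_eq_one _ (by
      simp only [Set.Finite.mem_toFinset] at hx
      exact hx.2)]
    rw [hfin'.encard_eq_coe_toFinset_card]
    simp
  exact measurable_of_tendsto_metrizable
    (fun m => ENNReal.measurable_ofReal.comp (measurable_pairing _)) (tendsto_pi_nhds.2 hlim)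

lemma measurable_windowMeasure (n : ℕ) : Measurable (windowMeasure n) := by
  refine Measurable.measure_of_isPiSystem
    (BorelSpace.measurable_eq.trans (borel_eq_generateFrom_Icc ℝ)) (isPiSystem_Icc id id) ?_ ?_
  · rintro _ ⟨a, b, -, rfl⟩
    simp_rw [windowMeasure_apply n _ measurableSet_Icc, Set.inter_assoc, Set.Icc_inter_Icc]
    exact measurable_encard_inter_Icc _ _
  · simp_rw [windowMeasure_apply n _ MeasurableSet.univ, Set.inter_univ]
    exact measurable_encard_inter_Icc _ _

/-- The number of points in a Borel set is a measurable function of the configuration. -/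
theorem measurable_encard_inter {B : Set ℝ} (hB : MeasurableSet B) :
    Measurable fun S : Config => (S.1 ∩ B).encard := by
  have h1 : ∀ S : Config, ((S.1 ∩ B).encard : ℝ≥0∞) = ⨆ n, windowMeasure n S B := by
    intro S
    have hcount : (S.1 ∩ B).Countable := by
      have hc : S.1 ∩ B ⊆ ⋃ n : ℕ, S.1 ∩ Set.Icc (-n : ℝ) n := by
        rintro x ⟨hx, -⟩
        obtain ⟨n, hn⟩ := exists_nat_ge |x|
        exact Set.mem_iUnion.2 ⟨n, hx, abs_le.1 hn⟩
      exact (Set.countable_iUnion fun n => (S.2 _ isCompact_Icc).countable).mono hc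
    rw [← Measure.count_apply hcount.measurableSet]
    have hU : S.1 ∩ B = ⋃ n : ℕ, S.1 ∩ Set.Icc (-n : ℝ) n ∩ B := by
      refine Set.Subset.antisymm ?_ (Set.iUnion_subset fun n x hx => ⟨hx.1.1, hx.2⟩)
      rintro x ⟨hx, hxB⟩
      obtain ⟨n, hn⟩ := exists_nat_ge |x|
      exact Set.mem_iUnion.2 ⟨n, ⟨hx, abs_le.1 hn⟩, hxB⟩
    have hmono : Monotone fun n : ℕ => S.1 ∩ Set.Icc (-n : ℝ) n ∩ B := by
      intro m n hmn x hx
      have : (m : ℝ) ≤ n := by exact_mod_cast hmn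
      exact ⟨⟨hx.1.1, by linarith [hx.1.2.1], by linarith [hx.1.2.2]⟩, hx.2⟩
    rw [hU, hmono.measure_iUnion]
    refine iSup_congr fun n => ?_
    rw [windowMeasure_apply n S hB, Measure.count_apply
      ((S.2 _ isCompact_Icc).measurableSet.inter hB)]
  have h2 : Measurable fun S : Config => ((S.1 ∩ B).encard : ℝ≥0∞) := by
    simp_rw [h1]
    exact Measurable.iSup fun n => (Measure.measurable_coe hB).comp (measurable_windowMeasure n)
  refine measurable_to_countable' fun k => ?_
  have : (fun S : Config => (S.1 ∩ B).encard) ⁻¹' {k}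
      = (fun S : Config => ((S.1 ∩ B).encard : ℝ≥0∞)) ⁻¹' {(k : ℝ≥0∞)} := by
    ext S
    simp
  rw [this]
  exact h2 (measurableSet_singleton _)

/-! ### Convergence in distribution through windows -/

/-- The interval `[-n, n]`. -/
abbrev window (n : ℕ) : Set ℝ := Set.Icc (-n : ℝ) n

/-- Whether a configuration belongs to `A` depends only on its points in `[-n, n]`. -/
def DeterminedBy (n : ℕ) (A : Set Config) : Prop :=
  ∀ S T : Config, S.1 ∩ window n = T.1 ∩ window n → S ∈ A → T ∈ A

lemma DeterminedBy.mono {m n : ℕ} (hmn : m ≤ n) {A : Set Config} (h : DeterminedBy m A) :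
    DeterminedBy n A := by
  intro S T hST
  refine h S T ?_
  have hsub : window m ⊆ window n := by
    have : (m : ℝ) ≤ n := by exact_mod_cast hmn
    exact Set.Icc_subset_Icc (by linarith) this
  rw [← Set.inter_eq_right.2 hsub, ← Set.inter_assoc, ← Set.inter_assoc, hST]

/-- A pairing depends only on the points in a window. -/
lemma exists_window_pairing_eq (f : C_c(ℝ, ℝ)) :
    ∃ n : ℕ, ∀ S T : Config, S.1 ∩ window n = T.1 ∩ window n → pairing f S = pairing f T := by
  obtain ⟨R, hR⟩ := f.hasCompactSupport'.isBounded.subset_closedBall 0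
  obtain ⟨n, hn⟩ := exists_nat_ge R
  refine ⟨n, fun S T hST => ?_⟩
  have hf : ∀ x ∉ window n, f x = 0 := by
    intro x hx
    refine image_eq_zero_of_notMem_tsupport fun h => hx ?_
    have := hR h
    rw [Metric.mem_closedBall, dist_zero_right, Real.norm_eq_abs, abs_le] at this
    exact ⟨by linarith [this.1], by linarith [this.2]⟩
  rw [pairing_eq_sum isCompact_Icc hf, pairing_eq_sum isCompact_Icc hf]
  refine Finset.sum_congr ?_ fun _ _ => rfl
  ext x
  simp only [Set.Finite.mem_toFinset]
  rw [hST]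

/-- The basic neighbourhoods in the vague topology involve finitely many test functions, hence one
window. -/
lemma exists_determinedBy_of_isOpen {U : Set Config} (hU : IsOpen U) {S : Config} (hS : S ∈ U) :
    ∃ W, IsOpen W ∧ W ⊆ U ∧ S ∈ W ∧ ∃ n, DeterminedBy n W := by
  obtain ⟨V, hV, rfl⟩ := isOpen_induced_iff.1 hU
  obtain ⟨I, u, hu, hI⟩ := isOpen_pi_iff.1 hV _ hS
  refine ⟨{T | ∀ f ∈ I, pairing f T ∈ u f}, ?_, ?_, ?_, ?_⟩
  · have : {T : Config | ∀ f ∈ I, pairing f T ∈ u f} = ⋂ f ∈ I, pairing f ⁻¹' u f := by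
      ext T; simp
    rw [this]
    exact isOpen_biInter_finset fun f hf => (hu f hf).1.preimage (continuous_pairing f)
  · exact fun T hT => hI fun f hf => hT f hf
  · exact fun f hf => (hu f hf).2
  · choose n hn using exists_window_pairing_eq
    refine ⟨I.sup n, fun T T' hTT' hT f hf => ?_⟩
    have hle : n f ≤ I.sup n := Finset.le_sup hf
    have hdet : DeterminedBy (n f) {T | pairing f T ∈ u f} := fun T T' h hT => by
      change pairing f T' ∈ u f
      rw [← hn f T T' h]
      exact hT
    exact hdet.mono hle T T' hTT' (hT f hf)

/-- An open set of configurations is an increasing union of open sets each of which is determined by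
a window. -/
lemma exists_monotone_determinedBy {U : Set Config} (hU : IsOpen U) :
    ∃ V : ℕ → Set Config, Monotone V ∧ (∀ m, IsOpen (V m)) ∧ (∀ m, ∃ n, DeterminedBy n (V m)) ∧
      ⋃ m, V m = U := by
  let 𝒮 : Set (Set Config) := {W | IsOpen W ∧ W ⊆ U ∧ ∃ n, DeterminedBy n W}
  obtain ⟨T, hTc, hTS, hTU⟩ := TopologicalSpace.isOpen_sUnion_countable 𝒮 fun W hW => hW.1
  have hU' : ⋃₀ 𝒮 = U := by
    refine Set.Subset.antisymm (Set.sUnion_subset fun W hW => hW.2.1) fun S hS => ?_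
    obtain ⟨W, h1, h2, h3, h4⟩ := exists_determinedBy_of_isOpen hU hS
    exact ⟨W, ⟨h1, h2, h4⟩, h3⟩
  have hempty : ∅ ∈ 𝒮 := ⟨isOpen_empty, Set.empty_subset _, 0, fun _ _ _ h => h⟩
  obtain ⟨g, hg⟩ := (hTc.insert ∅).exists_eq_range (Set.insert_nonempty _ _)
  have hgS : ∀ m, g m ∈ 𝒮 := by
    intro m
    have : g m ∈ insert ∅ T := hg ▸ ⟨m, rfl⟩
    rcases this with h | h
    · rw [h]; exact hempty
    · exact hTS h
  refine ⟨fun m => ⋃ k ∈ Finset.range (m + 1), g k, ?_, ?_, ?_, ?_⟩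
  · intro m m' hmm'
    exact Set.biUnion_subset_biUnion_left fun k hk =>
      Finset.mem_range.2 ((Finset.mem_range.1 hk).trans_le (by omega))
  · exact fun m => isOpen_biUnion fun k _ => (hgS k).1
  · intro m
    choose n hn using fun k => (hgS k).2.2
    refine ⟨(Finset.range (m + 1)).sup n, fun S S' hSS' hS => ?_⟩
    obtain ⟨k, hk, hSk⟩ := Set.mem_iUnion₂.1 hS
    exact Set.mem_iUnion₂.2 ⟨k, hk, (hn k).mono (Finset.le_sup hk) S S' hSS' hSk⟩
  · rw [← hU', ← hTU]
    refine Set.Subset.antisymm ?_ ?_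
    · refine Set.iUnion_subset fun m => Set.iUnion₂_subset fun k _ => ?_
      have : g k ∈ insert ∅ T := hg ▸ ⟨k, rfl⟩
      rcases this with h | h
      · rw [h]; exact Set.empty_subset _
      · exact Set.subset_sUnion_of_mem h
    · refine Set.sUnion_subset fun W hW => ?_
      have : W ∈ Set.range g := hg ▸ Set.mem_insert_of_mem _ hW
      obtain ⟨k, rfl⟩ := this
      exact fun S hS => Set.mem_iUnion.2 ⟨k, Set.mem_iUnion₂.2 ⟨k, by simp, hS⟩⟩

/-- A criterion for convergence in distribution: in each window the configuration `X t` agrees, up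
to an event of vanishing probability, with a random configuration that has the law of the limit
in this window. -/
theorem tendstoInDistribution_of_window {Ω G : Type*} [MeasurableSpace Ω] [MeasurableSpace G]
    {P : Measure Ω} [IsProbabilityMeasure P] {X : ℝ → Ω → Config} (hX : ∀ t, AEMeasurable (X t) P)
    {V : Ω → Config} (hV : AEMeasurable V P) (Q : ProbabilityMeasure Config)
    (hQ : (Q : Measure Config) = P.map V) {θ : Measure G} {w : ℕ → G → Config}
    (hw : ∀ n, AEMeasurable (w n) θ)
    (hVw : ∀ n, ∃ g : Ω → G, Measurable g ∧ P.map g = θ ∧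
      ∀ᵐ ω ∂P, (V ω).1 ∩ window n = (w n (g ω)).1 ∩ window n)
    (hXw : ∀ n : ℕ, ∃ g : ℝ → Ω → G, (∀ᶠ t in atTop, Measurable (g t) ∧ P.map (g t) = θ) ∧
      Tendsto (fun t => P {ω | (X t ω).1 ∩ window n ≠ (w n (g t ω)).1 ∩ window n}) atTop (𝓝 0)) :
    TendstoInDistribution X atTop (id : Config → Config) (fun _ => P) (Q : Measure Config) := by
  refine ⟨hX, aemeasurable_id, ?_⟩
  refine tendsto_of_forall_isOpen_le_liminf' fun U hU => ?_
  simp only [ProbabilityMeasure.coe_mk, Measure.map_id]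
  obtain ⟨A, hmono, hopen, hdet, rfl⟩ := exists_monotone_determinedBy hU
  -- it suffices to consider an open set that depends on one window
  rw [hmono.measure_iUnion]
  refine iSup_le fun m => ?_
  have hle : liminf (fun t => P.map (X t) (A m)) atTop
      ≤ liminf (fun t => P.map (X t) (⋃ m, A m)) atTop :=
    liminf_le_liminf (Eventually.of_forall fun t => measure_mono (Set.subset_iUnion A m))
  refine le_trans ?_ hle
  obtain ⟨n, hn⟩ := hdet m
  have hAm : MeasurableSet (A m) := (hopen m).measurableSet
  obtain ⟨g, hg, hgθ, hVg⟩ := hVw n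
  obtain ⟨g', hg', hbad⟩ := hXw n
  have hQA : (Q : Measure Config) (A m) = θ (w n ⁻¹' A m) := by
    rw [hQ, Measure.map_apply_of_aemeasurable hV hAm, ← hgθ,
      Measure.map_apply₀ hg.aemeasurable ((hw n).nullMeasurableSet_preimage hAm |> fun h => by
        rw [hgθ]; exact h)]
    refine measure_congr ?_
    filter_upwards [hVg] with ω hω
    exact propext ⟨fun h => hn _ _ hω h, fun h => hn _ _ hω.symm h⟩
  -- the two configurations agree in the window outside the exceptional event
  have hstep : ∀ᶠ t in atTop, (Q : Measure Config) (A m)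
      - P {ω | (X t ω).1 ∩ window n ≠ (w n (g' t ω)).1 ∩ window n} ≤ P.map (X t) (A m) := by
    filter_upwards [hg'] with t ht
    rw [tsub_le_iff_right, hQA, ← ht.2, Measure.map_apply₀ ht.1.aemeasurable (by
      rw [ht.2]; exact (hw n).nullMeasurableSet_preimage hAm),
      Measure.map_apply_of_aemeasurable (hX t) hAm]
    refine (measure_mono fun ω hω => ?_).trans (measure_union_le _ _)
    by_cases h : (X t ω).1 ∩ window n = (w n (g' t ω)).1 ∩ window n
    · exact Or.inl (hn _ _ h.symm hω)
    · exact Or.inr h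
  have hlim : Tendsto (fun t => (Q : Measure Config) (A m)
      - P {ω | (X t ω).1 ∩ window n ≠ (w n (g' t ω)).1 ∩ window n}) atTop
      (𝓝 ((Q : Measure Config) (A m))) := by
    have := ENNReal.Tendsto.sub (tendsto_const_nhds (x := (Q : Measure Config) (A m))) hbad
      (Or.inl (measure_ne_top _ _))
    simpa using this
  rw [← hlim.liminf_eq]
  exact liminf_le_liminf hstep

/-! ### The law of the service times -/

instance : IsProbabilityMeasure (expSeq 1) := isProbabilityMeasure_expSeq one_pos

/-- The output of a machine up to time `n` depends on the input up to time `n` only. -/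
lemma run_congr {α β γ σ : Type*} {φ : σ × (α × β) → γ} {ψ : σ × (α × β) → σ} {s : σ}
    {a a' : ℕ → α} {b : ℕ → β} {n : ℕ} (h : ∀ k ≤ n, a k = a' k) :
    run φ ψ s a b n = run φ ψ s a' b n := by
  induction n generalizing s a a' b with
  | zero => rw [run, run, h 0 le_rfl]
  | succ n ih =>
    rw [run, run, h 0 (by omega)]
    exact ih fun k hk => h (k + 1) (by omega)

/-- The service times at the first of the sites `z 0, z 1, …` which have the clocks `W 0, W 1, …`,
computed under the assumption that the clock of the site `z n` gives the service times there. -/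
def serviceApprox : ℕ → (ℕ → ℝ) → (ℕ → ℕ → ℝ) → ℕ → ℝ
  | 0, _, W => W 0
  | n + 1, z, W => scons (W 0 0) (run siteOut siteNext (z 0 + W 0 0, z 1, stail z)
      (serviceApprox n (stail z) (stail W)) (stail (W 0)))

/-- The service times at the first of the sites `z 0, z 1, …` with clocks `W 0, W 1, …`. -/
def serviceOf (z : ℕ → ℝ) (W : ℕ → ℕ → ℝ) (k : ℕ) : ℝ := serviceApprox k z W k

lemma serviceApprox_succ {n k : ℕ} (hk : k ≤ n) (z : ℕ → ℝ) (W : ℕ → ℕ → ℝ) :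
    serviceApprox (n + 1) z W k = serviceApprox n z W k := by
  induction n generalizing k z W with
  | zero =>
    obtain rfl : k = 0 := by omega
    rfl
  | succ n ih =>
    cases k with
    | zero => rfl
    | succ k =>
      exact run_congr (a := serviceApprox (n + 1) (stail z) (stail W))
        (a' := serviceApprox n (stail z) (stail W)) fun l hl => ih (by omega) _ _

lemma serviceApprox_eq_serviceOf {n k : ℕ} (hk : k ≤ n) (z : ℕ → ℝ) (W : ℕ → ℕ → ℝ) :
    serviceApprox n z W k = serviceOf z W k := by
  induction n, hk using Nat.le_induction with
  | base => rfl
  | succ n hn ih => rw [serviceApprox_succ hn, ih]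

/-- The service time of car `i + k` at `y i` involves the sites `y i, …, y (i + k)` only, because at
`y (i + k)` this car is the first one; so the approximations are exact. -/
lemma service_eq_serviceOf {y : ℤ → ℝ} {d : ℤ → ℕ → ℝ} (hd : ∀ i, StrictMono (d i))
    (hpos : ∀ i, 0 < d i 0) (i : ℤ) :
    service y d i = serviceOf (fun l => y (i + l)) fun l => gap (d (i + l)) := by
  funext k
  suffices h : ∀ n k, k ≤ n → ∀ i,
      service y d i k = serviceApprox n (fun l => y (i + l)) (fun l => gap (d (i + l))) k from
    h k k le_rfl i
  intro n
  induction n with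
  | zero =>
    intro k hk i
    obtain rfl : k = 0 := by omega
    simp [service, serviceApprox, gap]
  | succ n ih =>
    intro k hk i
    rw [service_eq_run hd hpos i, serviceApprox]
    have e0 : gap (d (i + ((0 : ℕ) : ℤ))) = gap (d i) := by simp
    have es : ∀ f : ℤ → ℝ, stail (fun l : ℕ => f (i + l)) = fun l : ℕ => f (i + 1 + l) := by
      intro f; funext l; simp only [stail_apply]; congr 1; push_cast; ring
    cases k with
    | zero => simp [gap]
    | succ k =>
      rw [scons_succ, scons_succ, e0, es]
      have e2 : stail (fun l : ℕ => gap (d (i + l))) = fun l : ℕ => gap (d (i + 1 + l)) := by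
        funext l; simp only [stail_apply]; congr 2; push_cast; ring
      rw [e2, run_congr fun l hl => ih l (by omega) (i + 1)]
      simp [gap]

@[fun_prop] lemma measurable_serviceApprox (n : ℕ) :
    Measurable fun p : (ℕ → ℝ) × (ℕ → ℕ → ℝ) => serviceApprox n p.1 p.2 := by
  induction n with
  | zero => exact (measurable_pi_apply 0).comp measurable_snd
  | succ n ih =>
    have h1 : Measurable fun p : (ℕ → ℝ) × (ℕ → ℕ → ℝ) => (stail p.1, stail p.2) := by fun_prop
    have h2 : Measurable fun p : (ℕ → ℝ) × (ℕ → ℕ → ℝ) => p.2 0 :=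
      (measurable_pi_apply 0).comp measurable_snd
    have h3 : Measurable fun p : (ℕ → ℝ) × (ℕ → ℕ → ℝ) => p.2 0 0 :=
      (measurable_pi_apply 0).comp h2
    have h4 : Measurable fun p : (ℕ → ℝ) × (ℕ → ℕ → ℝ) =>
        ((p.1 0 + p.2 0 0, p.1 1, stail p.1),
          (serviceApprox n (stail p.1) (stail p.2), stail (p.2 0))) := by
      refine Measurable.prodMk ?_ ((ih.comp h1).prodMk (measurable_stail.comp h2))
      exact (Measurable.add (by fun_prop) h3).prodMk (by fun_prop)
    have h5 := (measurable_run measurable_siteOut measurable_siteNext).comp h4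
    exact measurable_scons.comp (h3.prodMk h5)

@[fun_prop] lemma measurable_serviceOf :
    Measurable fun p : (ℕ → ℝ) × (ℕ → ℕ → ℝ) => serviceOf p.1 p.2 :=
  measurable_pi_lambda _ fun k => (measurable_pi_apply k).comp (measurable_serviceApprox k)

/-- At each step of the machine the output is a fresh exponential variable. -/
lemma map_siteOut (s : SiteState) :
    ((expMeasure 1).prod (expMeasure 1)).map (fun p => siteOut (s, p)) = expMeasure 1 :=
  map_memoryless_swap (g := max 0 (max s.1 (s.2.2 0) - max s.2.1 (s.2.2 0))) one_pos
    (le_max_left _ _)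

/-- The approximations have the right law by induction along the sites: each site is a machine
that turns independent exponential variables into independent exponential variables. -/
lemma measurePreserving_serviceApprox (n : ℕ) (z : ℕ → ℝ) :
    MeasurePreserving (serviceApprox n z) (iid (expSeq 1)) (expSeq 1) := by
  induction n generalizing z with
  | zero => exact measurePreserving_eval_infinitePi (fun _ : ℕ => expSeq 1) 0
  | succ n ih =>
    have m1 := measurePreserving_split (expSeq 1)
    have m2 := (measurePreserving_split (expMeasure 1)).prod (ih (stail z))
    have m3 := measurePreserving_prodAssoc (expMeasure 1) (expSeq 1) (expSeq 1)
    have hm : Measurable (Function.uncurry fun (x : ℝ) (q : (ℕ → ℝ) × (ℕ → ℝ)) =>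
        run siteOut siteNext (z 0 + x, z 1, stail z) q.2 q.1) :=
      (measurable_run measurable_siteOut measurable_siteNext).comp
        (f := fun p : ℝ × ((ℕ → ℝ) × (ℕ → ℝ)) =>
          (((z 0 + p.1, z 1, stail z) : SiteState), (p.2.2, p.2.1))) (by fun_prop)
    have m4 := (MeasurePreserving.id (expMeasure 1)).skew_product (μc := (expSeq 1).prod (expSeq 1))
      (μd := expSeq 1) hm (ae_of_all _ fun x => by
        have h := map_run measurable_siteOut measurable_siteNext map_siteOut
          (z 0 + x, z 1, stail z)
        have hsw := Measure.prod_swap (μ := expSeq 1) (ν := expSeq 1)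
        have hmr : Measurable fun p : (ℕ → ℝ) × (ℕ → ℝ) =>
            run siteOut siteNext (z 0 + x, z 1, stail z) p.1 p.2 :=
          (measurable_run measurable_siteOut measurable_siteNext).comp
            (f := fun p => (((z 0 + x, z 1, stail z) : SiteState), p)) (by fun_prop)
        rw [← hsw, Measure.map_map hmr measurable_swap] at h
        exact h)
    exact (measurePreserving_scons (expMeasure 1)).comp (m4.comp (m3.comp (m2.comp m1)))

/-- For given positions of the cars, the service times at a site are independent exponential
variables. -/
theorem measurePreserving_serviceOf (z : ℕ → ℝ) :
    MeasurePreserving (serviceOf z) (iid (expSeq 1)) (expSeq 1) := by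
  have hm : Measurable (serviceOf z) := measurable_serviceOf.comp (f := fun W => (z, W))
    (by fun_prop)
  refine ⟨hm, eq_iid fun n t ht => ?_⟩
  rw [Measure.map_apply hm (measurableSet_prefix n ht), ← iid_prefix n ht,
    ← (measurePreserving_serviceApprox n z).measure_preimage
      (measurableSet_prefix n ht).nullMeasurableSet]
  congr 1
  ext W
  simp only [Set.mem_preimage, Set.mem_ofPred_eq]
  exact forall₂_congr fun k hk => by rw [serviceApprox_eq_serviceOf hk.le]

/-! ### The law of the input -/

namespace IsInput

variable {Ω : Type*} [MeasurableSpace Ω] {P : Measure Ω} {lam : ℝ}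
  {y : ℤ → Ω → ℝ} {d : ℤ → ℕ → Ω → ℝ}

lemma measurable_sites (h : IsInput P lam y d) : Measurable fun ω i => y i ω :=
  measurable_pi_lambda _ h.measurable_y

lemma measurable_clock (h : IsInput P lam y d) (i : ℤ) : Measurable fun ω k => d i k ω :=
  measurable_pi_lambda _ (h.measurable_d i)

lemma ae_strictMono_clock (h : IsInput P lam y d) :
    ∀ᵐ ω ∂P, ∀ i, StrictMono fun k => d i k ω := ae_all_iff.2 h.strictMono_d

lemma ae_pos_clock (h : IsInput P lam y d) : ∀ᵐ ω ∂P, ∀ i, 0 < d i 0 ω := ae_all_iff.2 h.pos_d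

/-- The clocks at the sites `i, i + 1, …`, each given by its inter-event times. -/
def clocks (d : ℤ → ℕ → Ω → ℝ) (i : ℤ) (ω : Ω) : ℕ → ℕ → ℝ := fun l => gap fun k => d (i + l) k ω

lemma measurable_clocks (h : IsInput P lam y d) (i : ℤ) : Measurable (clocks d i) :=
  measurable_pi_lambda _ fun l => measurable_gap.comp (h.measurable_clock (i + l))

lemma ae_serviceOf_eq (h : IsInput P lam y d) (i : ℤ) :
    ∀ᵐ ω ∂P, serviceOf (fun l => y (i + 2 + l) ω) (stail (stail (clocks d i ω)))
      = service (fun j => y j ω) (fun j k => d j k ω) (i + 2) := by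
  filter_upwards [h.ae_strictMono_clock, h.ae_pos_clock] with ω h1 h2
  rw [service_eq_serviceOf h1 h2]
  congr 1
  funext l
  simp only [stail_apply, clocks]
  rw [show i + ((l + 1 + 1 : ℕ) : ℤ) = i + 2 + l by push_cast; ring]

variable [IsProbabilityMeasure P]

/-- The inter-event times of the clock at a site are independent exponential variables. -/
lemma map_gap_clock (h : IsInput P lam y d) (i : ℤ) :
    P.map (fun ω => gap fun k => d i k ω) = expSeq 1 := by
  refine (h.poisson_d i).map_gap one_pos (T := id) Function.injective_id measurable_id
    (fun a b ha hab => ?_) (h.measurable_clock i) (h.strictMono_d i) (h.pos_d i)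
    (ae_of_all _ fun ω s _ => by simp)
  rw [Set.preimage_id, Measure.restrict_apply measurableSet_Ioc, Set.inter_eq_left.2,
    Real.volume_Ioc,
    one_mul]
  exact fun x hx => ha.trans_lt hx.1

lemma map_clocks (h : IsInput P lam y d) (i : ℤ) : P.map (clocks d i) = iid (expSeq 1) := by
  have h1 : iIndepFun (fun (l : ℕ) ω => gap fun k => d (i + l) k ω) P := by
    have h2 := h.indep_d.precomp (g := fun l : ℕ => i + (l : ℤ)) fun a b hab => by simpa using hab
    exact h2.comp (fun _ => gap) fun _ => measurable_gap
  have h3 := h1.map_fun_eq_infinitePi_map fun l : ℕ =>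
    measurable_gap.comp (h.measurable_clock (i + l))
  refine h3.trans ?_
  rw [iid]
  congr 1
  funext l
  exact h.map_gap_clock (i + l)

lemma measurePreserving_sites_clocks (h : IsInput P lam y d) (i : ℤ) :
    MeasurePreserving (fun ω => ((fun j => y j ω), clocks d i ω)) P
      ((P.map fun ω j => y j ω).prod (iid (expSeq 1))) := by
  refine ⟨h.measurable_sites.prodMk (h.measurable_clocks i), ?_⟩
  have hind : IndepFun (fun ω j => y j ω) (clocks d i) P := by
    refine h.indep_y_d.comp (φ := id)
      (ψ := fun (c : ℤ → ℕ → ℝ) (l : ℕ) => gap (c (i + l))) measurable_id ?_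
    exact measurable_pi_lambda _ fun l => measurable_gap.comp (measurable_pi_apply _)
  rw [(indepFun_iff_map_prod_eq_prod_map_map h.measurable_sites.aemeasurable
    (h.measurable_clocks i).aemeasurable).1 hind, h.map_clocks]

/-- The positions of the cars, the clocks at two sites and the service times at the next site are
independent. -/
theorem measurePreserving_service (h : IsInput P lam y d) (i : ℤ) :
    MeasurePreserving (fun ω => ((fun j => y j ω), (clocks d i ω 0, (clocks d i ω 1,
        serviceOf (fun l => y (i + 2 + l) ω) (stail (stail (clocks d i ω)))))))
      P ((P.map fun ω j => y j ω).prod ((expSeq 1).prod ((expSeq 1).prod (expSeq 1)))) := by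
  have : IsProbabilityMeasure (P.map fun ω j => y j ω) :=
    Measure.isProbabilityMeasure_map h.measurable_sites.aemeasurable
  have hm : Measurable (Function.uncurry fun (u : ℤ → ℝ) (W : ℕ → ℕ → ℝ) =>
      (W 0, (W 1, serviceOf (fun l => u (i + 2 + l)) (stail (stail W))))) := by
    have h1 : Measurable fun p : (ℤ → ℝ) × (ℕ → ℕ → ℝ) =>
        ((fun l : ℕ => p.1 (i + 2 + l)), stail (stail p.2)) := by fun_prop
    have h2 : ∀ n, Measurable fun p : (ℤ → ℝ) × (ℕ → ℕ → ℝ) => p.2 n := fun n =>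
      (measurable_pi_apply n).comp measurable_snd
    exact (h2 0).prodMk ((h2 1).prodMk (measurable_serviceOf.comp h1))
  have m1 := (MeasurePreserving.id (P.map fun ω j => y j ω)).skew_product
    (μc := iid (expSeq 1)) (μd := (expSeq 1).prod ((expSeq 1).prod (expSeq 1))) hm
    (ae_of_all _ fun u => by
      have m2 := (MeasurePreserving.id (expSeq 1)).prod
        (((MeasurePreserving.id (expSeq 1)).prod
          (measurePreserving_serviceOf fun l => u (i + 2 + l))).comp
            (measurePreserving_split (expSeq 1)))
      exact (m2.comp (measurePreserving_split (expSeq 1))).map_eq)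
  exact m1.comp (h.measurePreserving_sites_clocks i)

/-- Almost surely at each site some car passes without stopping. -/
theorem ae_exists_phase_lt (h : IsInput P lam y d) :
    ∀ᵐ ω ∂P, ∀ i, ∃ k, phase (fun j => y j ω) (fun j k => d j k ω) i k
      < phase (fun j => y j ω) (fun j k => d j k ω) (i + 1) k := by
  refine ae_all_iff.2 fun i => ?_
  have m := h.measurePreserving_service (i - 1)
  have : IsProbabilityMeasure (P.map fun ω j => y j ω) :=
    Measure.isProbabilityMeasure_map h.measurable_sites.aemeasurable
  have m1 : MeasurePreserving (fun q : (ℤ → ℝ) × ((ℕ → ℝ) × ((ℕ → ℝ) × (ℕ → ℝ))) => q.2.2)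
      ((P.map fun ω j => y j ω).prod ((expSeq 1).prod ((expSeq 1).prod (expSeq 1))))
      ((expSeq 1).prod (expSeq 1)) := measurePreserving_snd.comp measurePreserving_snd
  have m2 := (Measure.measurePreserving_swap (μ := expSeq 1) (ν := expSeq 1)).comp (m1.comp m)
  have h1 := m2.quasiMeasurePreserving.ae (ae_exists_psum_gt one_pos le_rfl 0)
  filter_upwards [h1, h.strictMono_y, h.ae_serviceOf_eq (i - 1)] with ω ⟨k, hk⟩ hy hs
  refine Traffic.exists_phase_lt hy ⟨k, ?_⟩
  rw [show i + 1 = i - 1 + 2 by ring, ← hs]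
  simp only [Function.comp_apply, Prod.snd_swap, Prod.fst_swap, add_zero, clocks] at hk
  rw [psum_gap] at hk
  simpa using hk

end IsInput

/-! ### The sites seen from a fixed position -/

/-- The site `y i` is the first one to the right of `c`. -/
def IsFirst (c : ℝ) (y : ℤ → ℝ) (i : ℤ) : Prop := (∀ j < i, y j ≤ c) ∧ ∀ j, i ≤ j → c < y j

lemma IsFirst.unique {c : ℝ} {y : ℤ → ℝ} {i j : ℤ} (hi : IsFirst c y i) (hj : IsFirst c y j) :
    i = j := by
  by_contra h
  rcases lt_or_gt_of_ne h with h | h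
  · exact (hi.2 i le_rfl).not_ge (hj.1 i h)
  · exact (hj.2 j le_rfl).not_ge (hi.1 j h)

lemma IsSites.exists_isFirst {y : ℤ → ℝ} (hy : IsSites y) (c : ℝ) : ∃ i, IsFirst c y i := by
  obtain ⟨i₁, h1⟩ := hy.exists_lt c
  obtain ⟨i₂, h2⟩ := hy.exists_gt c
  obtain ⟨i, hi, hle⟩ := Int.exists_least_of_bdd (P := fun i => c < y i)
    ⟨i₁, fun i hi => (hy.strictMono.lt_iff_lt.1 (h1.trans hi)).le⟩ ⟨i₂, h2⟩
  refine ⟨i, fun j hj => ?_, fun j hj => hi.trans_le (hy.strictMono.monotone hj)⟩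
  by_contra h
  exact (hle j (not_le.1 h)).not_gt hj

open Classical in
/-- The index of the first site to the right of `c`. -/
def firstIndex (c : ℝ) (y : ℤ → ℝ) : ℤ := if h : ∃ i, IsFirst c y i then h.choose else 0

lemma firstIndex_eq {c : ℝ} {y : ℤ → ℝ} {i : ℤ} (h : IsFirst c y i) : firstIndex c y = i := by
  have h' : ∃ i, IsFirst c y i := ⟨i, h⟩
  rw [firstIndex, dif_pos h', h'.choose_spec.unique h]

lemma IsSites.isFirst_firstIndex {y : ℤ → ℝ} (hy : IsSites y) (c : ℝ) :
    IsFirst c y (firstIndex c y) := by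
  obtain ⟨i, hi⟩ := hy.exists_isFirst c
  rwa [firstIndex_eq hi]

@[fun_prop] lemma measurable_firstIndex :
    Measurable fun p : ℝ × (ℤ → ℝ) => firstIndex p.1 p.2 := by
  have hm : ∀ i, MeasurableSet {p : ℝ × (ℤ → ℝ) | IsFirst p.1 p.2 i} := by
    intro i
    have : {p : ℝ × (ℤ → ℝ) | IsFirst p.1 p.2 i} = (⋂ j, ⋂ _ : j < i, {p | p.2 j ≤ p.1}) ∩
        ⋂ j, ⋂ _ : i ≤ j, {p | p.1 < p.2 j} := by
      ext p; simp [IsFirst]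
    rw [this]
    refine (MeasurableSet.iInter fun j => .iInter fun _ => ?_).inter
      (MeasurableSet.iInter fun j => .iInter fun _ => ?_)
    · exact measurableSet_le (by fun_prop) (by fun_prop)
    · exact measurableSet_lt (by fun_prop) (by fun_prop)
  refine measurable_to_countable' fun i => ?_
  have hpre : (fun p : ℝ × (ℤ → ℝ) => firstIndex p.1 p.2) ⁻¹' {i}
      = {p | IsFirst p.1 p.2 i} ∪ ({p | i = 0} ∩ (⋃ j, {p | IsFirst p.1 p.2 j})ᶜ) := by
    ext p
    simp only [Set.mem_preimage, Set.mem_singleton_iff, Set.mem_union, Set.mem_ofPred_eq,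
      Set.mem_inter_iff, Set.mem_compl_iff, Set.mem_iUnion]
    by_cases h : ∃ j, IsFirst p.1 p.2 j
    · obtain ⟨j, hj⟩ := h
      rw [firstIndex_eq hj]
      constructor
      · rintro rfl
        exact Or.inl hj
      · rintro (hi | ⟨-, hne⟩)
        · exact hj.unique hi
        · exact absurd ⟨j, hj⟩ hne
    · rw [firstIndex, dif_neg h]
      constructor
      · rintro rfl
        exact Or.inr ⟨rfl, h⟩
      · rintro (hi | ⟨rfl, -⟩)
        · exact absurd ⟨i, hi⟩ h
        · rfl
  rw [hpre]
  exact (hm i).union ((MeasurableSet.const _).inter (MeasurableSet.iUnion hm).compl)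

/-- The sites to the right of `c`, in increasing order. -/
def after (c : ℝ) (y : ℤ → ℝ) (k : ℕ) : ℝ := y (firstIndex c y + k)

/-- The sites to the left of `c`, in decreasing order. -/
def before (c : ℝ) (y : ℤ → ℝ) (k : ℕ) : ℝ := y (firstIndex c y - 1 - k)

lemma measurable_eval_int : Measurable fun q : (ℤ → ℝ) × ℤ => q.1 q.2 :=
  measurable_from_prod_countable_left fun i => measurable_pi_apply i

@[fun_prop] lemma measurable_after : Measurable fun p : ℝ × (ℤ → ℝ) => after p.1 p.2 := by
  refine measurable_pi_lambda _ fun k => ?_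
  have h : Measurable fun p : ℝ × (ℤ → ℝ) => (p.2, firstIndex p.1 p.2 + (k : ℤ)) :=
    measurable_snd.prodMk (measurable_firstIndex.add_const _)
  exact measurable_eval_int.comp h

@[fun_prop] lemma measurable_before : Measurable fun p : ℝ × (ℤ → ℝ) => before p.1 p.2 := by
  refine measurable_pi_lambda _ fun k => ?_
  have h : Measurable fun p : ℝ × (ℤ → ℝ) => (p.2, firstIndex p.1 p.2 - 1 - (k : ℤ)) :=
    measurable_snd.prodMk ((measurable_firstIndex.sub_const _).sub_const _)
  exact measurable_eval_int.comp h

namespace IsSites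

variable {y : ℤ → ℝ}

lemma after_strictMono (hy : IsSites y) (c : ℝ) : StrictMono (after c y) := fun k l hkl =>
  hy.strictMono (by omega)

lemma lt_after (hy : IsSites y) (c : ℝ) (k : ℕ) : c < after c y k :=
  (hy.isFirst_firstIndex c).2 _ (by omega)

lemma mem_range_after_iff (hy : IsSites y) {c s : ℝ} (hs : c < s) :
    s ∈ Set.range (after c y) ↔ s ∈ Set.range y := by
  constructor
  · rintro ⟨k, rfl⟩
    exact ⟨_, rfl⟩
  · rintro ⟨i, rfl⟩
    have hi : firstIndex c y ≤ i := by
      by_contra h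
      exact ((hy.isFirst_firstIndex c).1 i (not_le.1 h)).not_gt hs
    obtain ⟨k, rfl⟩ := Int.le.dest hi
    exact ⟨k, rfl⟩

lemma before_strictAnti (hy : IsSites y) (c : ℝ) : StrictAnti (before c y) := fun k l hkl =>
  hy.strictMono (by omega)

lemma before_le (hy : IsSites y) (c : ℝ) (k : ℕ) : before c y k ≤ c :=
  (hy.isFirst_firstIndex c).1 _ (by omega)

lemma mem_range_before_iff (hy : IsSites y) {c s : ℝ} (hs : s ≤ c) :
    s ∈ Set.range (before c y) ↔ s ∈ Set.range y := by
  constructor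
  · rintro ⟨k, rfl⟩
    exact ⟨_, rfl⟩
  · rintro ⟨i, rfl⟩
    have hi : i ≤ firstIndex c y - 1 := by
      by_contra h
      exact ((hy.isFirst_firstIndex c).2 i (by omega)).not_ge hs
    obtain ⟨k, hk⟩ := Int.le.dest hi
    refine ⟨k, ?_⟩
    rw [before]
    congr 1
    omega

end IsSites

/-- The distances between the points of the sequence that consists of `c` and the sites to the right
of `c`. -/
def afterGaps (c : ℝ) (y : ℤ → ℝ) : ℕ → ℝ := gap fun k => after c y k - c

/-- The distances between the points of the sequence that consists of `c` and the sites to the left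
of `c`. -/
def beforeGaps (c : ℝ) (y : ℤ → ℝ) : ℕ → ℝ := gap fun k => c - before c y k

lemma psum_afterGaps (c : ℝ) (y : ℤ → ℝ) (k : ℕ) : psum (afterGaps c y) k = after c y k - c := by
  rw [afterGaps, psum_gap]

lemma psum_beforeGaps (c : ℝ) (y : ℤ → ℝ) (k : ℕ) :
    psum (beforeGaps c y) k = c - before c y k := by
  rw [beforeGaps, psum_gap]

@[fun_prop] lemma measurable_afterGaps :
    Measurable fun p : ℝ × (ℤ → ℝ) => afterGaps p.1 p.2 := by
  refine measurable_gap.comp (measurable_pi_lambda _ fun k => ?_)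
  exact ((measurable_pi_apply k).comp measurable_after).sub measurable_fst

@[fun_prop] lemma measurable_beforeGaps :
    Measurable fun p : ℝ × (ℤ → ℝ) => beforeGaps p.1 p.2 := by
  refine measurable_gap.comp (measurable_pi_lambda _ fun k => ?_)
  exact measurable_fst.sub ((measurable_pi_apply k).comp measurable_before)

lemma homogeneous_apply (r : ℝ) (B : Set ℝ) : homogeneous r B = ENNReal.ofReal r * volume B := rfl

namespace IsInput

variable {Ω : Type*} [MeasurableSpace Ω] {P : Measure Ω} {lam : ℝ} {y : ℤ → Ω → ℝ}
  {d : ℤ → ℕ → Ω → ℝ}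

lemma ae_isSites (h : IsInput P lam y d) : ∀ᵐ ω ∂P, IsSites fun i => y i ω := by
  have hfin : ∀ᵐ ω ∂P, ∀ n : ℕ, (Set.range (fun i => y i ω) ∩ Set.Icc (-n : ℝ) n).Finite := by
    refine ae_all_iff.2 fun n => h.poisson_y.ae_finite measurableSet_Icc ?_
    rw [homogeneous_apply, Real.volume_Icc]
    exact ENNReal.mul_ne_top ENNReal.ofReal_ne_top ENNReal.ofReal_ne_top
  filter_upwards [hfin, h.strictMono_y] with ω hω hy
  -- infinitely many sites do not fit into a bounded interval
  have key : ∀ (f : ℕ → ℤ), Function.Injective f → ∀ a b, ∃ k, y (f k) ω ∉ Set.Icc a b := by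
    intro f hf a b
    by_contra hne
    push Not at hne
    obtain ⟨n, hn⟩ := exists_nat_ge (max (-a) b)
    refine Set.infinite_of_injective_forall_mem (f := fun k => y (f k) ω)
      (hy.injective.comp hf) (fun k => ?_) (hω n)
    have := hne k
    exact ⟨⟨f k, rfl⟩, by linarith [this.1, le_max_left (-a) b], by
      linarith [this.2, le_max_right (-a) b]⟩
  refine ⟨hy, fun a => ?_, fun a => ?_⟩
  · obtain ⟨k, hk⟩ := key (fun k => k) Nat.cast_injective (y 0 ω) a
    refine ⟨k, ?_⟩
    by_contra hle
    exact hk ⟨hy.monotone (by omega), not_lt.1 hle⟩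
  · obtain ⟨k, hk⟩ := key (fun k => -k) (fun a b hab => by simpa using hab) a (y 0 ω)
    refine ⟨-k, ?_⟩
    by_contra hle
    exact hk ⟨not_lt.1 hle, hy.monotone (by omega)⟩

variable [IsProbabilityMeasure P]

/-- The distances between the sites to the right of a fixed position are independent exponential
variables. -/
theorem measurePreserving_afterGaps (h : IsInput P lam y d) (hlam : 0 < lam) (c : ℝ) :
    MeasurePreserving (afterGaps c) (P.map fun ω i => y i ω) (expSeq lam) := by
  have hm : Measurable (after c) := measurable_after.comp (f := fun y => (c, y)) (by fun_prop)
  have hm' : Measurable (afterGaps c) :=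
    measurable_afterGaps.comp (f := fun y => (c, y)) (by fun_prop)
  refine ⟨hm', ?_⟩
  rw [Measure.map_map hm' h.measurable_sites]
  have hxm : Measurable fun ω (k : ℕ) => after c (fun i => y i ω) k - c :=
    measurable_pi_lambda _ fun k =>
      ((measurable_pi_apply k).comp (hm.comp h.measurable_sites)).sub_const c
  refine h.poisson_y.map_gap hlam (T := fun x => x - c) sub_left_injective (by fun_prop)
    (fun a b ha hab => ?_) hxm ?_ ?_ ?_
  · rw [Set.preimage_sub_const_Ioc, homogeneous_apply, Real.volume_Ioc,
      ← ENNReal.ofReal_mul hlam.le]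
    congr 1
    ring
  · filter_upwards [h.ae_isSites] with ω hω k l hkl
    exact sub_lt_sub_right (hω.after_strictMono c hkl) c
  · filter_upwards [h.ae_isSites] with ω hω
    exact sub_pos.2 (hω.lt_after c 0)
  · filter_upwards [h.ae_isSites] with ω hω s hs
    have h1 := hω.mem_range_after_iff (c := c) (s := s + c) (by linarith)
    constructor
    · rintro ⟨k, hk⟩
      obtain ⟨i, hi⟩ := h1.1 ⟨k, by linarith⟩
      exact ⟨_, ⟨i, rfl⟩, by simp only; linarith⟩
    · rintro ⟨_, ⟨i, rfl⟩, hi⟩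
      obtain ⟨k, hk⟩ := h1.2 ⟨i, by simp only at hi ⊢; linarith⟩
      exact ⟨k, by simp only; linarith⟩

/-- The distances between the sites to the left of a fixed position are independent exponential
variables. -/
theorem measurePreserving_beforeGaps (h : IsInput P lam y d) (hlam : 0 < lam) (c : ℝ) :
    MeasurePreserving (beforeGaps c) (P.map fun ω i => y i ω) (expSeq lam) := by
  have hm : Measurable (before c) := measurable_before.comp (f := fun y => (c, y)) (by fun_prop)
  have hm' : Measurable (beforeGaps c) :=
    measurable_beforeGaps.comp (f := fun y => (c, y)) (by fun_prop)
  refine ⟨hm', ?_⟩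
  rw [Measure.map_map hm' h.measurable_sites]
  have hxm : Measurable fun ω (k : ℕ) => c - before c (fun i => y i ω) k :=
    measurable_pi_lambda _ fun k =>
      ((measurable_pi_apply k).comp (hm.comp h.measurable_sites)).const_sub c
  have hc : ∀ᵐ ω ∂P, Set.range (fun i => y i ω) ∩ {c} = ∅ :=
    h.poisson_y.ae_empty (measurableSet_singleton c) (by simp [homogeneous_apply])
  refine h.poisson_y.map_gap hlam (T := fun x => c - x) sub_right_injective (by fun_prop)
    (fun a b ha hab => ?_) hxm ?_ ?_ ?_
  · rw [Set.preimage_const_sub_Ioc, homogeneous_apply, Real.volume_Ico,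
      ← ENNReal.ofReal_mul hlam.le]
    congr 1
    ring
  · filter_upwards [h.ae_isSites] with ω hω k l hkl
    exact sub_lt_sub_left (hω.before_strictAnti c hkl) c
  · filter_upwards [h.ae_isSites, hc] with ω hω hcω
    refine sub_pos.2 (lt_of_le_of_ne (hω.before_le c 0) fun heq => ?_)
    exact (Set.eq_empty_iff_forall_notMem.1 hcω) c ⟨⟨_, heq⟩, rfl⟩
  · filter_upwards [h.ae_isSites] with ω hω s hs
    have h1 := hω.mem_range_before_iff (c := c) (s := c - s) (by linarith)
    constructor
    · rintro ⟨k, hk⟩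
      obtain ⟨i, hi⟩ := h1.1 ⟨k, by linarith⟩
      exact ⟨_, ⟨i, rfl⟩, by simp only at hi ⊢; linarith⟩
    · rintro ⟨_, ⟨i, rfl⟩, hi⟩
      obtain ⟨k, hk⟩ := h1.2 ⟨i, by simp only at hi ⊢; linarith⟩
      exact ⟨k, by simp only; linarith⟩

end IsInput

/-! ### Sample paths of the queue -/

section

variable {c t L : ℝ} {z e : ℕ → ℝ}

lemma lindley_strictMono (he : ∀ k, 0 < e k) : StrictMono (lindley c z e) :=
  strictMono_nat_of_lt_succ fun k => by
    rw [lindley]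
    linarith [le_max_left (lindley c z e k) (z (k + 1)), he (k + 1)]

lemma lt_lindley (he : ∀ k, 0 < e k) (k : ℕ) : z k < lindley c z e k := by
  cases k with
  | zero => rw [lindley]; linarith [le_max_right c (z 0), he 0]
  | succ k => rw [lindley]; linarith [le_max_right (lindley c z e k) (z (k + 1)), he (k + 1)]

lemma exists_firstAfter (h : ∃ n, t < lindley c z e n) : ∃ n, FirstAfter t c z e n := by
  classical
  exact ⟨Nat.find h, Nat.find_spec h, fun k hk => not_lt.1 (Nat.find_min h hk)⟩

/-- As long as the server is busy after time `t`, the departures after time `t` are the partial sums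
of the service times as seen from time `t`. -/
lemma mem_range_lindley_iff (he : ∀ k, 0 < e k) (hct : c ≤ t) {n : ℕ}
    (hn : FirstAfter t c z e n) (H : ∀ m, z m ≤ t ∨ ∃ k < m, t + L < lindley c z e k) {s : ℝ}
    (hs : 0 < s) (hsL : s ≤ L) :
    t + s ∈ Set.range (lindley c z e) ↔ s ∈ Set.range (psum (restart t c z e)) := by
  rw [restart_eq hn]
  set U := lindley c z e with hU
  set r := residual t c z e n with hr
  have hmono : StrictMono U := lindley_strictMono he
  have hrk : ∀ k, r (k + 1) = e (n + 1 + k) := fun k => rfl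
  -- the partial sums are the departures, until both have left the window of length `L`
  have key : ∀ k, psum r k = U (n + k) - t ∨ (L < psum r k ∧ t + L < U (n + k)) := by
    intro k
    induction k with
    | zero =>
      left
      have hz : z n ≤ t := by
        rcases H n with h | ⟨k, hk, hlt⟩
        · exact h
        · linarith [hn.2 k hk]
      have hstart : U n - e n ≤ t := by
        cases n with
        | zero => simp only [hU, lindley]; linarith [max_le hct hz]
        | succ n =>
          have := hn.2 n (Nat.lt_succ_self n)
          simp only [hU, lindley]
          linarith [max_le this hz]
      rw [psum_zero, hr, residual, scons_zero, max_eq_left hstart, add_zero]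
    | succ k ih =>
      have hup : U (n + k) < U (n + (k + 1)) := hmono (by omega)
      have hup' : psum r k < psum r (k + 1) := by
        rw [psum_succ, hrk]
        linarith [he (n + 1 + k)]
      rcases ih with ih | ⟨h1, h2⟩
      · rcases H (n + k + 1) with h | ⟨j, hj, hlt⟩
        · left
          have hge : z (n + k + 1) ≤ U (n + k) :=
            h.trans (hn.1.le.trans (hmono.monotone (by omega)))
          rw [psum_succ, hrk, ih, show n + (k + 1) = n + k + 1 by omega, hU, lindley,
            max_eq_left hge, show n + 1 + k = n + k + 1 by omega]
          ring
        · right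
          have hle : U j ≤ U (n + k) := hmono.monotone (by omega)
          constructor <;> linarith
      · right
        constructor <;> linarith
  constructor
  · rintro ⟨j, hj⟩
    have hnj : n ≤ j := by
      by_contra h
      linarith [hn.2 j (not_le.1 h)]
    obtain ⟨k, rfl⟩ := Nat.exists_eq_add_of_le hnj
    refine ⟨k, ?_⟩
    rcases key k with h | ⟨-, h⟩ <;> linarith
  · rintro ⟨k, hk⟩
    refine ⟨n + k, ?_⟩
    rcases key k with h | ⟨h, -⟩ <;> linarith

/-- If all customers are there from the beginning, then the departures are the partial sums of the
service times. -/
lemma lindley_zero (he : ∀ k, 0 < e k) : lindley 0 (fun _ => 0) e = psum e := by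
  funext k
  induction k with
  | zero => simp [lindley, psum_zero]
  | succ k ih =>
    rw [lindley, ih, psum_succ, max_eq_left (psum_pos he k).le]

/-- From customer `M` on, a queue is a queue with another initial state. -/
lemma exists_lindley_add (c : ℝ) (z e : ℕ → ℝ) (M : ℕ) : ∃ c', ∀ k,
    lindley c z e (M + k) = lindley c' (fun k => z (M + k)) (fun k => e (M + k)) k := by
  induction M generalizing c z e with
  | zero => exact ⟨c, fun k => by simp⟩
  | succ M ih =>
    obtain ⟨c', hc'⟩ := ih (max c (z 0) + e 0) (stail z) (stail e)
    refine ⟨c', fun k => ?_⟩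
    rw [show M + 1 + k = M + k + 1 by omega, lindley_succ', hc']
    congr 1 <;> funext k <;> simp only [stail_apply] <;> congr 1 <;> omega

lemma lindley_mono {c' : ℝ} (h : c ≤ c') (k : ℕ) : lindley c z e k ≤ lindley c' z e k := by
  induction k with
  | zero => exact add_le_add_left (max_le_max h le_rfl) _
  | succ k ih => exact add_le_add_left (max_le_max ih le_rfl) _

/-- A change of the initial state has an effect only as long as the server is never idle. -/
lemma lindley_le_max (c c' : ℝ) (k : ℕ) :
    lindley c' z e k ≤ max (c' + psum e k) (lindley c z e k) := by
  induction k with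
  | zero =>
    simp only [lindley, psum_zero]
    rw [max_add_add_right]
    refine add_le_add_left (max_le (le_max_left _ _) ?_) _
    exact (le_max_right c (z 0)).trans (le_max_right _ _)
  | succ k ih =>
    simp only [lindley, psum_succ]
    rw [← add_assoc, max_add_add_right]
    refine add_le_add_left (max_le (ih.trans (max_le_max le_rfl (le_max_left _ _))) ?_) _
    exact (le_max_right _ _).trans (le_max_right _ _)

/-- Two queues with the same arrivals and service times and different initial states coalesce. -/
lemma exists_lindley_eq (he : ∀ k, 0 < e k) (h : ∀ C : ℝ, ∃ k, psum e k + C < z k) (c c' : ℝ) :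
    ∃ n, ∀ k, lindley c z e (n + k) = lindley c' z e (n + k) := by
  wlog hcc : c ≤ c' generalizing c c'
  · obtain ⟨n, hn⟩ := this c' c (le_of_not_ge hcc)
    exact ⟨n, fun k => (hn k).symm⟩
  obtain ⟨n, hn⟩ := h c'
  refine ⟨n, fun k => ?_⟩
  induction k with
  | zero =>
    rw [add_zero]
    refine le_antisymm (lindley_mono hcc n) ((lindley_le_max c c' n).trans (max_le ?_ le_rfl))
    linarith [lt_lindley (c := c) (z := z) he n]
  | succ k ih =>
    rw [← add_assoc, lindley, lindley, ih]

/-- The server needs at least the service times of the customers `j, …, j + n` after the arrival of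
customer `j`. -/
lemma add_sum_le_lindley (c : ℝ) (z e : ℕ → ℝ) (j n : ℕ) :
    z j + ∑ l ∈ Finset.range (n + 1), e (j + l) ≤ lindley c z e (j + n) := by
  induction n with
  | zero =>
    simp only [zero_add, Finset.range_one, Finset.sum_singleton, add_zero]
    cases j with
    | zero => exact add_le_add_left (le_max_right _ _) _
    | succ j => exact add_le_add_left (le_max_right _ _) _
  | succ n ih =>
    rw [Finset.sum_range_succ, ← add_assoc, ← add_assoc, lindley]
    exact add_le_add_left (ih.trans (le_max_left _ _)) _

end

lemma eventually_mem_range_iff {U V : ℕ → ℝ} (hU : StrictMono U) (hV : StrictMono V) {m n : ℕ}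
    (h : ∀ k, U (m + k) = V (n + k)) :
    ∀ᶠ x in atTop, (x ∈ Set.range U ↔ x ∈ Set.range V) := by
  filter_upwards [eventually_ge_atTop (U m), eventually_ge_atTop (V n)] with x h1 h2
  constructor
  · rintro ⟨j, rfl⟩
    obtain ⟨k, rfl⟩ := Nat.exists_eq_add_of_le (hU.le_iff_le.1 h1)
    exact ⟨n + k, (h k).symm⟩
  · rintro ⟨j, rfl⟩
    obtain ⟨k, rfl⟩ := Nat.exists_eq_add_of_le (hV.le_iff_le.1 h2)
    exact ⟨m + k, h k⟩

/-- The recursion for interdeparture times and sojourn times describes the departures from a queue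
which is left by a customer at time `c`, with the next arrivals counted from the arrival time
`c - w` of this customer. -/
lemma psum_run_burke (c w : ℝ) (a e : ℕ → ℝ) (k : ℕ) :
    psum (run burkeOut burkeNext w a e) k
      = lindley c (fun k => c - w + psum a k) e k - c := by
  induction k generalizing c w a e with
  | zero =>
    rw [psum_zero, run, lindley, psum_zero, burkeOut]
    have : max c (c - w + a 0) = c + max (a 0 - w) 0 := by
      rw [← max_add_add_left, max_comm]
      congr 1 <;> ring
    rw [this]
    ring
  | succ k ih =>
    have hs : stail (run burkeOut burkeNext w a e)
        = run burkeOut burkeNext (burkeNext (w, (a 0, e 0))) (stail a) (stail e) := rfl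
    rw [psum_succ', hs, ih (c + burkeOut (w, (a 0, e 0))), lindley_succ']
    have h0 : run burkeOut burkeNext w a e 0 = burkeOut (w, (a 0, e 0)) := rfl
    have h1 : max c (c - w + psum a 0) + e 0 = c + burkeOut (w, (a 0, e 0)) := by
      rw [psum_zero, burkeOut]
      have : max c (c - w + a 0) = c + max (a 0 - w) 0 := by
        rw [← max_add_add_left, max_comm]
        congr 1 <;> ring
      rw [this]
      ring
    have h2 : stail (fun k => c - w + psum a k) = fun k =>
        c + burkeOut (w, (a 0, e 0)) - burkeNext (w, (a 0, e 0)) + psum (stail a) k := by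
      funext k
      simp only [stail_apply, psum_succ', burkeOut, burkeNext]
      rcases le_total (a 0) w with h | h
      · rw [max_eq_right (a := a 0 - w) (by linarith), max_eq_left (by linarith)]
        ring
      · rw [max_eq_left (a := a 0 - w) (by linarith), max_eq_right (by linarith)]
        ring
    rw [h0, h1, h2]
    ring

/-! ### Rearranging independent sequences -/

/-- The sequence `e` with the first `M` terms of `f` put in front. -/
def splice {α : Type*} (M : ℕ) (f e : ℕ → α) (k : ℕ) : α := if k < M then f k else e (k - M)

/-- The sequence `e` with its first `M` terms in reversed order. -/
def reverse {α : Type*} (M : ℕ) (e : ℕ → α) (k : ℕ) : α := if k < M then e (M - 1 - k) else e k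

lemma splice_add {α : Type*} (M : ℕ) (f e : ℕ → α) (k : ℕ) : splice M f e (M + k) = e k := by
  simp [splice]

section

variable {α : Type*} [MeasurableSpace α]

lemma measurable_splice : Measurable fun p : ℕ × ((ℕ → α) × (ℕ → α)) =>
    splice p.1 p.2.1 p.2.2 := by
  refine measurable_from_prod_countable_right fun M => measurable_pi_lambda _ fun k => ?_
  simp only [splice]
  split_ifs <;> fun_prop

lemma measurable_reverse : Measurable fun p : ℕ × (ℕ → α) => reverse p.1 p.2 := by
  refine measurable_from_prod_countable_right fun M => measurable_pi_lambda _ fun k => ?_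
  simp only [reverse]
  split_ifs <;> fun_prop

lemma measurePreserving_splice (ρ : Measure α) [IsProbabilityMeasure ρ] (M : ℕ) :
    MeasurePreserving (fun p : (ℕ → α) × (ℕ → α) => splice M p.1 p.2) ((iid ρ).prod (iid ρ))
      (iid ρ) := by
  induction M with
  | zero =>
    have : (fun p : (ℕ → α) × (ℕ → α) => splice 0 p.1 p.2) = Prod.snd := by
      funext p k; simp [splice]
    rw [this]
    exact measurePreserving_snd
  | succ M ih =>
    have m1 := (measurePreserving_split ρ).prod (MeasurePreserving.id (iid ρ))
    have m2 := measurePreserving_prodAssoc ρ (iid ρ) (iid ρ)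
    have m3 := (MeasurePreserving.id ρ).prod ih
    have m := (measurePreserving_scons ρ).comp (m3.comp (m2.comp m1))
    convert m using 1
    funext p k
    cases k with
    | zero => simp [splice, MeasurableEquiv.prodAssoc]
    | succ k => simp [splice, MeasurableEquiv.prodAssoc]

lemma measurePreserving_reverse (ρ : Measure α) [IsProbabilityMeasure ρ] (M : ℕ) :
    MeasurePreserving (reverse M) (iid ρ) (iid ρ) := by
  have hm : Measurable (reverse M : (ℕ → α) → ℕ → α) :=
    measurable_reverse.comp (f := fun e => (M, e)) (by fun_prop)
  refine ⟨hm, ?_⟩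
  let f : ℕ → ℕ := fun k => if k < M then M - 1 - k else k
  have hf : Function.Injective f := by
    intro a b hab
    simp only [f] at hab
    split_ifs at hab <;> omega
  have h := Measure.map_infinitePi_infinitePi_of_inj (P := fun _ : ℕ => ρ) hf
  have he : (reverse M : (ℕ → α) → ℕ → α) = fun e k => e (f k) := by
    funext e k
    simp only [reverse, f]
    split_ifs <;> rfl
  rw [he]
  exact h

end

lemma psum_reverse {M k : ℕ} (hk : k < M) (e : ℕ → ℝ) :
    psum (reverse M e) k = ∑ l ∈ Finset.range (k + 1), e (M - 1 - k + l) := by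
  rw [psum, ← Finset.sum_range_reflect]
  refine Finset.sum_congr rfl fun l hl => ?_
  have := Finset.mem_range.1 hl
  rw [reverse, if_pos (by omega)]
  congr 1
  omega

/-! ### Unbounded sums -/

lemma ae_exists_psum_gt_all {r s : ℝ} (hr : 0 < r) (hrs : r ≤ s) :
    ∀ᵐ p ∂(expSeq r).prod (expSeq s), ∀ C : ℝ, ∃ k, psum p.2 k + C < psum p.1 k := by
  have h := ae_all_iff.2 fun n : ℕ => ae_exists_psum_gt hr hrs n
  filter_upwards [h] with p hp C
  obtain ⟨n, hn⟩ := exists_nat_ge C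
  obtain ⟨k, hk⟩ := hp n
  exact ⟨k, by linarith⟩

lemma ae_exists_lt_psum {r : ℝ} (hr : 0 < r) :
    ∀ᵐ x ∂expSeq r, ∀ C : ℝ, ∃ k, C < psum x k := by
  have := isProbabilityMeasure_expSeq hr
  have h1 := ae_exists_psum_gt_all hr le_rfl
  have h2 := (Measure.quasiMeasurePreserving_snd (μ := expSeq r) (ν := expSeq r)).ae
    (ae_pos_expSeq hr)
  have hms : MeasurableSet {x : ℕ → ℝ | ∀ n : ℕ, ∃ k, (n : ℝ) < psum x k} := by
    simp only [Set.ofPred_forall, Set.ofPred_exists]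
    exact .iInter fun n => .iUnion fun k => measurableSet_lt (by fun_prop) (by fun_prop)
  have h3 : ∀ᵐ p ∂(expSeq r).prod (expSeq r),
      p.1 ∈ {x : ℕ → ℝ | ∀ n : ℕ, ∃ k, (n : ℝ) < psum x k} := by
    filter_upwards [h1, h2] with p hp hp2 n
    obtain ⟨k, hk⟩ := hp n
    exact ⟨k, by linarith [psum_pos hp2 k]⟩
  have h4 := (ae_map_iff measurable_fst.aemeasurable hms).2 h3
  rw [measurePreserving_fst.map_eq] at h4
  filter_upwards [h4] with x hx C
  obtain ⟨n, hn⟩ := exists_nat_ge C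
  obtain ⟨k, hk⟩ := hx n
  exact ⟨k, by linarith⟩

/-- A strictly increasing unbounded sequence is locally finite. -/
lemma isLocFinite_range {x : ℕ → ℝ} (hx : StrictMono x) (hub : ∀ C, ∃ k, C < x k) :
    IsLocFinite (Set.range x) := by
  intro K hK
  obtain ⟨b, hb⟩ := hK.bddAbove
  obtain ⟨n, hn⟩ := hub b
  refine ((Set.finite_Iio n).image x).subset ?_
  rintro _ ⟨⟨k, rfl⟩, hk⟩
  exact ⟨k, hx.lt_iff_lt.1 ((hb hk).trans_lt hn), rfl⟩

/-! ### Random configurations that agree in a window -/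

lemma inter_window_subset_of_encard {n : ℕ} {S T : Config}
    (h : ∀ a b : ℚ, (S.1 ∩ (window n ∩ Set.Icc (a : ℝ) b)).encard
      = (T.1 ∩ (window n ∩ Set.Icc (a : ℝ) b)).encard) :
    S.1 ∩ window n ⊆ T.1 ∩ window n := by
  rintro x ⟨hxS, hxn⟩
  refine ⟨?_, hxn⟩
  by_contra hxT
  have hfin := T.2 (window n) isCompact_Icc
  obtain ⟨ε, hε, hball⟩ := Metric.isOpen_iff.1 hfin.isClosed.isOpen_compl x fun hx => hxT hx.1
  obtain ⟨a, ha1, ha2⟩ := exists_rat_btwn (show x - ε < x by linarith)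
  obtain ⟨b, hb1, hb2⟩ := exists_rat_btwn (show x < x + ε by linarith)
  have h0 : (T.1 ∩ (window n ∩ Set.Icc (a : ℝ) b)).encard = 0 := by
    rw [Set.encard_eq_zero, Set.eq_empty_iff_forall_notMem]
    rintro z ⟨hzT, hzn, hz⟩
    refine hball ?_ ⟨hzT, hzn⟩
    rw [Metric.mem_ball, Real.dist_eq, abs_lt]
    constructor <;> linarith [hz.1, hz.2]
  rw [← h a b, Set.encard_eq_zero] at h0
  exact (Set.eq_empty_iff_forall_notMem.1 h0) x ⟨hxS, hxn, ha2.le, hb1.le⟩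

lemma measurableSet_window_eq (n : ℕ) :
    MeasurableSet {p : Config × Config | p.1.1 ∩ window n = p.2.1 ∩ window n} := by
  have : {p : Config × Config | p.1.1 ∩ window n = p.2.1 ∩ window n}
      = ⋂ a : ℚ, ⋂ b : ℚ, {p | (p.1.1 ∩ (window n ∩ Set.Icc (a : ℝ) b)).encard
        = (p.2.1 ∩ (window n ∩ Set.Icc (a : ℝ) b)).encard} := by
    ext p
    simp only [Set.mem_ofPred_eq, Set.mem_iInter]
    constructor
    · intro h a b
      rw [← Set.inter_assoc, h, Set.inter_assoc]
    · intro h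
      exact Set.Subset.antisymm (inter_window_subset_of_encard h)
        (inter_window_subset_of_encard fun a b => (h a b).symm)
  rw [this]
  refine .iInter fun a => .iInter fun b => ?_
  have hm := measurable_encard_inter
    (measurableSet_Icc.inter measurableSet_Icc : MeasurableSet (window n ∩ Set.Icc (a : ℝ) b))
  exact measurableSet_eq_fun (hm.comp measurable_fst) (hm.comp measurable_snd)

/-- If two random configurations almost surely agree in a window for all large times, then the
probability that they differ in the window tends to zero. -/
lemma tendsto_measure_window_ne {Ω : Type*} [MeasurableSpace Ω] {P : Measure Ω}
    [IsProbabilityMeasure P] {X Y : ℝ → Ω → Config} (hX : ∀ t, AEMeasurable (X t) P)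
    (hY : ∀ t, AEMeasurable (Y t) P) {n : ℕ}
    (h : ∀ᵐ ω ∂P, ∀ᶠ t in atTop, (X t ω).1 ∩ window n = (Y t ω).1 ∩ window n) :
    Tendsto (fun t => P {ω | (X t ω).1 ∩ window n ≠ (Y t ω).1 ∩ window n}) atTop (𝓝 0) := by
  -- only sequences of times are considered, because of the null sets in the definition of
  -- almost everywhere measurability
  refine tendsto_of_seq_tendsto fun u hu => ?_
  let A : ℕ → Set Ω := fun k => {ω | ((hX (u k)).mk _ ω).1 ∩ window n
    ≠ ((hY (u k)).mk _ ω).1 ∩ window n}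
  have hA : ∀ k, MeasurableSet (A k) := fun k =>
    (((hX (u k)).measurable_mk.prodMk (hY (u k)).measurable_mk)
      (measurableSet_window_eq n)).compl
  have heq : ∀ᵐ ω ∂P, ∀ k, X (u k) ω = (hX (u k)).mk _ ω ∧ Y (u k) ω = (hY (u k)).mk _ ω := by
    refine ae_all_iff.2 fun k => ?_
    filter_upwards [(hX (u k)).ae_eq_mk, (hY (u k)).ae_eq_mk] with ω h1 h2 using ⟨h1, h2⟩
  have hmeas : ∀ k, P {ω | (X (u k) ω).1 ∩ window n ≠ (Y (u k) ω).1 ∩ window n} = P (A k) := by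
    intro k
    refine measure_congr ?_
    filter_upwards [heq] with ω hω
    refine propext ?_
    change _ ≠ _ ↔ _ ≠ _
    rw [(hω k).1, (hω k).2]
  have hlim : Tendsto (fun k => P (A k)) atTop (𝓝 (P ∅)) := by
    refine tendsto_measure_of_ae_tendsto_indicator_of_isFiniteMeasure atTop MeasurableSet.empty hA
      ?_
    filter_upwards [h, heq] with ω h1 h2
    filter_upwards [hu.eventually h1] with k hk
    simp only [Set.mem_empty_iff_false, iff_false, A, Set.mem_ofPred_eq, not_not]
    rw [← (h2 k).1, ← (h2 k).2]
    exact hk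
  rw [measure_empty] at hlim
  exact hlim.congr fun k => (hmeas k).symm

/-- The points of the sequence `U`, seen from `t`. -/
def shifted (U : ℕ → ℝ) (t : ℝ) : Config := toConfig {x | x + t ∈ Set.range U}

lemma setOf_add_mem_range (U : ℕ → ℝ) (t : ℝ) :
    {x | x + t ∈ Set.range U} = Set.range fun k => U k - t := by
  ext x
  constructor
  · rintro ⟨k, hk⟩
    exact ⟨k, by simp only; linarith⟩
  · rintro ⟨k, hk⟩
    exact ⟨k, by simp only at hk; linarith⟩

lemma isLocFinite_shifted {U : ℕ → ℝ} (hU : StrictMono U) (hub : ∀ C, ∃ k, C < U k) (t : ℝ) :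
    IsLocFinite {x | x + t ∈ Set.range U} := by
  rw [setOf_add_mem_range]
  refine isLocFinite_range (fun k l hkl => sub_lt_sub_right (hU hkl) t) fun C => ?_
  obtain ⟨k, hk⟩ := hub (C + t)
  exact ⟨k, by linarith⟩

lemma mem_shifted_iff {U : ℕ → ℝ} (hU : StrictMono U) (hub : ∀ C, ∃ k, C < U k) {t x : ℝ} :
    x ∈ (shifted U t).1 ↔ x + t ∈ Set.range U := by
  rw [shifted, toConfig_coe (isLocFinite_shifted hU hub t), Set.mem_ofPred_eq]

lemma aemeasurable_shifted {Ω : Type*} [MeasurableSpace Ω] {P : Measure Ω} {U : Ω → ℕ → ℝ}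
    (hU : Measurable U) (hmono : ∀ᵐ ω ∂P, StrictMono (U ω))
    (hub : ∀ᵐ ω ∂P, ∀ C, ∃ k, C < U ω k) (t : ℝ) :
    AEMeasurable (fun ω => shifted (U ω) t) P := by
  refine aemeasurable_toConfig (x := fun k ω => U ω k - t) (A := fun _ => Set.univ)
    (fun k => ((measurable_pi_apply k).comp hU).sub_const t) (fun _ => MeasurableSet.univ)
    (ae_of_all _ fun ω => ?_) ?_ ?_
  · rw [setOf_add_mem_range]
    ext x
    simp
  · filter_upwards [hmono, hub] with ω h1 h2 using isLocFinite_shifted h1 h2 t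
  · filter_upwards [hmono] with ω h1 k l _ _ hkl
    exact h1.injective (sub_left_injective hkl)

/-- Points whose distances have the law `expSeq r`, started at the left of the window. -/
def windowConfig (n : ℕ) (g : ℕ → ℝ) : Config := shifted (psum g) (n + 1)

lemma aemeasurable_windowConfig {r : ℝ} (hr : 0 < r) (n : ℕ) :
    AEMeasurable (windowConfig n) (expSeq r) := by
  refine aemeasurable_shifted measurable_psum ?_ (ae_exists_lt_psum hr) _
  filter_upwards [ae_pos_expSeq hr] with g hg using psum_strictMono hg

/-! ### The moving cars as a random configuration -/

lemma IsSites.exists_lt_add {y : ℤ → ℝ} (hy : IsSites y) (C : ℝ) :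
    ∃ k : ℕ, C < y (1 + k) := by
  obtain ⟨i, hi⟩ := hy.exists_gt C
  exact ⟨i.toNat, hi.trans_le (hy.strictMono.monotone (by omega))⟩

lemma eventually_forall_window {p : ℝ → Prop} (h : ∀ᶠ x in atTop, p x) (n : ℕ) :
    ∀ᶠ t in atTop, ∀ x ∈ window n, p (x + t) := by
  obtain ⟨s, hs⟩ := eventually_atTop.1 h
  filter_upwards [eventually_ge_atTop (s + n)] with t ht x hx
  exact hs _ (by linarith [hx.1])

namespace IsInput

variable {Ω : Type*} [MeasurableSpace Ω] {P : Measure Ω} {lam : ℝ} {y : ℤ → Ω → ℝ}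
  {d : ℤ → ℕ → Ω → ℝ}

lemma measurable_phase (h : IsInput P lam y d) (i : ℤ) (k : ℕ) :
    Measurable fun ω => phase (fun j => y j ω) (fun j k => d j k ω) i k := by
  refine (h.measurable_y i).add ?_
  induction k generalizing i with
  | zero => exact h.measurable_d i 0
  | succ k ih =>
    have h1 := ((ih (i + 1)).add (h.measurable_y (i + 1))).sub (h.measurable_y i)
    exact Measurable.ite (measurableSet_lt (ih i) h1) h1 (h.measurable_d i (k + 1))

lemma ae_isLocFinite_movingCars (h : IsInput P lam y d) :
    ∀ᵐ ω ∂P, ∀ t, IsLocFinite (movingCars (fun i => y i ω) (fun i k => d i k ω) t) := by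
  filter_upwards [h.ae_isSites, h.ae_strictMono_clock, h.ae_pos_clock] with ω h1 h2 h3 t
  exact isLocFinite_movingCars h1 h2 h3 t

lemma aemeasurable_movingCars (h : IsInput P lam y d) (t : ℝ) :
    AEMeasurable (fun ω => toConfig (movingCars (fun i => y i ω) (fun i k => d i k ω) t)) P := by
  refine aemeasurable_toConfig (ι := ℤ × ℕ)
    (x := fun p ω => phase (fun i => y i ω) (fun i k => d i k ω) p.1 p.2 - t)
    (A := fun p => {ω | y (p.1 - 1) ω < phase (fun i => y i ω) (fun i k => d i k ω) p.1 p.2 - t} ∩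
      {ω | phase (fun i => y i ω) (fun i k => d i k ω) p.1 p.2 - t ≤ y p.1 ω})
    (fun p => (h.measurable_phase p.1 p.2).sub_const t) (fun p => ?_) (ae_of_all _ fun ω => ?_)
    ?_ ?_
  · have hm := (h.measurable_phase p.1 p.2).sub_const t
    exact (measurableSet_lt (h.measurable_y _) hm).inter (measurableSet_le hm (h.measurable_y _))
  · ext x
    simp only [mem_movingCars_iff, Set.mem_ofPred_eq, Set.mem_inter_iff, Prod.exists]
    refine exists_congr fun i => exists_congr fun k => ?_
    constructor
    · rintro ⟨h1, h2, h3⟩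
      have : phase (fun i => y i ω) (fun i k => d i k ω) i k - t = x := by linarith
      rw [this]
      exact ⟨⟨h2, h3⟩, rfl⟩
    · rintro ⟨⟨h2, h3⟩, rfl⟩
      exact ⟨by ring, h2, h3⟩
  · filter_upwards [h.ae_isLocFinite_movingCars] with ω hω using hω t
  · filter_upwards [h.strictMono_y, h.ae_strictMono_clock] with ω hy hd
    rintro ⟨i, k⟩ ⟨j, l⟩ ⟨hi1, hi2⟩ ⟨hj1, hj2⟩ heq
    simp only [Set.mem_ofPred_eq] at hi1 hi2 hj1 hj2 heq
    have hij : i - 1 < j := hy.lt_iff_lt.1 (hi1.trans_le (heq ▸ hj2))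
    have hji : j - 1 < i := hy.lt_iff_lt.1 (hj1.trans_le (heq ▸ hi2))
    obtain rfl : i = j := by omega
    have := (phase_strictMono (y := fun i => y i ω) hd i).injective (sub_left_injective heq)
    rw [this]

/-- The phases of the cars at the first site to the right of the origin. -/
def firstPhase (y : ℤ → Ω → ℝ) (d : ℤ → ℕ → Ω → ℝ) (ω : Ω) : ℕ → ℝ :=
  phase (fun i => y i ω) (fun i k => d i k ω) 1

lemma measurable_firstPhase (h : IsInput P lam y d) : Measurable (firstPhase y d) :=
  measurable_pi_lambda _ fun k => h.measurable_phase 1 k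

lemma ae_strictMono_firstPhase (h : IsInput P lam y d) :
    ∀ᵐ ω ∂P, StrictMono (firstPhase y d ω) := by
  filter_upwards [h.ae_strictMono_clock] with ω hd using phase_strictMono hd 1

lemma ae_exists_lt_firstPhase (h : IsInput P lam y d) :
    ∀ᵐ ω ∂P, ∀ C, ∃ k, C < firstPhase y d ω k := by
  filter_upwards [h.ae_isSites, h.ae_strictMono_clock, h.ae_pos_clock] with ω h1 h2 h3 C
  obtain ⟨k, hk⟩ := h1.exists_lt_add C
  exact ⟨k, hk.trans (lt_phase (y := fun i => y i ω) h2 h3 1 k)⟩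

lemma aemeasurable_shifted_firstPhase (h : IsInput P lam y d) (t : ℝ) :
    AEMeasurable (fun ω => shifted (firstPhase y d ω) t) P :=
  aemeasurable_shifted h.measurable_firstPhase h.ae_strictMono_firstPhase
    h.ae_exists_lt_firstPhase t

/-- The service times at the first site to the right of the origin, as a function of the positions
and the clocks. -/
def firstService (y : ℤ → Ω → ℝ) (d : ℤ → ℕ → Ω → ℝ) (ω : Ω) : ℕ → ℝ :=
  serviceOf (fun l => y (-1 + 2 + l) ω) (stail (stail (clocks d (-1) ω)))

lemma ae_firstPhase_eq (h : IsInput P lam y d) : ∀ᵐ ω ∂P,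
    firstPhase y d ω = lindley 0 (fun k => y (1 + k) ω) (firstService y d ω) := by
  filter_upwards [h.ae_serviceOf_eq (-1), h.label_y] with ω h1 h2
  funext k
  rw [firstService, h1]
  exact (lindley_service (y := fun i => y i ω) (i := 1) h2.2.le k).symm

variable [IsProbabilityMeasure P]

lemma ae_eventually_movingCars_eq (h : IsInput P lam y d) (n : ℕ) :
    ∀ᵐ ω ∂P, ∀ᶠ t in atTop,
      (toConfig (movingCars (fun i => y i ω) (fun i k => d i k ω) t)).1 ∩ window n
        = (shifted (firstPhase y d ω) t).1 ∩ window n := by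
  filter_upwards [h.ae_isSites, h.ae_strictMono_clock, h.ae_exists_phase_lt,
    h.ae_isLocFinite_movingCars, h.ae_strictMono_firstPhase, h.ae_exists_lt_firstPhase]
    with ω h1 h2 h3 h4 h5 h6
  filter_upwards [eventually_mem_movingCars_iff h1 h2 h3 1 (-n) n] with t ht
  ext x
  refine and_congr_left fun hx => ?_
  rw [toConfig_coe (h4 t), mem_shifted_iff h5 h6]
  exact ht x hx

end IsInput

/-! ### Overload: arrivals at a rate of at least one -/

lemma measurableSet_isSites : MeasurableSet {u : ℤ → ℝ | IsSites u} := by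
  have : {u : ℤ → ℝ | IsSites u} = (⋂ i : ℤ, ⋂ j : ℤ, ⋂ _ : i < j, {u | u i < u j}) ∩
      ((⋂ n : ℕ, ⋃ i : ℤ, {u | (n : ℝ) < u i}) ∩ ⋂ n : ℕ, ⋃ i : ℤ, {u | u i < -(n : ℝ)}) := by
    ext u
    simp only [Set.mem_ofPred_eq, Set.mem_inter_iff, Set.mem_iInter, Set.mem_iUnion]
    constructor
    · intro h
      exact ⟨fun i j hij => h.strictMono hij, fun n => h.exists_gt n, fun n => h.exists_lt (-n)⟩
    · rintro ⟨h1, h2, h3⟩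
      refine ⟨fun i j hij => h1 i j hij, fun a => ?_, fun a => ?_⟩
      · obtain ⟨n, hn⟩ := exists_nat_ge a
        obtain ⟨i, hi⟩ := h2 n
        exact ⟨i, hn.trans_lt hi⟩
      · obtain ⟨n, hn⟩ := exists_nat_ge (-a)
        obtain ⟨i, hi⟩ := h3 n
        exact ⟨i, by linarith⟩
  rw [this]
  refine MeasurableSet.inter (.iInter fun i => .iInter fun j => .iInter fun _ => ?_)
    (MeasurableSet.inter (.iInter fun n => .iUnion fun i => ?_)
      (.iInter fun n => .iUnion fun i => ?_))
  · exact measurableSet_lt (by fun_prop) (by fun_prop)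
  · exact measurableSet_lt (by fun_prop) (by fun_prop)
  · exact measurableSet_lt (by fun_prop) (by fun_prop)

lemma ae_exists_firstAfter (t c : ℝ) {z : ℕ → ℝ} (hz : ∀ C, ∃ k, C < z k) :
    ∀ᵐ e ∂expSeq 1, ∃ n, FirstAfter t c z e n := by
  filter_upwards [ae_pos_expSeq one_pos] with e he
  obtain ⟨k, hk⟩ := hz t
  exact exists_firstAfter ⟨k, hk.trans (lt_lindley he k)⟩

lemma ae_exists_firstAfter_zero {r : ℝ} (hr : 0 < r) (t : ℝ) :
    ∀ᵐ g ∂expSeq r, ∃ n, FirstAfter t 0 (fun _ => 0) g n := by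
  filter_upwards [ae_pos_expSeq hr, ae_exists_lt_psum hr] with g hg hub
  obtain ⟨k, hk⟩ := hub t
  exact exists_firstAfter ⟨k, by rwa [lindley_zero hg]⟩

/-- In the last time `T` before the present the backlog never reached the level `L`: here `p.1`
gives the arrivals and `p.2` the service times, both backwards in time. -/
def smallBacklog (L T : ℝ) : Set ((ℕ → ℝ) × (ℕ → ℝ)) :=
  {p | ∀ k, psum p.1 k < T → psum p.2 k ≤ L + psum p.1 k}

lemma measurableSet_smallBacklog (L T : ℝ) : MeasurableSet (smallBacklog L T) := by
  have : smallBacklog L T = ⋂ k, ({p | psum p.1 k < T}ᶜ ∪ {p | psum p.2 k ≤ L + psum p.1 k}) := by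
    ext p
    simp only [smallBacklog, Set.mem_ofPred_eq, Set.mem_iInter, Set.mem_union, Set.mem_compl_iff]
    exact forall_congr' fun k => imp_iff_not_or
  rw [this]
  exact .iInter fun k => (measurableSet_lt (by fun_prop) (by fun_prop)).compl.union
    (measurableSet_le (by fun_prop) (by fun_prop))

/-- The backlog reaches every level: otherwise the service times, summed backwards in time, would
never exceed the sums of the interarrival times by `L`. -/
lemma tendsto_smallBacklog {lam : ℝ} (hlam : 1 ≤ lam) (L : ℝ) :
    Tendsto (fun T => ((expSeq lam).prod (expSeq 1)) (smallBacklog L T)) atTop (𝓝 0) := by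
  have := isProbabilityMeasure_expSeq (one_pos.trans_le hlam)
  have h := tendsto_measure_iInter_atTop (μ := (expSeq lam).prod (expSeq 1))
    (s := smallBacklog L) (fun T => (measurableSet_smallBacklog L T).nullMeasurableSet)
    (fun S T hST p hp k hk => hp k (hk.trans_le hST)) ⟨0, measure_ne_top _ _⟩
  have h0 : ((expSeq lam).prod (expSeq 1)) (⋂ T, smallBacklog L T) = 0 := by
    have hsw := (Measure.measurePreserving_swap (μ := expSeq lam)
      (ν := expSeq 1)).quasiMeasurePreserving.ae (ae_exists_psum_gt one_pos hlam L)
    refine measure_mono_null (fun p hp => ?_) (ae_iff.1 hsw)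
    simp only [Set.mem_ofPred_eq, Prod.fst_swap, Prod.snd_swap, not_exists, not_lt]
    intro k
    have := Set.mem_iInter.1 hp (psum p.1 k + 1) k (by linarith)
    linarith
  rwa [h0] at h

/-- If there was a large backlog, then the server is busy for a long time. -/
lemma busy_of_notMem_smallBacklog {u : ℤ → ℝ} (hu : IsSites u) (hu0 : u 0 ≤ 0) {e : ℕ → ℝ}
    {t L : ℝ} (h : (beforeGaps t u, reverse (firstIndex t u - 1).toNat e) ∉ smallBacklog L t)
    (m : ℕ) :
    u (1 + m) ≤ t ∨ ∃ k < m, t + L < lindley 0 (fun l => u (1 + l)) e k := by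
  have hf := hu.isFirst_firstIndex t
  set ι := firstIndex t u
  set M := (ι - 1).toNat with hM
  simp only [smallBacklog, Set.mem_ofPred_eq, not_forall, not_le] at h
  -- the site `k` to the left of `t` is that of customer `M - 1 - k`, where `M` is the number of
  -- customers up to time `t`
  obtain ⟨k, hk1, hk2⟩ := h
  rw [psum_beforeGaps, before] at hk1 hk2
  have hpos : u 0 < u (ι - 1 - k) := by linarith
  have hk : 0 < ι - 1 - k := hu.strictMono.lt_iff_lt.1 hpos
  have hkM : k < M := by omega
  rcases lt_or_ge m M with hm | hm
  · left
    exact hf.1 _ (by omega)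
  · right
    refine ⟨M - 1, by omega, ?_⟩
    have hsum := add_sum_le_lindley 0 (fun l : ℕ => u (1 + l)) e (M - 1 - k) k
    rw [← psum_reverse hkM, show M - 1 - k + k = M - 1 by omega] at hsum
    have hidx : (1 : ℤ) + ((M - 1 - k : ℕ) : ℤ) = ι - 1 - k := by omega
    simp only [hidx] at hsum
    linarith

namespace IsInput

variable {Ω : Type*} [MeasurableSpace Ω] {P : Measure Ω} [IsProbabilityMeasure P] {lam : ℝ}
  {y : ℤ → Ω → ℝ} {d : ℤ → ℕ → Ω → ℝ}

lemma isProbabilityMeasure_sites (h : IsInput P lam y d) :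
    IsProbabilityMeasure (P.map fun ω j => y j ω) :=
  Measure.isProbabilityMeasure_map h.measurable_sites.aemeasurable

lemma measurePreserving_firstService (h : IsInput P lam y d) :
    MeasurePreserving (fun ω => ((fun j => y j ω), firstService y d ω)) P
      ((P.map fun ω j => y j ω).prod (expSeq 1)) := by
  have := h.isProbabilityMeasure_sites
  have m1 : MeasurePreserving (fun q : (ℕ → ℝ) × ((ℕ → ℝ) × (ℕ → ℝ)) => q.2.2)
      ((expSeq 1).prod ((expSeq 1).prod (expSeq 1))) (expSeq 1) :=
    measurePreserving_snd.comp measurePreserving_snd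
  exact ((MeasurePreserving.id (P.map fun ω j => y j ω)).prod m1).comp
    (h.measurePreserving_service (-1))

lemma ae_pos_firstService (h : IsInput P lam y d) : ∀ᵐ ω ∂P, ∀ k, 0 < firstService y d ω k := by
  have := h.isProbabilityMeasure_sites
  exact (measurePreserving_snd.comp h.measurePreserving_firstService).quasiMeasurePreserving.ae
    (ae_pos_expSeq one_pos)

/-- In the overloaded case the site is eventually busy, and the cars pass it according to its
clock. -/
theorem exists_gaps_of_one_le (h : IsInput P lam y d) (hlam : 1 ≤ lam) (n : ℕ) :
    ∃ g : ℝ → Ω → ℕ → ℝ, (∀ t, Measurable (g t) ∧ P.map (g t) = expSeq 1) ∧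
      Tendsto (fun t => P {ω | (shifted (firstPhase y d ω) t).1 ∩ window n
        ≠ (windowConfig n (g t ω)).1 ∩ window n}) atTop (𝓝 0) := by
  have hlam0 : 0 < lam := one_pos.trans_le hlam
  have := h.isProbabilityMeasure_sites
  have hsites : ∀ᵐ u ∂P.map fun ω j => y j ω, IsSites u :=
    (ae_map_iff h.measurable_sites.aemeasurable measurableSet_isSites).2 h.ae_isSites
  -- the point to the left of the window from which the departures are counted
  let τ : ℝ → ℝ := fun t => t - (n + 1)
  -- the service times as seen from time `τ t`
  have m1 : ∀ t, MeasurePreserving (fun p : (ℤ → ℝ) × (ℕ → ℝ) =>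
      restart t 0 (fun l : ℕ => p.1 (1 + l)) p.2) ((P.map fun ω j => y j ω).prod (expSeq 1))
      (expSeq 1) := by
    intro t
    have hm : Measurable (Function.uncurry fun (u : ℤ → ℝ) (e : ℕ → ℝ) =>
        restart t 0 (fun l : ℕ => u (1 + l)) e) :=
      (measurable_restart t).comp (f := fun p : (ℤ → ℝ) × (ℕ → ℝ) =>
        ((0 : ℝ), (fun l : ℕ => p.1 (1 + l)), p.2)) (by fun_prop)
    exact measurePreserving_snd.comp ((MeasurePreserving.id _).skew_product hm (by
      filter_upwards [hsites] with u hu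
      exact map_restart one_pos t 0 _ (ae_exists_firstAfter t 0 hu.exists_lt_add)))
  -- arrivals and service times backwards in time
  have m2 : ∀ t, MeasurePreserving (fun p : (ℤ → ℝ) × (ℕ → ℝ) =>
      (beforeGaps t p.1, reverse (firstIndex t p.1 - 1).toNat p.2))
      ((P.map fun ω j => y j ω).prod (expSeq 1)) ((expSeq lam).prod (expSeq 1)) := by
    intro t
    have hidx : Measurable fun p : (ℤ → ℝ) × (ℕ → ℝ) => (firstIndex t p.1 - 1).toNat :=
      (Measurable.of_discrete (f := fun i : ℤ => (i - 1).toNat)).comp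
        (measurable_firstIndex.comp (f := fun p : (ℤ → ℝ) × (ℕ → ℝ) => (t, p.1)) (by fun_prop))
    have hm : Measurable (Function.uncurry fun (u : ℤ → ℝ) (e : ℕ → ℝ) =>
        reverse (firstIndex t u - 1).toNat e) :=
      measurable_reverse.comp (hidx.prodMk measurable_snd)
    exact (h.measurePreserving_beforeGaps hlam0 t).skew_product hm
      (ae_of_all _ fun u => (measurePreserving_reverse (expMeasure 1) _).map_eq)
  have m0 := h.measurePreserving_firstService
  refine ⟨fun t ω => restart (τ t) 0 (fun l : ℕ => y (1 + l) ω) (firstService y d ω), fun t =>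
    ⟨((m1 (τ t)).comp m0).measurable, ((m1 (τ t)).comp m0).map_eq⟩, ?_⟩
  -- a backlog of `2 * n + 1` keeps the server busy from `τ t` to the right end of the window
  have hlim : Tendsto (fun t => ((expSeq lam).prod (expSeq 1)) (smallBacklog (2 * n + 1) (τ t)))
      atTop (𝓝 0) :=
    (tendsto_smallBacklog hlam _).comp (tendsto_atTop_add_const_right _ _ tendsto_id)
  refine tendsto_of_tendsto_of_tendsto_of_le_of_le' tendsto_const_nhds hlim
    (Eventually.of_forall fun _ => bot_le) ?_
  filter_upwards [eventually_ge_atTop ((n : ℝ) + 1)] with t ht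
  have ht' : 0 ≤ τ t := sub_nonneg.2 ht
  rw [← ((m2 (τ t)).comp m0).measure_preimage
    (measurableSet_smallBacklog _ _).nullMeasurableSet]
  refine measure_mono_ae ?_
  have hr := ((m1 (τ t)).comp m0).quasiMeasurePreserving.ae (ae_pos_expSeq one_pos)
  have hr' := ((m1 (τ t)).comp m0).quasiMeasurePreserving.ae (ae_exists_lt_psum one_pos)
  filter_upwards [h.ae_isSites, h.label_y, h.ae_firstPhase_eq, h.ae_pos_firstService,
    h.ae_strictMono_firstPhase, h.ae_exists_lt_firstPhase, hr, hr'] with ω h1 h2 h3 h4 h5 h6 h7 h8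
  intro hne
  by_contra hbig
  refine hne ?_
  simp only [Function.comp_apply] at h7 h8
  have hbusy := busy_of_notMem_smallBacklog h1 h2.1 hbig
  ext x
  refine and_congr_left fun hx => ?_
  rw [mem_shifted_iff h5 h6, windowConfig, mem_shifted_iff (psum_strictMono h7) h8, h3]
  obtain ⟨k, hk⟩ := h1.exists_lt_add (τ t)
  obtain ⟨m, hm⟩ := exists_firstAfter
    ⟨k, hk.trans (lt_lindley (c := 0) (z := fun l : ℕ => y (1 + l) ω) h4 k)⟩
  have := mem_range_lindley_iff h4 ht' hm hbusy (s := x + (n + 1)) (by linarith [hx.1])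
    (by linarith [hx.2])
  rw [← this]
  simp only [τ]
  rw [show t - ((n : ℝ) + 1) + (x + (n + 1)) = x + t by ring]

end IsInput

/-! ### Underload: arrivals at a rate below one -/

namespace IsInput

variable {Ω : Type*} {lam : ℝ} {y : ℤ → Ω → ℝ} {d : ℤ → ℕ → Ω → ℝ}

/-- A variable with the equilibrium law of the sojourn time, obtained from the first event of the
clock at the site `-1`. -/
def sojourn (lam : ℝ) (d : ℤ → ℕ → Ω → ℝ) (ω : Ω) : ℝ := 1 / (1 - lam) * clocks d (-1) ω 0 0

/-- The number of sites between `-w` and the origin. -/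
def early (w : ℝ) (u : ℤ → ℝ) : ℕ := (1 - firstIndex (-w) u).toNat

/-- The service times of the stationary queue: the sites before the origin are served according to
the clock at the site `0`. -/
def stationaryService (lam : ℝ) (y : ℤ → Ω → ℝ) (d : ℤ → ℕ → Ω → ℝ) (ω : Ω) : ℕ → ℝ :=
  splice (early (sojourn lam d ω) fun j => y j ω) (clocks d (-1) ω 1) (firstService y d ω)

/-- The interdeparture times of a queue in equilibrium which a customer leaves at time `0`. -/
def stationaryGaps (lam : ℝ) (y : ℤ → Ω → ℝ) (d : ℤ → ℕ → Ω → ℝ) (ω : Ω) : ℕ → ℝ :=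
  run burkeOut burkeNext (sojourn lam d ω) (afterGaps (-sojourn lam d ω) fun j => y j ω)
    (stationaryService lam y d ω)

lemma psum_stationaryGaps (ω : Ω) : psum (stationaryGaps lam y d ω)
    = lindley 0 (after (-sojourn lam d ω) fun j => y j ω) (stationaryService lam y d ω) := by
  funext k
  rw [stationaryGaps, psum_run_burke 0, sub_zero]
  congr 1
  funext l
  rw [psum_afterGaps]
  ring

variable [MeasurableSpace Ω] {P : Measure Ω} [IsProbabilityMeasure P]

/-- Burke's theorem for the stationary queue. -/
theorem measurePreserving_stationaryGaps (h : IsInput P lam y d) (h0 : 0 < lam) (h1 : lam < 1) :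
    MeasurePreserving (stationaryGaps lam y d) P (expSeq lam) := by
  have hb : 0 < 1 - lam := sub_pos.2 h1
  have := h.isProbabilityMeasure_sites
  have := isProbabilityMeasure_expMeasure hb
  have := isProbabilityMeasure_expMeasure h0
  have := isProbabilityMeasure_expSeq h0
  set μ := P.map fun ω j => y j ω
  -- the sojourn time, the gaps after minus the sojourn time and the service times are independent:
  -- this is checked by conditioning on them one after the other
  have mw : MeasurePreserving (fun x : ℕ → ℝ => 1 / (1 - lam) * x 0) (expSeq 1)
      (expMeasure (1 - lam)) :=
    (⟨by fun_prop, map_const_mul_expMeasure hb one_pos⟩ : MeasurePreserving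
      (fun x : ℝ => 1 / (1 - lam) * x) (expMeasure 1) (expMeasure (1 - lam))).comp
      (measurePreserving_eval_infinitePi (fun _ : ℕ => expMeasure 1) 0)
  have m1 := (measurePreserving_prodAssoc μ (expSeq 1)
    ((expSeq 1).prod (expSeq 1))).symm (MeasurableEquiv.prodAssoc)
  have m2 := ((mw.prod (MeasurePreserving.id μ)).comp
    (Measure.measurePreserving_swap (μ := μ) (ν := expSeq 1))).prod
      (MeasurePreserving.id ((expSeq 1).prod (expSeq 1)))
  have ma : MeasurePreserving (fun p : ℝ × (ℤ → ℝ) => (p.1, afterGaps (-p.1) p.2))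
      ((expMeasure (1 - lam)).prod μ) ((expMeasure (1 - lam)).prod (expSeq lam)) := by
    refine (MeasurePreserving.id (expMeasure (1 - lam))).skew_product
      (g := fun w u => afterGaps (-w) u) ?_ (ae_of_all _ fun w =>
        (h.measurePreserving_afterGaps h0 (-w)).map_eq)
    exact measurable_afterGaps.comp (f := fun p : ℝ × (ℤ → ℝ) => (-p.1, p.2)) (by fun_prop)
  have m3 : MeasurePreserving (fun q : (ℝ × (ℤ → ℝ)) × ((ℕ → ℝ) × (ℕ → ℝ)) =>
      ((q.1.1, afterGaps (-q.1.1) q.1.2), splice (early q.1.1 q.1.2) q.2.1 q.2.2))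
      (((expMeasure (1 - lam)).prod μ).prod ((expSeq 1).prod (expSeq 1)))
      (((expMeasure (1 - lam)).prod (expSeq lam)).prod (expSeq 1)) := by
    refine ma.skew_product (g := fun (q : ℝ × (ℤ → ℝ)) (p : (ℕ → ℝ) × (ℕ → ℝ)) =>
      splice (early q.1 q.2) p.1 p.2) ?_ (ae_of_all _ fun q =>
        (measurePreserving_splice (expMeasure 1) _).map_eq)
    have hidx : Measurable fun q : (ℝ × (ℤ → ℝ)) × ((ℕ → ℝ) × (ℕ → ℝ)) => early q.1.1 q.1.2 :=
      (Measurable.of_discrete (f := fun i : ℤ => (1 - i).toNat)).comp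
        (measurable_firstIndex.comp
          (f := fun q : (ℝ × (ℤ → ℝ)) × ((ℕ → ℝ) × (ℕ → ℝ)) => (-q.1.1, q.1.2)) (by fun_prop))
    exact measurable_splice.comp (hidx.prodMk measurable_snd)
  have m4 := measurePreserving_prodAssoc (expMeasure (1 - lam)) (expSeq lam) (expSeq 1)
  have m5 : MeasurePreserving (fun p : ℝ × ((ℕ → ℝ) × (ℕ → ℝ)) =>
      run burkeOut burkeNext p.1 p.2.1 p.2.2)
      ((expMeasure (1 - lam)).prod ((expSeq lam).prod (expSeq 1))) (expSeq lam) :=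
    ⟨measurable_run measurable_burkeOut measurable_burkeNext,
      map_run_of_invariant measurable_burkeOut measurable_burkeNext (map_burke h0 h1)⟩
  exact m5.comp (m4.comp (m3.comp (m2.comp (m1.comp (h.measurePreserving_service (-1))))))

/-- The queue formed by the cars at the site `1` coalesces with the stationary queue. -/
lemma ae_eventually_mem_range_stationary (h : IsInput P lam y d) (h0 : 0 < lam) (h1 : lam < 1) :
    ∀ᵐ ω ∂P, ∀ᶠ x in atTop, (x ∈ Set.range (firstPhase y d ω)
      ↔ x ∈ Set.range (psum (stationaryGaps lam y d ω))) := by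
  have := h.isProbabilityMeasure_sites
  have := isProbabilityMeasure_expSeq h0
  have hb : 0 < 1 - lam := sub_pos.2 h1
  have m1 := ((h.measurePreserving_afterGaps h0 0).prod (MeasurePreserving.id (expSeq 1))).comp
    h.measurePreserving_firstService
  have hgt := m1.quasiMeasurePreserving.ae (ae_exists_psum_gt_all h0 h1.le)
  have hpg := (h.measurePreserving_stationaryGaps h0 h1).quasiMeasurePreserving.ae
    (ae_pos_expSeq h0)
  filter_upwards [h.ae_isSites, h.label_y, h.ae_firstPhase_eq, h.ae_pos_firstService,
    h.ae_strictMono_firstPhase, hgt, hpg, h.ae_pos_clock] with ω h1 h2 h3 h4 h5 h6 h7 h8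
  set u : ℤ → ℝ := fun j => y j ω with hu
  set e := firstService y d ω
  set w := sojourn lam d ω with hw
  have hw0 : 0 < w := mul_pos (by positivity) (h8 _)
  have hι : firstIndex (-w) u ≤ 1 := by
    by_contra hlt
    have := (h1.isFirst_firstIndex (-w)).1 1 (not_le.1 hlt)
    linarith [h2.2]
  have hM : ((early w u : ℕ) : ℤ) = 1 - firstIndex (-w) u := by rw [early]; omega
  -- the labelling puts the site `1` first to the right of the origin
  have hone : firstIndex 0 u = 1 := by
    refine firstIndex_eq ⟨fun j hj => (h1.strictMono.monotone (by omega)).trans h2.1,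
      fun j hj => h2.2.trans_le (h1.strictMono.monotone hj)⟩
  have hz : ∀ C : ℝ, ∃ k, psum e k + C < u (1 + k) := by
    intro C
    obtain ⟨k, hk⟩ := h6 C
    refine ⟨k, ?_⟩
    simp only [Function.comp_apply, Prod.map_apply, id_eq, psum_afterGaps, after, sub_zero] at hk
    rw [hone] at hk
    exact hk
  -- after the early customers the stationary queue has the arrivals and service times of the
  -- site `1`
  obtain ⟨c', hc'⟩ := exists_lindley_add 0 (after (-w) u) (stationaryService lam y d ω) (early w u)
  have e1 : (fun k => after (-w) u (early w u + k)) = fun k : ℕ => u (1 + k) := by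
    funext k
    rw [after]
    congr 1
    push_cast
    omega
  have e2 : (fun k => stationaryService lam y d ω (early w u + k)) = e := by
    funext k
    exact splice_add _ _ _ k
  rw [e1, e2] at hc'
  obtain ⟨N, hN⟩ := exists_lindley_eq h4 hz 0 c'
  refine eventually_mem_range_iff (m := N) (n := early w u + N) h5 (psum_strictMono h7) fun k => ?_
  rw [h3, psum_stationaryGaps, add_assoc, hc', hN]

/-- In the underloaded case the cars pass the first site like the departures from a queue in
equilibrium. -/
theorem exists_gaps_of_lt_one (h : IsInput P lam y d) (h0 : 0 < lam) (h1 : lam < 1) (n : ℕ) :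
    ∃ g : ℝ → Ω → ℕ → ℝ, (∀ t, Measurable (g t) ∧ P.map (g t) = expSeq lam) ∧
      Tendsto (fun t => P {ω | (shifted (firstPhase y d ω) t).1 ∩ window n
        ≠ (windowConfig n (g t ω)).1 ∩ window n}) atTop (𝓝 0) := by
  -- the point to the left of the window from which the departures are counted
  let τ : ℝ → ℝ := fun t => t - (n + 1)
  have mg := h.measurePreserving_stationaryGaps h0 h1
  have hpg := mg.quasiMeasurePreserving.ae (ae_pos_expSeq h0)
  have hug := mg.quasiMeasurePreserving.ae (ae_exists_lt_psum h0)
  have hmg : ∀ᵐ ω ∂P, StrictMono (psum (stationaryGaps lam y d ω)) := by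
    filter_upwards [hpg] with ω hω using psum_strictMono hω
  -- the partial sums of the stationary gaps are the departures from a server that is never idle, so
  -- that `map_restart` applies
  have mr : ∀ t, MeasurePreserving (restart t 0 fun _ => 0) (expSeq lam) (expSeq lam) := fun t =>
    ⟨(measurable_restart t).comp (f := fun e : ℕ → ℝ => ((0 : ℝ), (fun _ : ℕ => (0 : ℝ)), e))
      (by fun_prop), map_restart h0 t 0 _ (ae_exists_firstAfter_zero h0 t)⟩
  refine ⟨fun t ω => restart (τ t) 0 (fun _ => 0) (stationaryGaps lam y d ω), fun t =>
    ⟨((mr (τ t)).comp mg).measurable, ((mr (τ t)).comp mg).map_eq⟩, ?_⟩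
  have hlim := tendsto_measure_window_ne (P := P) (n := n) h.aemeasurable_shifted_firstPhase
    (Y := fun t ω => shifted (psum (stationaryGaps lam y d ω)) t)
    (aemeasurable_shifted (measurable_psum.comp mg.measurable) hmg hug) (by
      filter_upwards [h.ae_eventually_mem_range_stationary h0 h1, h.ae_strictMono_firstPhase,
        h.ae_exists_lt_firstPhase, hmg, hug] with ω h2 h3 h4 h5 h6
      filter_upwards [eventually_forall_window h2 n] with t ht
      ext x
      refine and_congr_left fun hx => ?_
      rw [mem_shifted_iff h3 h4, mem_shifted_iff h5 h6]
      exact ht x hx)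
  refine tendsto_of_tendsto_of_tendsto_of_le_of_le' tendsto_const_nhds hlim
    (Eventually.of_forall fun _ => bot_le) ?_
  filter_upwards [eventually_ge_atTop ((n : ℝ) + 1)] with t ht
  have ht' : 0 ≤ τ t := sub_nonneg.2 ht
  refine measure_mono_ae ?_
  have hr := ((mr (τ t)).comp mg).quasiMeasurePreserving.ae (ae_pos_expSeq h0)
  have hr' := ((mr (τ t)).comp mg).quasiMeasurePreserving.ae (ae_exists_lt_psum h0)
  filter_upwards [hpg, hug, hmg, hr, hr'] with ω h2 h3 h4 h5 h6
  intro hne heq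
  refine hne (heq.trans ?_)
  simp only [Function.comp_apply] at h5 h6
  ext x
  refine and_congr_left fun hx => ?_
  rw [mem_shifted_iff h4 h3, windowConfig, mem_shifted_iff (psum_strictMono h5) h6,
    ← lindley_zero h2]
  obtain ⟨k, hk⟩ := h3 (τ t)
  obtain ⟨m, hm⟩ := exists_firstAfter (c := 0) (z := fun _ => 0) ⟨k, by rwa [lindley_zero h2]⟩
  have := mem_range_lindley_iff (L := 2 * n + 1) h2 ht' hm (fun _ => Or.inl ht')
    (s := x + (n + 1)) (by linarith [hx.1]) (by linarith [hx.2])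
  rw [← this]
  simp only [τ]
  rw [show t - ((n : ℝ) + 1) + (x + (n + 1)) = x + t by ring]

end IsInput

/-! ### The limit -/

lemma encard_image_mul_inter {s : ℝ} (hs : s ≠ 0) (X B : Set ℝ) :
    ((s * ·) '' X ∩ B).encard = (X ∩ (s * ·) ⁻¹' B).encard := by
  rw [← Set.image_inter_preimage]
  exact (mul_right_injective₀ hs).encard_image _

/-- The law of a random configuration whose points are those of a Poisson process, multiplied by
`s`, makes the identity of the space of configurations a Poisson process. -/
lemma IsPoissonProcess.map_config {Ω : Type*} [MeasurableSpace Ω] {P : Measure Ω}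
    [IsProbabilityMeasure P] {ν : Measure ℝ} {X : Ω → Set ℝ} (hX : IsPoissonProcess P ν X) {s : ℝ}
    (hs : s ≠ 0) {V : Ω → Config} (hV : AEMeasurable V P)
    (hVX : ∀ᵐ ω ∂P, (V ω).1 = (s * ·) '' X ω) :
    IsPoissonProcess (P.map V) (ν.map (s * ·)) fun S : Config => S.1 := by
  have := Measure.isProbabilityMeasure_map hV
  have hm : Measurable fun x : ℝ => s * x := by fun_prop
  have hcount : ∀ B : Set ℝ, (fun ω => ((V ω).1 ∩ B).encard)
      =ᵐ[P] fun ω => (X ω ∩ (s * ·) ⁻¹' B).encard := fun B => by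
    filter_upwards [hVX] with ω hω
    rw [hω, encard_image_mul_inter hs]
  have hlaw : ∀ B : Set ℝ, MeasurableSet B → (P.map V).map (fun S : Config => (S.1 ∩ B).encard)
      = P.map fun ω => (X ω ∩ (s * ·) ⁻¹' B).encard := fun B hB => by
    rw [AEMeasurable.map_map_of_aemeasurable (measurable_encard_inter hB).aemeasurable hV]
    exact Measure.map_congr (hcount B)
  refine ⟨fun B hB => measurable_encard_inter hB, fun B hB hfin => ?_, fun n B hB hdisj => ?_⟩
  · rw [Measure.map_apply hm hB] at hfin ⊢
    rw [hlaw B hB, hX.law_count _ (hm hB) hfin]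
  · have hi := hX.indep_count n (fun l => (s * ·) ⁻¹' B l) (fun l => hm (hB l))
      fun l m hlm => (hdisj hlm).preimage _
    rw [iIndepFun_iff_map_fun_eq_pi_map
      fun l => (hX.measurable_count _ (hm (hB l))).aemeasurable] at hi
    rw [iIndepFun_iff_map_fun_eq_pi_map fun l => (measurable_encard_inter (hB l)).aemeasurable]
    simp only [fun l => hlaw (B l) (hB l)]
    rw [← hi, AEMeasurable.map_map_of_aemeasurable
      (measurable_pi_lambda _ fun l => measurable_encard_inter (hB l)).aemeasurable hV]
    refine Measure.map_congr ?_
    filter_upwards [ae_all_iff.2 fun l => hcount (B l)] with ω hω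
    funext l
    exact hω l

lemma map_mul_homogeneous {r lam : ℝ} (hr : 0 < r) (hlam : 0 < lam) :
    (homogeneous lam).map (fun x => lam / r * x) = homogeneous r := by
  rw [homogeneous, Measure.map_smul, Real.map_volume_mul_left (by positivity), smul_smul,
    ← ENNReal.ofReal_mul hlam.le, abs_of_pos (by positivity), homogeneous]
  congr 2
  field_simp

lemma IsSites.isLocFinite_range {y : ℤ → ℝ} (hy : IsSites y) : IsLocFinite (Set.range y) := by
  intro K hK
  obtain ⟨a, ha⟩ := hK.bddBelow
  obtain ⟨b, hb⟩ := hK.bddAbove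
  obtain ⟨i, hi⟩ := hy.exists_lt a
  obtain ⟨j, hj⟩ := hy.exists_gt b
  refine ((Set.finite_Icc i j).image y).subset ?_
  rintro _ ⟨⟨k, rfl⟩, hk⟩
  exact ⟨k, ⟨hy.strictMono.le_iff_le.1 (hi.le.trans (ha hk)),
    hy.strictMono.le_iff_le.1 ((hb hk).trans hj.le)⟩, rfl⟩

lemma IsSites.const_mul {y : ℤ → ℝ} (hy : IsSites y) {s : ℝ} (hs : 0 < s) :
    IsSites fun i => s * y i := by
  refine ⟨fun i j hij => mul_lt_mul_of_pos_left (hy.strictMono hij) hs, fun a => ?_, fun a => ?_⟩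
  · obtain ⟨i, hi⟩ := hy.exists_gt (a / s)
    exact ⟨i, (div_lt_iff₀' hs).1 hi⟩
  · obtain ⟨i, hi⟩ := hy.exists_lt (a / s)
    exact ⟨i, (lt_div_iff₀' hs).1 hi⟩

/-- The configuration of the sites, multiplied by `s`. -/
def scaledSites {Ω : Type*} (s : ℝ) (y : ℤ → Ω → ℝ) (ω : Ω) : Config :=
  toConfig (Set.range fun i => s * y i ω)

namespace IsInput

variable {Ω : Type*} [MeasurableSpace Ω] {P : Measure Ω} {lam : ℝ} {y : ℤ → Ω → ℝ}
  {d : ℤ → ℕ → Ω → ℝ}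

lemma ae_scaledSites_eq (h : IsInput P lam y d) {s : ℝ} (hs : 0 < s) :
    ∀ᵐ ω ∂P, (scaledSites s y ω).1 = (s * ·) '' Set.range fun i => y i ω := by
  filter_upwards [h.ae_isSites] with ω hω
  rw [scaledSites, toConfig_coe (hω.const_mul hs).isLocFinite_range, ← Set.range_comp]
  rfl

lemma aemeasurable_scaledSites (h : IsInput P lam y d) {s : ℝ} (hs : 0 < s) :
    AEMeasurable (scaledSites s y) P := by
  refine aemeasurable_toConfig (x := fun i ω => s * y i ω) (A := fun _ => Set.univ)
    (fun i => (h.measurable_y i).const_mul s) (fun _ => MeasurableSet.univ)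
    (ae_of_all _ fun ω => ?_) ?_ ?_
  · ext x
    simp
  · filter_upwards [h.ae_isSites] with ω hω using (hω.const_mul hs).isLocFinite_range
  · filter_upwards [h.ae_isSites] with ω hω i j _ _ hij
    exact (hω.const_mul hs).strictMono.injective hij

variable [IsProbabilityMeasure P]

/-- In a window the scaled sites are points with independent exponential distances. -/
lemma exists_gaps_scaledSites (h : IsInput P lam y d) (hlam : 0 < lam) {r : ℝ} (hr : 0 < r)
    (n : ℕ) : ∃ g : Ω → ℕ → ℝ, Measurable g ∧ P.map g = expSeq r ∧ ∀ᵐ ω ∂P,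
      (scaledSites (lam / r) y ω).1 ∩ window n = (windowConfig n (g ω)).1 ∩ window n := by
  have hs : 0 < lam / r := by positivity
  set s := lam / r with hsdef
  -- the point that is scaled to the left of the window
  let c : ℝ := -(n + 1) / s
  have hsc : s * c = -(n + 1) := by simp only [c]; field_simp
  have m1 := h.measurePreserving_afterGaps hlam c
  have m2 : MeasurePreserving (fun x k => s * x k : (ℕ → ℝ) → ℕ → ℝ) (expSeq lam) (expSeq r) :=
    ⟨by fun_prop, map_const_mul_expSeq hr hlam⟩
  have m := (m2.comp m1).comp (⟨h.measurable_sites, rfl⟩ :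
    MeasurePreserving (fun ω i => y i ω) P (P.map fun ω i => y i ω))
  refine ⟨_, m.measurable, m.map_eq, ?_⟩
  filter_upwards [h.ae_isSites, h.ae_scaledSites_eq hs] with ω hω hV
  have hp : psum (fun k => s * afterGaps c (fun i => y i ω) k)
      = fun k => s * after c (fun i => y i ω) k + (n + 1) := by
    funext k
    rw [psum_mul, psum_afterGaps, mul_sub, hsc, sub_neg_eq_add]
  have hmono : StrictMono (psum fun k => s * afterGaps c (fun i => y i ω) k) := by
    rw [hp]
    intro k l hkl
    have := mul_lt_mul_of_pos_left (hω.after_strictMono c hkl) hs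
    simp only
    linarith
  have hub : ∀ C, ∃ k, C < psum (fun k => s * afterGaps c (fun i => y i ω) k) k := by
    intro C
    obtain ⟨i, hi⟩ := hω.exists_gt (max c ((C - (n + 1)) / s))
    obtain ⟨k, hk⟩ := (hω.mem_range_after_iff ((le_max_left _ _).trans_lt hi)).2 ⟨i, rfl⟩
    refine ⟨k, ?_⟩
    rw [hp]
    have := (div_lt_iff₀' hs).1 ((le_max_right _ _).trans_lt hi)
    simp only [hk]
    linarith
  ext x
  refine and_congr_left fun hx => ?_
  have hcx : c < x / s := by
    rw [lt_div_iff₀' hs, hsc]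
    linarith [hx.1]
  rw [hV]
  change _ ↔ x ∈ (shifted (psum fun k => s * afterGaps c (fun i => y i ω) k) (n + 1)).1
  rw [mem_shifted_iff hmono hub, hp]
  have h1 := hω.mem_range_after_iff hcx
  constructor
  · rintro ⟨_, hz, rfl⟩
    simp only [mul_div_cancel_left₀ _ hs.ne'] at h1
    obtain ⟨k, hk⟩ := h1.2 hz
    exact ⟨k, by simp only [hk]⟩
  · rintro ⟨k, hk⟩
    refine ⟨x / s, h1.1 ⟨k, ?_⟩, by simp only; field_simp⟩
    rw [eq_div_iff hs.ne']
    simp only at hk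
    linarith

/-- In a window and at a late time the moving cars are, up to an event of small probability, points
with independent exponential distances. -/
lemma exists_gaps_movingCars (h : IsInput P lam y d) (hlam : 0 < lam) (n : ℕ) :
    ∃ g : ℝ → Ω → ℕ → ℝ, (∀ᶠ t in atTop, Measurable (g t) ∧ P.map (g t) = expSeq (min 1 lam)) ∧
      Tendsto (fun t => P {ω |
        (toConfig (movingCars (fun i => y i ω) (fun i k => d i k ω) t)).1 ∩ window n
          ≠ (windowConfig n (g t ω)).1 ∩ window n}) atTop (𝓝 0) := by
  obtain ⟨g, hg, hlim⟩ : ∃ g : ℝ → Ω → ℕ → ℝ,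
      (∀ t, Measurable (g t) ∧ P.map (g t) = expSeq (min 1 lam)) ∧
      Tendsto (fun t => P {ω | (shifted (firstPhase y d ω) t).1 ∩ window n
        ≠ (windowConfig n (g t ω)).1 ∩ window n}) atTop (𝓝 0) := by
    rcases le_or_gt 1 lam with h1 | h1
    · rw [min_eq_left h1]
      exact h.exists_gaps_of_one_le h1 n
    · rw [min_eq_right h1.le]
      exact h.exists_gaps_of_lt_one hlam h1 n
  refine ⟨g, Eventually.of_forall hg, ?_⟩
  have hsum := (tendsto_measure_window_ne h.aemeasurable_movingCars
    h.aemeasurable_shifted_firstPhase (h.ae_eventually_movingCars_eq n)).add hlim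
  rw [add_zero] at hsum
  refine tendsto_of_tendsto_of_tendsto_of_le_of_le tendsto_const_nhds hsum (fun _ => zero_le) ?_
  intro t
  refine (measure_mono fun ω hω => ?_).trans (measure_union_le _ _)
  by_contra hcon
  simp only [Set.mem_union, Set.mem_ofPred_eq, not_or, not_not] at hcon
  exact hω (hcon.1.trans hcon.2)

end IsInput

end Traffic

theorem proposition1 {Ω : Type*} [MeasurableSpace Ω] (P : Measure Ω) [IsProbabilityMeasure P]
    (lam : ℝ) (hlam : 0 < lam) (y : ℤ → Ω → ℝ) (d : ℤ → ℕ → Ω → ℝ)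
    (hyd : Traffic.IsInput P lam y d) :
    (∀ᵐ ω ∂P, ∀ K : Set ℝ, IsCompact K →
      ∀ᶠ t : ℝ in atTop,
        Traffic.jams (fun i => y i ω) (fun i k => d i k ω) t ∩ K = ∅) ∧
    (∀ᵐ ω ∂P, ∀ t : ℝ, 0 ≤ t →
      Traffic.IsLocFinite (Traffic.movingCars (fun i => y i ω) (fun i k => d i k ω) t)) ∧
    ∃ Q : ProbabilityMeasure Traffic.Config,
      Traffic.IsPoissonProcess (Q : Measure Traffic.Config) (Traffic.homogeneous (min 1 lam))
        (fun S => S.1) ∧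
      TendstoInDistribution
        (fun (t : ℝ) ω =>
          Traffic.toConfig (Traffic.movingCars (fun i => y i ω) (fun i k => d i k ω) t))
        atTop (id : Traffic.Config → Traffic.Config) (fun _ => P) (Q : Measure Traffic.Config) := by
  refine ⟨?_, ?_, ?_⟩
  · filter_upwards [hyd.ae_isSites, hyd.ae_strictMono_clock, hyd.ae_exists_phase_lt]
      with ω h1 h2 h3 K hK
    exact Traffic.eventually_jams_inter_eq_empty h1 h2 h3 hK
  · filter_upwards [hyd.ae_isLocFinite_movingCars] with ω hω t _ using hω t
  · have hr : 0 < min 1 lam := lt_min one_pos hlam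
    have hs : 0 < lam / min 1 lam := by positivity
    have hV := hyd.aemeasurable_scaledSites hs
    refine ⟨⟨P.map (Traffic.scaledSites (lam / min 1 lam) y),
      Measure.isProbabilityMeasure_map hV⟩, ?_, ?_⟩
    · have := hyd.poisson_y.map_config hs.ne' hV (hyd.ae_scaledSites_eq hs)
      rwa [Traffic.map_mul_homogeneous hr hlam] at this
    · exact Traffic.tendstoInDistribution_of_window hyd.aemeasurable_movingCars hV _ rfl
        (fun n => Traffic.aemeasurable_windowConfig hr n)
        (fun n => hyd.exists_gaps_scaledSites hlam hr n)
        (fun n => hyd.exists_gaps_movingCars hlam n)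

end
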